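/- **Setting.** Let $(\mathcal C,\mathbb E,\mathfrak s)$ be a small extriangulated category (Nakaoka–Palu) with enough $\mathbb E$-injectives: every $A$ admits a conflation $A\to I\to Z$ with $I$ in the class $\mathcal I_{\mathbb E}(\mathcal C)$ of $\mathbb E$-injective objects. Let $\mathbb E^1=\mathbb E$ and $\mathbb E^{i+1}(X,A)=\int^{Z\in\mathcal C}\mathbb E(Z,A)\otimes_{\mathbb Z}\mathbb E^{i}(X,Z)$ be the higher extension groups. Let $n\ge 0$ and let $\mathcal X=\mathrm{add}(\mathcal X)\subseteq\mathcal C$ be an $(n+2)$-rigid full subcategory, i.e. $\mathbb E^i(X,X')=0$ for $X,X'\in\mathcal X$, $1\le i\le n+1$, with $\mathcal I_{\mathbb E}(\mathcal C)\subseteq\mathcal X$. Let $\mathcal X^\wedge_m$ be the full subcategory of objects with an $\mathcal X$-resolution of length at most $m$ (spliced from conflations), $[\mathcal X]$ the ideal of morphisms of $\mathcal X^\wedge_{n+1}$ factoring through an object of $\mathcal X$, and $\mathcal M_2:=\mathcal X^\wedge_{n+1}/[\mathcal X]$. Let $\overline{\mathcal X^\wedge_n}$ be the quotient of $\mathcal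 X^\wedge_n$ by the ideal of morphisms $f$ with $\mathbb E(-,f)=0$. The assignment $M\mapsto\mathbb E(M,-)|_{\mathcal X^\wedge_n}$ induces a contravariant functor $\mathbb K$ from $\mathcal M_2$ to the additive functors $\overline{\mathcal X^\wedge_n}\to\mathrm{Ab}$. Let $\mathcal L^n_{\mathcal X}$ be the full subcategory of those additive functors $G$ admitting an exact sequence $\overline{\mathcal X^\wedge_n}(X_0,-)\to\overline{\mathcal X^\wedge_n}(X_1,-)\to G\to0$ with $X_0\in\mathcal X$, $X_1\in\mathcal X^\wedge_n$. Let $\varepsilon_2:=\varepsilon_{\mathbb K}$ be the class of sequences $K\to M\to N$ in $\mathcal M_2$ for which $0\to\mathbb K(N)\to\mathbb K(M)\to\mathbb K(K)\to0$ is exact. For an exact category $(\mathcal M,\varepsilon)$, let $\varepsilon(\mathcal M)$ be the category of conflations of $\mathcal M$ (morphisms are commutative diagrams) with its degreewise exact structure, and let $\mathcal S(\mathcal M)$ be the class of split conflations. A class $\mathcal D$ in an exact category is *pseudo-cluster tilting* if $\mathcal D=\mathrm{add}(\mathcal D)$ and every object $M$ admits conflations $M\xrightarrow{\alpha}D_0\to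 D_1$ and $D_1'\to D_0'\xrightarrow{\beta}M$ with $D_0,D_1,D_0',D_1'\in\mathcal D$, $\alpha$ a $\mathcal D$-preenvelope and $\beta$ a $\mathcal D$-precover. $\mathcal D^\wedge_1$ and $\mathcal D^\vee_1$ are the classes of objects of $\mathcal D$-resolution, resp. $\mathcal D$-coresolution, dimension at most $1$. **Theorem.** In this setting $\mathbb K$ is well defined on $\mathcal M_2$, $(\mathcal M_2,\varepsilon_2)$ is a weakly idempotent complete exact category, $\mathbb K:\mathcal M_2\to\mathcal L^n_{\mathcal X}$ is a duality, the category of conflations $\varepsilon_2(\mathcal M_2)$ is exact with the degreewise structure, and: (a) $\mathcal S(\mathcal M_2)$ is a pseudo-cluster tilting subcategory of $\varepsilon_2(\mathcal M_2)$. In particular $\varepsilon_2(\mathcal M_2)=\mathcal S(\mathcal M_2)^\wedge_1=\mathcal S(\mathcal M_2)^\vee_1$. (b) The quotient $\varepsilon_2(\mathcal M_2)/[\mathcal S(\mathcal M_2)]$ is an abelian category. (c) Let $\eta:K\xrightarrow{[a]}M\xrightarrow{[b]}N$ be a conflation in $\mathcal M_2$. Then $\eta\in\mathcal S(\mathcal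 M_2)$ if and only if there exist $X\in\mathcal X$, $I\in\mathcal I_{\mathbb E}(\mathcal C)$, $N'\in\mathcal X^\wedge_{n+1}$ and a split $\mathbb E$-triangle $$K\xrightarrow{(a,f,i)^t}M\oplus X\oplus I\xrightarrow{\,b'\,}N'\dashrightarrow$$ in $\mathcal C$, together with an isomorphism $\varphi:\mathbb K(N')\to\mathbb K(N)$ such that $\mathbb K(N')\xrightarrow{\mathbb K[b']}\mathbb K(M)\xrightarrow{\mathbb K[a]}\mathbb K(K)$ is a conflation in $\mathcal L^n_{\mathcal X}$ and $\mathbb K[b]\circ\varphi=\mathbb K[b']$; here $\mathbb K(M\oplus X\oplus I)$ is identified with $\mathbb K(M)$ via the inclusion $M\to M\oplus X\oplus I$. -/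

import Mathlib

open CategoryTheory CategoryTheory.Limits Opposite
open scoped TensorProduct DirectSum

universe u v w

namespace ConflationQuotient

/-! ### Ideals of preadditive categories and their quotients -/

/-- A two-sided ideal of morphisms of a preadditive category. -/
structure HomIdeal (A : Type w) [Category.{v} A] [Preadditive A] where
  carrier : ∀ X Y : A, AddSubgroup (X ⟶ Y)
  precomp_mem : ∀ {X Y Z : A} (f : X ⟶ Y) {g : Y ⟶ Z}, g ∈ carrier Y Z → f ≫ g ∈ carrier X Z
  postcomp_mem : ∀ {X Y Z : A} {f : X ⟶ Y} (g : Y ⟶ Z), f ∈ carrier X Y → f ≫ g ∈ carrier X Z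

namespace HomIdeal

variable {A : Type w} [Category.{v} A] [Preadditive A] (I : HomIdeal A)

/-- Two parallel morphisms are identified when their difference lies in the ideal. -/
def rel : HomRel A := fun X Y f g => f - g ∈ I.carrier X Y

instance : Congruence I.rel where
  comp_left f g g' h := by
    have := I.precomp_mem f h
    rwa [Preadditive.comp_sub] at this
  comp_right g h := by
    have := I.postcomp_mem g h
    rwa [Preadditive.sub_comp] at this
  equivalence :=
    { refl := fun f => by
        change f - f ∈ _
        rw [sub_self]
        exact zero_mem _
      symm := fun {f g} h => by
        change g - f ∈ _
        rw [← neg_sub]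
        exact neg_mem h
      trans := fun {f g k} h h' => by
        change f - k ∈ _
        rw [← sub_add_sub_cancel f g k]
        exact add_mem h h' }

/-- The quotient category by an ideal: same objects, morphisms modulo the ideal. -/
abbrev Quot : Type w := CategoryTheory.Quotient I.rel

instance : Preadditive (CategoryTheory.Quotient I.rel) :=
  CategoryTheory.Quotient.preadditive I.rel (fun X Y f₁ f₂ g₁ g₂ h h' => by
    change f₁ + g₁ - (f₂ + g₂) ∈ _
    rw [add_sub_add_comm]
    exact add_mem h h')

/-- The quotient functor. -/
abbrev proj : A ⥤ I.Quot := CategoryTheory.Quotient.functor I.rel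

/-- The ideal `[P]` generated by the morphisms which factor through an object of `P`.
See `mem_ofObjects_iff`: if `P` is closed under finite coproducts, it consists exactly of the
morphisms which factor through an object of `P`. -/
def ofObjects (P : ObjectProperty A) : HomIdeal A where
  carrier X Y := AddSubgroup.closure
    {f | ∃ (Z : A) (s : X ⟶ Z) (t : Z ⟶ Y), P Z ∧ s ≫ t = f}
  precomp_mem {X Y Z} f g hg := by
    induction hg using AddSubgroup.closure_induction with
    | mem g hg =>
      obtain ⟨W, s, t, hW, rfl⟩ := hg
      exact AddSubgroup.subset_closure ⟨W, f ≫ s, t, hW, by simp⟩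
    | zero => simp
    | add g g' _ _ h h' => rw [Preadditive.comp_add]; exact add_mem h h'
    | neg g _ h => rw [Preadditive.comp_neg]; exact neg_mem h
  postcomp_mem {X Y Z} f g hf := by
    induction hf using AddSubgroup.closure_induction with
    | mem f hf =>
      obtain ⟨W, s, t, hW, rfl⟩ := hf
      exact AddSubgroup.subset_closure ⟨W, s, t ≫ g, hW, by simp⟩
    | zero => simp
    | add f f' _ _ h h' => rw [Preadditive.add_comp]; exact add_mem h h'
    | neg f _ h => rw [Preadditive.neg_comp]; exact neg_mem h

theorem mem_ofObjects_iff (P : ObjectProperty A) (hne : ∃ Z, P Z)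
    (hP : ∀ Z Z' : A, P Z → P Z' → ∃ c : BinaryCofan Z Z', Nonempty (IsColimit c) ∧ P c.pt)
    {X Y : A} (f : X ⟶ Y) :
    f ∈ (ofObjects P).carrier X Y ↔ ∃ (Z : A) (s : X ⟶ Z) (t : Z ⟶ Y), P Z ∧ s ≫ t = f := by
  constructor
  · intro hf
    change f ∈ AddSubgroup.closure _ at hf
    induction hf using AddSubgroup.closure_induction with
    | mem f hf => exact hf
    | zero =>
      obtain ⟨Z, hZ⟩ := hne
      exact ⟨Z, 0, 0, hZ, by simp⟩
    | add f g _ _ hf hg =>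
      obtain ⟨Z, s, t, hZ, rfl⟩ := hf
      obtain ⟨Z', s', t', hZ', rfl⟩ := hg
      obtain ⟨c, ⟨hc⟩, hcP⟩ := hP Z Z' hZ hZ'
      let l : Z ⟶ c.pt := c.inl
      let r : Z' ⟶ c.pt := c.inr
      let d : c.pt ⟶ Y := hc.desc (BinaryCofan.mk t t')
      refine ⟨c.pt, s ≫ l + s' ≫ r, d, hcP, ?_⟩
      have h₁ : l ≫ d = t :=
        hc.fac (BinaryCofan.mk t t') ⟨WalkingPair.left⟩
      have h₂ : r ≫ d = t' :=
        hc.fac (BinaryCofan.mk t t') ⟨WalkingPair.right⟩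
      rw [Preadditive.add_comp, Category.assoc, Category.assoc, h₁, h₂]
    | neg f _ hf =>
      obtain ⟨Z, s, t, hZ, rfl⟩ := hf
      exact ⟨Z, -s, t, hZ, by simp⟩
  · intro h
    exact AddSubgroup.subset_closure h

end HomIdeal

/-! ### Classes of objects -/

section Classes

variable {A : Type w} [Category.{v} A]

/-- `free(P)`: the finite coproducts (possibly empty) of objects of `P`. -/
def free (P : ObjectProperty A) : ObjectProperty A := fun Y =>
  ∃ (m : ℕ) (X : Fin m → A) (i : ∀ j, X j ⟶ Y),
    (∀ j, P (X j)) ∧ Nonempty (IsColimit (Cofan.mk Y i))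

/-- `smd(P)`: the direct summands of objects of `P`. -/
def smd (P : ObjectProperty A) : ObjectProperty A := fun Y =>
  ∃ (Y' : A) (c : BinaryCofan Y Y'), Nonempty (IsColimit c) ∧ P c.pt

/-- `add(P) = smd(free(P))`. -/
def add (P : ObjectProperty A) : ObjectProperty A := smd (free P)

/-- `f : M ⟶ D` is a `P`-preenvelope of `M`. -/
def IsPreenvelope (P : ObjectProperty A) {M D : A} (f : M ⟶ D) : Prop :=
  P D ∧ ∀ ⦃D' : A⦄, P D' → ∀ g : M ⟶ D', ∃ h : D ⟶ D', f ≫ h = g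

/-- `f : D ⟶ M` is a `P`-precover of `M`. -/
def IsPrecover (P : ObjectProperty A) {D M : A} (f : D ⟶ M) : Prop :=
  P D ∧ ∀ ⦃D' : A⦄, P D' → ∀ g : D' ⟶ M, ∃ h : D' ⟶ D, h ≫ f = g

/-- `HasResolution conf P k Z`: there is a finite `P`-resolution
`0 → X_k → ⋯ → X_0 → Z → 0` of length `k`, spliced from sequences satisfying `conf`. -/
def HasResolution (conf : ∀ ⦃X Y Z : A⦄, (X ⟶ Y) → (Y ⟶ Z) → Prop) (P : ObjectProperty A) :
    ℕ → ObjectProperty A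
  | 0 => fun Z => ∃ X, P X ∧ Nonempty (X ≅ Z)
  | k + 1 => fun Z => ∃ (K X : A) (i : K ⟶ X) (p : X ⟶ Z),
      conf i p ∧ P X ∧ HasResolution conf P k K

/-- `HasCoresolution conf P k Z`: there is a finite `P`-coresolution
`0 → Z → X_0 → ⋯ → X_k → 0` of length `k`, spliced from sequences satisfying `conf`. -/
def HasCoresolution (conf : ∀ ⦃X Y Z : A⦄, (X ⟶ Y) → (Y ⟶ Z) → Prop) (P : ObjectProperty A) :
    ℕ → ObjectProperty A
  | 0 => fun Z => ∃ X, P X ∧ Nonempty (Z ≅ X)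
  | k + 1 => fun Z => ∃ (X L : A) (i : Z ⟶ X) (p : X ⟶ L),
      conf i p ∧ P X ∧ HasCoresolution conf P k L

/-- The class `P^∧_n` of the objects of `P`-resolution dimension at most `n`. -/
def resDimLE (conf : ∀ ⦃X Y Z : A⦄, (X ⟶ Y) → (Y ⟶ Z) → Prop) (P : ObjectProperty A)
    (n : ℕ) : ObjectProperty A := fun Z => ∃ k ≤ n, HasResolution conf P k Z

/-- The class `P^∨_n` of the objects of `P`-coresolution dimension at most `n`. -/
def coresDimLE (conf : ∀ ⦃X Y Z : A⦄, (X ⟶ Y) → (Y ⟶ Z) → Prop) (P : ObjectProperty A)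
    (n : ℕ) : ObjectProperty A := fun Z => ∃ k ≤ n, HasCoresolution conf P k Z

end Classes

/-! ### Exact categories and categories of conflations -/

section Exact

variable {A : Type w} [Category.{v} A] [Preadditive A]

/-- The pair `(f, g)` is a short sequence belonging to the class `ε`. -/
def IsConflation (ε : ObjectProperty (ShortComplex A)) ⦃X Y Z : A⦄ (f : X ⟶ Y) (g : Y ⟶ Z) :
    Prop := ∃ zero : f ≫ g = 0, ε (ShortComplex.mk f g zero)

/-- Admissible monomorphisms. -/
def IsAdmMono (ε : ObjectProperty (ShortComplex A)) ⦃X Y : A⦄ (f : X ⟶ Y) : Prop :=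
  ∃ (Z : A) (g : Y ⟶ Z), IsConflation ε f g

/-- Admissible epimorphisms. -/
def IsAdmEpi (ε : ObjectProperty (ShortComplex A)) ⦃Y Z : A⦄ (g : Y ⟶ Z) : Prop :=
  ∃ (X : A) (f : X ⟶ Y), IsConflation ε f g

/-- `(A, ε)` is an exact category (in the sense of Quillen). -/
structure IsExactCategory (ε : ObjectProperty (ShortComplex A)) : Prop where
  additive : HasFiniteBiproducts A
  isLimit : ∀ S, ε S → Nonempty (IsLimit (KernelFork.ofι S.f S.zero))
  isColimit : ∀ S, ε S → Nonempty (IsColimit (CokernelCofork.ofπ S.g S.zero))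
  of_iso : ∀ S S' : ShortComplex A, (S ≅ S') → ε S → ε S'
  id_admMono : ∀ X : A, IsAdmMono ε (𝟙 X)
  id_admEpi : ∀ X : A, IsAdmEpi ε (𝟙 X)
  comp_admMono : ∀ ⦃X Y Z : A⦄ (f : X ⟶ Y) (g : Y ⟶ Z),
    IsAdmMono ε f → IsAdmMono ε g → IsAdmMono ε (f ≫ g)
  comp_admEpi : ∀ ⦃X Y Z : A⦄ (f : X ⟶ Y) (g : Y ⟶ Z),
    IsAdmEpi ε f → IsAdmEpi ε g → IsAdmEpi ε (f ≫ g)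
  pushout : ∀ ⦃X Y X' : A⦄ (f : X ⟶ Y) (a : X ⟶ X'), IsAdmMono ε f →
    ∃ (Y' : A) (b : Y ⟶ Y') (f' : X' ⟶ Y'), IsPushout f a b f' ∧ IsAdmMono ε f'
  pullback : ∀ ⦃Y Z Z' : A⦄ (g : Y ⟶ Z) (c : Z' ⟶ Z), IsAdmEpi ε g →
    ∃ (Y' : A) (b : Y' ⟶ Y) (g' : Y' ⟶ Z'), IsPullback b g' g c ∧ IsAdmEpi ε g'

/-- The category of conflations `ε(A)`: its objects are the conflations `X₁ ↣ X₂ ↠ X₃`, its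
morphisms are the commutative diagrams between them. -/
abbrev Conflations (ε : ObjectProperty (ShortComplex A)) : Type max w v := ε.FullSubcategory

/-- The degreewise exact structure on the category of conflations. -/
def degreewise (ε : ObjectProperty (ShortComplex A)) :
    ObjectProperty (ShortComplex (Conflations ε)) := fun T =>
  IsConflation ε T.f.hom.τ₁ T.g.hom.τ₁ ∧ IsConflation ε T.f.hom.τ₂ T.g.hom.τ₂ ∧
    IsConflation ε T.f.hom.τ₃ T.g.hom.τ₃

/-- The class of the splitting conflations. -/
def splitConflations (ε : ObjectProperty (ShortComplex A)) : ObjectProperty (Conflations ε) :=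
  fun S => Nonempty S.obj.Splitting

/-- `D` is a pseudo-cluster tilting subcategory of `(A, ε)`. -/
structure IsPseudoClusterTilting (ε : ObjectProperty (ShortComplex A)) (D : ObjectProperty A) :
    Prop where
  add_eq : D = add D
  preenvelope : ∀ M : A, ∃ (D₀ D₁ : A) (α : M ⟶ D₀) (p : D₀ ⟶ D₁),
    IsConflation ε α p ∧ D D₀ ∧ D D₁ ∧ IsPreenvelope D α
  precover : ∀ M : A, ∃ (D₁ D₀ : A) (i : D₁ ⟶ D₀) (β : D₀ ⟶ M),
    IsConflation ε i β ∧ D D₀ ∧ D D₁ ∧ IsPrecover D β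

end Exact

/-- Every split epimorphism has a kernel. -/
def IsWeaklyIdempotentComplete (A : Type w) [Category.{v} A] [HasZeroMorphisms A] : Prop :=
  ∀ ⦃X Y : A⦄ (f : X ⟶ Y), IsSplitEpi f → HasKernel f

/-! ### Extriangulated categories -/

section Bifunctor

variable {C : Type u} [SmallCategory C] (E : Cᵒᵖ ⥤ C ⥤ AddCommGrpCat.{u})

/-- The group `E(Z, A)` of `E`-extensions. -/
abbrev Extn (Z A : C) : Type u := (E.obj (op Z)).obj A

variable {E}

/-- `a · δ`. -/
def push {Z A A' : C} (a : A ⟶ A') (δ : Extn E Z A) : Extn E Z A' := (E.obj (op Z)).map a δ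

/-- `δ · c`. -/
def pull {Z Z' A : C} (c : Z' ⟶ Z) (δ : Extn E Z A) : Extn E Z' A := (E.map c.op).app A δ

end Bifunctor

/-- An external triangulation `(E, s)` of an additive category `C` (Nakaoka–Palu).
`Realizes x y δ` says that the sequence `A ⟶ B ⟶ Z` belongs to the equivalence class `s(δ)`. -/
structure Extriangulation (C : Type u) [SmallCategory C] [Preadditive C]
    [HasZeroObject C] [HasBinaryBiproducts C] where
  /-- the bifunctor `E` -/
  E : Cᵒᵖ ⥤ C ⥤ AddCommGrpCat.{u}
  additive_right : ∀ Z : Cᵒᵖ, (E.obj Z).Additive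
  additive_left : ∀ A : C, (E.flip.obj A).Additive
  /-- the realization `s` -/
  Realizes : ∀ {A B Z : C}, (A ⟶ B) → (B ⟶ Z) → Extn E Z A → Prop
  exists_realizes : ∀ {A Z : C} (δ : Extn E Z A),
    ∃ (B : C) (x : A ⟶ B) (y : B ⟶ Z), Realizes x y δ
  realizes_of_iso : ∀ {A B B' Z : C} {δ : Extn E Z A} {x : A ⟶ B} {y : B ⟶ Z} {x' : A ⟶ B'}
    {y' : B' ⟶ Z} (b : B ≅ B'), x ≫ b.hom = x' → b.hom ≫ y' = y → Realizes x y δ →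
    Realizes x' y' δ
  iso_of_realizes : ∀ {A B B' Z : C} {δ : Extn E Z A} {x : A ⟶ B} {y : B ⟶ Z} {x' : A ⟶ B'}
    {y' : B' ⟶ Z}, Realizes x y δ → Realizes x' y' δ →
    ∃ b : B ≅ B', x ≫ b.hom = x' ∧ b.hom ≫ y' = y
  realizes_hom : ∀ {A B Z A' B' Z' : C} {δ : Extn E Z A} {δ' : Extn E Z' A'}
    {x : A ⟶ B} {y : B ⟶ Z} {x' : A' ⟶ B'} {y' : B' ⟶ Z'},
    Realizes x y δ → Realizes x' y' δ' → ∀ (a : A ⟶ A') (c : Z ⟶ Z'), push a δ = pull c δ' →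
    ∃ b : B ⟶ B', x ≫ b = a ≫ x' ∧ y ≫ c = b ≫ y'
  realizes_zero : ∀ A Z : C,
    Realizes (biprod.inl : A ⟶ A ⊞ Z) (biprod.snd : A ⊞ Z ⟶ Z) (0 : Extn E Z A)
  realizes_sum : ∀ {A B Z A' B' Z' : C} {δ : Extn E Z A} {δ' : Extn E Z' A'}
    {x : A ⟶ B} {y : B ⟶ Z} {x' : A' ⟶ B'} {y' : B' ⟶ Z'},
    Realizes x y δ → Realizes x' y' δ' →
    Realizes (biprod.map x x') (biprod.map y y')
      (push biprod.inl (pull biprod.fst δ) + push biprod.inr (pull biprod.snd δ') :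
        Extn E (Z ⊞ Z') (A ⊞ A'))
  et3 : ∀ {A B Z A' B' Z' : C} {δ : Extn E Z A} {δ' : Extn E Z' A'}
    {x : A ⟶ B} {y : B ⟶ Z} {x' : A' ⟶ B'} {y' : B' ⟶ Z'},
    Realizes x y δ → Realizes x' y' δ' → ∀ (a : A ⟶ A') (b : B ⟶ B'), x ≫ b = a ≫ x' →
    ∃ c : Z ⟶ Z', push a δ = pull c δ' ∧ y ≫ c = b ≫ y'
  et3_op : ∀ {A B Z A' B' Z' : C} {δ : Extn E Z A} {δ' : Extn E Z' A'}
    {x : A ⟶ B} {y : B ⟶ Z} {x' : A' ⟶ B'} {y' : B' ⟶ Z'},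
    Realizes x y δ → Realizes x' y' δ' → ∀ (b : B ⟶ B') (c : Z ⟶ Z'), y ≫ c = b ≫ y' →
    ∃ a : A ⟶ A', push a δ = pull c δ' ∧ x ≫ b = a ≫ x'
  et4 : ∀ {A B D G F : C} {f : A ⟶ B} {f' : B ⟶ D} {δ : Extn E D A} {g : B ⟶ G} {g' : G ⟶ F}
    {δ' : Extn E F B}, Realizes f f' δ → Realizes g g' δ' →
    ∃ (H : C) (h' : G ⟶ H) (d : D ⟶ H) (e : H ⟶ F) (δ'' : Extn E H A),
      g ≫ h' = f' ≫ d ∧ h' ≫ e = g' ∧ Realizes (f ≫ g) h' δ'' ∧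
      Realizes d e (push f' δ') ∧ pull d δ'' = δ ∧ push f δ'' = pull e δ'
  et4_op : ∀ {D A B F G : C} {f' : D ⟶ A} {f : A ⟶ B} {δ : Extn E B D} {g' : F ⟶ B} {g : B ⟶ G}
    {δ' : Extn E G F}, Realizes f' f δ → Realizes g' g δ' →
    ∃ (H : C) (d : D ⟶ H) (e : H ⟶ F) (h' : H ⟶ A) (δ'' : Extn E G H),
      d ≫ h' = f' ∧ h' ≫ f = e ≫ g' ∧ Realizes h' (f ≫ g) δ'' ∧
      Realizes d e (pull g' δ) ∧ δ' = push e δ'' ∧ push d δ = pull g δ''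

/-! ### Tensor products over `C` and higher extension groups -/

section Tensor

variable {C : Type u} [SmallCategory C] (E : Cᵒᵖ ⥤ C ⥤ AddCommGrpCat.{u})
  (W : C ⥤ AddCommGrpCat.{u})

open Classical in
/-- The subgroup of `⨁ Z, E(Z, A) ⊗ W(Z)` generated by the elements
`(δ · f) ⊗ w - δ ⊗ (f · w)`. -/
noncomputable def tensorRel (A : C) : AddSubgroup (⨁ Z : C, Extn E Z A ⊗[ℤ] W.obj Z) :=
  AddSubgroup.closure {t | ∃ (Z Z' : C) (f : Z ⟶ Z') (δ : Extn E Z' A) (x : W.obj Z),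
    t = DirectSum.of (fun Z : C => Extn E Z A ⊗[ℤ] W.obj Z) Z (pull f δ ⊗ₜ x) -
      DirectSum.of (fun Z : C => Extn E Z A ⊗[ℤ] W.obj Z) Z' (δ ⊗ₜ W.map f x)}

/-- The map induced by `a : A ⟶ A'` on `⨁ Z, E(Z, A) ⊗ W(Z)`. -/
noncomputable def tensorPush {A A' : C} (a : A ⟶ A') :
    (⨁ Z : C, Extn E Z A ⊗[ℤ] W.obj Z) →+ (⨁ Z : C, Extn E Z A' ⊗[ℤ] W.obj Z) :=
  DirectSum.map (fun Z => (LinearMap.rTensor (W.obj Z)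
    ((E.obj (op Z)).map a).hom.toIntLinearMap).toAddMonoidHom)

theorem tensorRel_le {A A' : C} (a : A ⟶ A') :
    tensorRel E W A ≤ (tensorRel E W A').comap (tensorPush E W a) := by
  classical
  refine (AddSubgroup.closure_le _).2 ?_
  rintro _ ⟨Z, Z', f, δ, x, rfl⟩
  refine AddSubgroup.subset_closure ⟨Z, Z', f, push a δ, x, ?_⟩
  have key : push a (pull f δ) = pull f (push a δ) :=
    (ConcreteCategory.congr_hom ((E.map f.op).naturality a) δ).symm
  rw [← key, map_sub]
  simp only [tensorPush, DirectSum.map_of]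
  rfl

theorem tensorPush_id (A : C) (t : ⨁ Z : C, Extn E Z A ⊗[ℤ] W.obj Z) :
    tensorPush E W (𝟙 A) t = t := by
  classical
  induction t using DirectSum.induction_on with
  | zero => exact map_zero _
  | add x y hx hy => rw [map_add, hx, hy]
  | of Z x =>
    induction x using TensorProduct.induction_on with
    | zero => simp
    | add x y hx hy => rw [map_add, map_add, hx, hy]
    | tmul δ x =>
      simp only [tensorPush, DirectSum.map_of]
      congr 1
      change ((E.obj (op Z)).map (𝟙 A) δ) ⊗ₜ[ℤ] x = δ ⊗ₜ[ℤ] x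
      rw [(E.obj (op Z)).map_id]
      rfl

theorem tensorPush_comp {A A' A'' : C} (a : A ⟶ A') (b : A' ⟶ A'')
    (t : ⨁ Z : C, Extn E Z A ⊗[ℤ] W.obj Z) :
    tensorPush E W (a ≫ b) t = tensorPush E W b (tensorPush E W a t) := by
  classical
  induction t using DirectSum.induction_on with
  | zero => simp
  | add x y hx hy => rw [map_add, map_add, map_add, hx, hy]
  | of Z x =>
    induction x using TensorProduct.induction_on with
    | zero => simp
    | add x y hx hy => rw [map_add, map_add, map_add, map_add, hx, hy]
    | tmul δ x =>
      simp only [tensorPush, DirectSum.map_of]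
      congr 1
      change ((E.obj (op Z)).map (a ≫ b) δ) ⊗ₜ[ℤ] x =
        ((E.obj (op Z)).map b ((E.obj (op Z)).map a δ)) ⊗ₜ[ℤ] x
      rw [(E.obj (op Z)).map_comp]
      rfl

/-- The coend `∫^Z E(Z, A) ⊗ W(Z)`, as a covariant functor of `A`. -/
noncomputable def tensorFunctor : C ⥤ AddCommGrpCat.{u} where
  obj A := AddCommGrpCat.of ((⨁ Z : C, Extn E Z A ⊗[ℤ] W.obj Z) ⧸ tensorRel E W A)
  map a := AddCommGrpCat.ofHom (QuotientAddGroup.map _ _ (tensorPush E W a) (tensorRel_le E W a))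
  map_id A := by
    classical
    refine AddCommGrpCat.hom_ext (AddMonoidHom.ext fun x => ?_)
    obtain ⟨x, rfl⟩ := QuotientAddGroup.mk_surjective x
    exact congrArg QuotientAddGroup.mk (tensorPush_id E W A x)
  map_comp a b := by
    classical
    refine AddCommGrpCat.hom_ext (AddMonoidHom.ext fun x => ?_)
    obtain ⟨x, rfl⟩ := QuotientAddGroup.mk_surjective x
    exact congrArg QuotientAddGroup.mk (tensorPush_comp E W a b x)

/-- The higher extension functors: `higherExt E X k = 𝔼^{k+1}(X, -)`, where `𝔼¹ = E` and
`𝔼^{k+2}(X, A) = ∫^Z E(Z, A) ⊗ 𝔼^{k+1}(X, Z)`. -/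
noncomputable def higherExt (X : C) : ℕ → (C ⥤ AddCommGrpCat.{u})
  | 0 => E.obj (op X)
  | k + 1 => tensorFunctor E (higherExt X k)

end Tensor

namespace Extriangulation

variable {C : Type u} [SmallCategory C] [Preadditive C] [HasZeroObject C] [HasBinaryBiproducts C]
  (T : Extriangulation C)

/-- Conflations of `C`: the sequences realizing some extension. -/
def IsConfl ⦃A B Z : C⦄ (x : A ⟶ B) (y : B ⟶ Z) : Prop := ∃ δ, T.Realizes x y δ

/-- The class of the `E`-injective objects. -/
def injectives : ObjectProperty C := fun I =>
  ∀ ⦃A B Z : C⦄ (x : A ⟶ B) (y : B ⟶ Z), T.IsConfl x y → ∀ g : A ⟶ I, ∃ h : B ⟶ I, x ≫ h = g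

/-- `C` has enough `E`-injectives. -/
def EnoughInjectives : Prop :=
  ∀ A : C, ∃ (I Z : C) (x : A ⟶ I) (y : I ⟶ Z), T.IsConfl x y ∧ T.injectives I

/-- `P` is `m`-rigid: `𝔼^i(P, P) = 0` for `1 ≤ i ≤ m - 1`. -/
def IsRigid (m : ℕ) (P : ObjectProperty C) : Prop :=
  ∀ k : ℕ, k + 2 ≤ m → ∀ X Y : C, P X → P Y → Subsingleton ((higherExt T.E X k).obj Y)

variable (P : ObjectProperty C) (n : ℕ)

/-- The class `P^∧_n` in `C`. -/
abbrev res : ObjectProperty C := resDimLE T.IsConfl P n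

/-- The ideal of the morphisms `f` of the full subcategory `W` with `E(-, f) = 0`. -/
def injIdeal (W : ObjectProperty C) : HomIdeal W.FullSubcategory where
  carrier X Y :=
    { carrier := {f | ∀ (Z : C) (δ : Extn T.E Z X.obj), push f.hom δ = 0}
      add_mem' := by
        intro f g hf hg Z δ
        have := T.additive_right (op Z)
        have h := ConcreteCategory.congr_hom ((T.E.obj (op Z)).map_add (f := f.hom) (g := g.hom)) δ
        exact h.trans ((congrArg₂ (· + ·) (hf Z δ) (hg Z δ)).trans (add_zero _))
      zero_mem' := by
        intro Z δ
        have := T.additive_right (op Z)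
        exact ConcreteCategory.congr_hom ((T.E.obj (op Z)).map_zero X.obj Y.obj) δ
      neg_mem' := by
        intro f hf Z δ
        have := T.additive_right (op Z)
        have h := ConcreteCategory.congr_hom ((T.E.obj (op Z)).map_neg (f := f.hom)) δ
        exact h.trans ((congrArg (fun t => -t) (hf Z δ)).trans neg_zero) }
  precomp_mem {X Y Z} f g hg V δ := by
    have h := ConcreteCategory.congr_hom ((T.E.obj (op V)).map_comp f.hom g.hom) δ
    exact h.trans (hg V _)
  postcomp_mem {X Y Z} f g hf V δ := by
    have h := ConcreteCategory.congr_hom ((T.E.obj (op V)).map_comp f.hom g.hom) δ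
    exact h.trans ((congrArg (fun t => push g.hom t) (hf V δ)).trans (map_zero _))

/-- The co-stable category of `P^∧_n`. -/
abbrev Costable : Type u := (T.injIdeal (T.res P n)).Quot

/-- For `M` in `C`, the functor induced by `E(M, -)` on the co-stable category of `P^∧_n`. -/
def costableExt (M : Cᵒᵖ) : T.Costable P n ⥤ AddCommGrpCat.{u} :=
  CategoryTheory.Quotient.lift _ ((T.res P n).ι ⋙ T.E.obj M) (by
    intro X Y f g h
    have := T.additive_right M
    rw [← sub_eq_zero]
    change (T.E.obj M).map f.hom - (T.E.obj M).map g.hom = 0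
    rw [← Functor.map_sub]
    ext δ
    exact h M.unop δ)

/-- The functor `𝔾`, sending `M` in `P^∧_{n+1}` to the functor induced by `E(M, -)` on the co-stable
category of `P^∧_n`. -/
def functorG : ((T.res P (n + 1)).FullSubcategory)ᵒᵖ ⥤ (T.Costable P n ⥤ AddCommGrpCat.{u}) where
  obj M := T.costableExt P n (op M.unop.obj)
  map f := CategoryTheory.Quotient.natTransLift _
    (Functor.whiskerLeft (T.res P n).ι (T.E.map f.unop.hom.op))
  map_id M := by
    refine CategoryTheory.Quotient.natTrans_ext _ _ (NatTrans.ext (funext fun X => ?_))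
    exact congrArg (fun t => NatTrans.app t X.obj) (T.E.map_id (op M.unop.obj))
  map_comp f g := by
    refine CategoryTheory.Quotient.natTrans_ext _ _ (NatTrans.ext (funext fun X => ?_))
    exact congrArg (fun t => NatTrans.app t X.obj) (T.E.map_comp f.unop.hom.op g.unop.hom.op)

/-- The ideal `[P]` of the full subcategory `P^∧_{n+1}`. -/
abbrev idealP : HomIdeal (T.res P (n + 1)).FullSubcategory :=
  HomIdeal.ofObjects (P.inverseImage (T.res P (n + 1)).ι)

/-- The quotient category `P^∧_{n+1}/[P]`. -/
abbrev M₂ : Type u := (T.idealP P n).Quot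

/-- The functor `𝔾` factors through `P^∧_{n+1}/[P]`. -/
def GFactors : Prop :=
  ∀ (X Y : (T.res P (n + 1)).FullSubcategory) (f g : X ⟶ Y), (T.idealP P n).rel f g →
    (T.functorG P n).rightOp.map f = (T.functorG P n).rightOp.map g

variable {P n}

/-- The contravariant functor `𝕂` on `P^∧_{n+1}/[P]` induced by `𝔾`. -/
def functorK (h : T.GFactors P n) : (T.M₂ P n)ᵒᵖ ⥤ (T.Costable P n ⥤ AddCommGrpCat.{u}) :=
  (CategoryTheory.Quotient.lift (T.idealP P n).rel (T.functorG P n).rightOp h).leftOp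

/-- The class `ε_𝕂` of the sequences `X₁ ⟶ X₂ ⟶ X₃` of `P^∧_{n+1}/[P]` for which
`0 ⟶ 𝕂(X₃) ⟶ 𝕂(X₂) ⟶ 𝕂(X₁) ⟶ 0` is exact. -/
def epsK (h : T.GFactors P n) : ObjectProperty (ShortComplex (T.M₂ P n)) := fun S =>
  IsConflation (fun R => R.ShortExact) ((T.functorK h).map S.g.op) ((T.functorK h).map S.f.op)

variable (P n)

/-- The class `𝓛ⁿ_P` of the modules `G` over the co-stable category of `P^∧_n` having a presentation
`Hom(X₀, -) ⟶ Hom(X₁, -) ⟶ G ⟶ 0` with `X₀` in `P` and `X₁` in `P^∧_n`. -/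
def classL : ObjectProperty (T.Costable P n ⥤ AddCommGrpCat.{u}) := fun G =>
  G.Additive ∧ ∃ (X₀ X₁ : (T.res P n).FullSubcategory)
    (α : preadditiveCoyoneda.obj (op ((T.injIdeal (T.res P n)).proj.obj X₀)) ⟶
      preadditiveCoyoneda.obj (op ((T.injIdeal (T.res P n)).proj.obj X₁)))
    (π : preadditiveCoyoneda.obj (op ((T.injIdeal (T.res P n)).proj.obj X₁)) ⟶ G)
    (zero : α ≫ π = 0), P X₀.obj ∧ (ShortComplex.mk α π zero).Exact ∧ Epi π

end Extriangulation

end ConflationQuotient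

/-!
# Conflations modulo splitting conflations for the quotient of a class of finite resolution dimension

The proof rests on one embedding. Write `P^∧_m` for the objects with a `P`-resolution of length at
most `m`, and let `M₂ = P^∧_{n+1}/[P]`.

**Rigidity.** A conflation `A ⟶ I ⟶ S` with `I` injective gives the dimension shift
`𝔼^{k+1}(X, A) = 0 ↔ 𝔼^k(X, S) = 0` (`Realizes.subsingleton_tensorFunctor_iff`): the coend is
generated by the tensors `δ ⊗ w`, where `δ` is the class of that conflation. By induction along
resolutions, `(n + 2)`-rigidity of `P` yields `E(P, P^∧_n) = 0` (`subsingleton_extn_of_res`). This is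
the only consequence of rigidity which is used.

**The duality.** Let `δ` be the class of a conflation `V ⟶ X ⟶ M` with `X` in `P` and `V` in `P^∧_n`.
Since `E(X, -)` vanishes on `P^∧_n`, the functor `E(M, -)` on the co-stable category of `P^∧_n` is
generated by `δ`, with relations given by `V ⟶ X` (`isPresentedBy_costableExt`). Evaluation at `δ`
shows that `𝕂` is full and faithful. Its essential image consists of all additive functors presented
by such a morphism `V ⟶ X`, since any `V ⟶ X` becomes an inflation after adding to `X` an injective
object containing `V` (`exists_iso_of_isPresentedBy`). Presented functors are closed under extensions
by the horseshoe construction (`HomIdeal.IsPresentedBy.extension`).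

**Exact structures.** Consequently `𝕂` identifies `M₂` with an extension closed subcategory of the
abelian category `(Costable ⥤ Ab)ᵒᵖ`, and `ε_𝕂` with the sequences which are short exact there. Any
such class is an exact structure (`IsExactEmbedding.isExactCategory`). The conflations of an extension
closed subcategory of an abelian category `B` form an extension closed subcategory of the abelian
category of short complexes in `B` (`IsExactEmbedding.conflations`), so the same statement applies to
the category of conflations with its degreewise structure.

**Splitting conflations.** The ideal generated by the splitting conflations consists of the
null-homotopic morphisms. A conflation `K ⟶ M ⟶ N` has the splitting conflation `M ⟶ M ⊞ N ⟶ N` as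
preenvelope, with cokernel `N ⟶ N ⟶ 0`, and the splitting conflation `K ⟶ K ⊞ M ⟶ M` as precover, with
kernel `0 ⟶ K ⟶ K`. The defect, which sends `K ⟶ M ⟶ N` to the cokernel of
`Hom(-, M) ⟶ Hom(-, N)`, is full, and it identifies exactly the morphisms with null-homotopic
difference. The defects are closed under kernels and cokernels among the `M₂`-modules, by base change
of conflations and by the admissible epimorphisms `M' ⊞ N ⟶ N'` obtained from an admissible
epimorphism `M' ⟶ N'` and any `N ⟶ N'`; hence the quotient is abelian
(`IsExactEmbedding.nonempty_abelian_quot`).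

**Lifting splittings to `C`.** A retraction of `a : K ⟶ M` modulo `[P]` is an equation `a r + f t = 1`
with `f : K ⟶ X` and `X` in `P`. Adding an inflation `i : K ⟶ I` into an injective object makes
`(a, f, i)` an inflation, and the equation makes its class vanish. Its cone lies in `P^∧_{n+1}` because
this class is closed under complements (`res_complement`). This gives the description of the
splitting conflations in terms of `C`, and the splitting of idempotents needed for `M₂` to be weakly
idempotent complete.
-/

open CategoryTheory CategoryTheory.Limits Opposite ConflationQuotient

namespace ConflationQuotient

open scoped ZeroObject

/-! ### Two criteria for isomorphisms -/

theorem isIso_of_sub_id_sq_eq_zero {D : Type w} [Category.{v} D] [Preadditive D] {A : D} (b : A ⟶ A)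
    (h : (b - 𝟙 A) ≫ (b - 𝟙 A) = 0) :
    IsIso b := by
  have h' : b ≫ b - b - (b - 𝟙 A) = 0 := by simpa using h
  refine ⟨𝟙 A + 𝟙 A - b, ?_, ?_⟩
  · rw [← sub_eq_zero, ← neg_eq_zero, ← h']
    simp only [Preadditive.comp_sub, Preadditive.comp_add, Category.comp_id]
    abel
  · rw [← sub_eq_zero, ← neg_eq_zero, ← h']
    simp only [Preadditive.sub_comp, Preadditive.add_comp, Category.id_comp]
    abel

theorem isIso_of_isIso_comp {D : Type w} [Category.{v} D] {A B : D} (b : A ⟶ B) (b' : B ⟶ A)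
    (h : IsIso (b ≫ b')) (h' : IsIso (b' ≫ b)) : IsIso b := by
  have : IsSplitMono b := ⟨⟨⟨b' ≫ inv (b ≫ b'), by rw [← Category.assoc, IsIso.hom_inv_id]⟩⟩⟩
  have : Epi b := epi_of_epi b' b
  exact isIso_of_epi_of_isSplitMono b

/-! ### Extensions -/

section Bifunctor

variable {C : Type u} [SmallCategory C] {E : Cᵒᵖ ⥤ C ⥤ AddCommGrpCat.{u}}

theorem push_id {Z A : C} (δ : Extn E Z A) : push (𝟙 A) δ = δ :=
  ConcreteCategory.congr_hom ((E.obj (op Z)).map_id A) δ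

theorem push_comp {Z A A' A'' : C} (a : A ⟶ A') (b : A' ⟶ A'') (δ : Extn E Z A) :
    push (a ≫ b) δ = push b (push a δ) :=
  ConcreteCategory.congr_hom ((E.obj (op Z)).map_comp a b) δ

theorem pull_id {Z A : C} (δ : Extn E Z A) : pull (𝟙 Z) δ = δ :=
  ConcreteCategory.congr_hom (congrArg (fun t => NatTrans.app t A) (E.map_id (op Z))) δ

theorem pull_comp {Z Z' Z'' A : C} (c' : Z'' ⟶ Z') (c : Z' ⟶ Z) (δ : Extn E Z A) :
    pull (c' ≫ c) δ = pull c' (pull c δ) :=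
  ConcreteCategory.congr_hom (congrArg (fun t => NatTrans.app t A) (E.map_comp c.op c'.op)) δ

theorem push_pull {Z Z' A A' : C} (a : A ⟶ A') (c : Z' ⟶ Z) (δ : Extn E Z A) :
    push a (pull c δ) = pull c (push a δ) :=
  (ConcreteCategory.congr_hom ((E.map c.op).naturality a) δ).symm

@[simp]
theorem push_zero {Z A A' : C} (a : A ⟶ A') : push a (0 : Extn E Z A) = 0 :=
  map_zero ((E.obj (op Z)).map a).hom

@[simp]
theorem pull_zero {Z Z' A : C} (c : Z' ⟶ Z) : pull c (0 : Extn E Z A) = 0 :=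
  map_zero ((E.map c.op).app A).hom

end Bifunctor

namespace Extriangulation

variable {C : Type u} [SmallCategory C] [Preadditive C] [HasZeroObject C] [HasBinaryBiproducts C]
  (T : Extriangulation C)

theorem add_push {Z A A' : C} (a a' : A ⟶ A') (δ : Extn T.E Z A) :
    push (a + a') δ = push a δ + push a' δ :=
  have := T.additive_right (op Z)
  ConcreteCategory.congr_hom ((T.E.obj (op Z)).map_add (f := a) (g := a')) δ

theorem sub_push {Z A A' : C} (a a' : A ⟶ A') (δ : Extn T.E Z A) :
    push (a - a') δ = push a δ - push a' δ :=
  have := T.additive_right (op Z)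
  ConcreteCategory.congr_hom ((T.E.obj (op Z)).map_sub (f := a) (g := a')) δ

theorem add_pull {Z Z' A : C} (c c' : Z' ⟶ Z) (δ : Extn T.E Z A) :
    pull (c + c') δ = pull c δ + pull c' δ :=
  have := T.additive_left A
  ConcreteCategory.congr_hom ((T.E.flip.obj A).map_add (f := c.op) (g := c'.op)) δ

theorem sub_pull {Z Z' A : C} (c c' : Z' ⟶ Z) (δ : Extn T.E Z A) :
    pull (c - c') δ = pull c δ - pull c' δ :=
  have := T.additive_left A
  ConcreteCategory.congr_hom ((T.E.flip.obj A).map_sub (f := c.op) (g := c'.op)) δ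

variable {T}

/-! ### Split sequences and exactness properties of conflations -/

theorem realizes_of_splitting {A B Z : C} {s : A ⟶ B} {y : B ⟶ Z} (r : B ⟶ A) (t : Z ⟶ B)
    (hsr : s ≫ r = 𝟙 A) (hty : t ≫ y = 𝟙 Z) (hsy : s ≫ y = 0) (htr : t ≫ r = 0)
    (h : r ≫ s + y ≫ t = 𝟙 B) : T.Realizes s y 0 := by
  refine T.realizes_of_iso (b := ⟨biprod.desc s t, biprod.lift r y, ?_, ?_⟩) ?_ ?_
    (T.realizes_zero A Z)
  · ext <;> simp [hsr, hty, hsy, htr]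
  · simpa using h
  · simp
  · ext <;> simp [hsy, hty]

theorem realizes_id_zero (A Z : C) (hZ : IsZero Z) : T.Realizes (𝟙 A) (0 : A ⟶ Z) 0 :=
  realizes_of_splitting (𝟙 A) 0 (by simp) (hZ.eq_of_src _ _) (by simp) (by simp) (by simp)

theorem realizes_zero_id (A Z : C) (hA : IsZero A) : T.Realizes (0 : A ⟶ Z) (𝟙 Z) 0 :=
  realizes_of_splitting 0 (𝟙 Z) (hA.eq_of_src _ _) (by simp) (by simp) (by simp) (by simp)

section Exactness

variable {A B Z W : C} {x : A ⟶ B} {y : B ⟶ Z} {δ : Extn T.E Z A}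

theorem Realizes.comp (h : T.Realizes x y δ) : x ≫ y = 0 := by
  obtain ⟨c, _, hc⟩ := T.et3 (realizes_id_zero A (0 : C) (isZero_zero C)) h (𝟙 A) x (by simp)
  rw [← hc, zero_comp]

/-- The inflation is a weak kernel of the deflation. -/
theorem Realizes.lift (h : T.Realizes x y δ) (g : W ⟶ B) (hg : g ≫ y = 0) :
    ∃ c : W ⟶ A, c ≫ x = g := by
  obtain ⟨c, _, hc⟩ := T.et3_op (realizes_id_zero W (0 : C) (isZero_zero C)) h g 0 (by simp [hg])
  exact ⟨c, by simpa using hc.symm⟩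

theorem Realizes.push_eq_zero (h : T.Realizes x y δ) : push x δ = 0 := by
  obtain ⟨c, hc, _⟩ := T.et3 h (realizes_id_zero B (0 : C) (isZero_zero C)) x (𝟙 B) (by simp)
  rw [hc, pull_zero]

theorem Realizes.pull_eq_zero (h : T.Realizes x y δ) : pull y δ = 0 := by
  obtain ⟨c, hc, _⟩ := T.et3_op (realizes_zero_id (0 : C) B (isZero_zero C)) h (𝟙 B) y (by simp)
  rw [← hc, push_zero]

/-- Exactness of `Hom(B, W) ⟶ Hom(A, W) ⟶ E(Z, W)`. -/
theorem Realizes.extend (h : T.Realizes x y δ) (a : A ⟶ W) (ha : push a δ = 0) :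
    ∃ b : B ⟶ W, x ≫ b = a := by
  obtain ⟨b, hb, _⟩ := T.realizes_hom h (realizes_id_zero W (0 : C) (isZero_zero C)) a 0
    (by simp [ha])
  exact ⟨b, by simpa using hb⟩

/-- Exactness of `Hom(W, B) ⟶ Hom(W, Z) ⟶ E(W, A)`. -/
theorem Realizes.colift (h : T.Realizes x y δ) (c : W ⟶ Z) (hc : pull c δ = 0) :
    ∃ b : W ⟶ B, b ≫ y = c := by
  obtain ⟨b, _, hb⟩ := T.realizes_hom (realizes_zero_id (0 : C) W (isZero_zero C)) h 0 c
    (by simp [hc])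
  exact ⟨b, by simpa using hb.symm⟩

theorem Realizes.pull_eq_zero_iff (h : T.Realizes x y δ) (c : W ⟶ Z) :
    pull c δ = 0 ↔ ∃ b : W ⟶ B, b ≫ y = c := by
  refine ⟨h.colift c, ?_⟩
  rintro ⟨b, rfl⟩
  rw [pull_comp, h.pull_eq_zero, pull_zero]

/-- Exactness of `Hom(W, Z) ⟶ E(W, A) ⟶ E(W, B)`. -/
theorem Realizes.exists_pull_eq (h : T.Realizes x y δ) (θ : Extn T.E W A) (hθ : push x θ = 0) :
    ∃ c : W ⟶ Z, pull c δ = θ := by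
  obtain ⟨V, x', y', h'⟩ := T.exists_realizes θ
  obtain ⟨b, hb⟩ := h'.extend x hθ
  obtain ⟨c, hc, _⟩ := T.et3 h' h (𝟙 A) b (by simp [hb])
  exact ⟨c, by rw [← hc, push_id]⟩

/-- Exactness of `Hom(A, W) ⟶ E(Z, W) ⟶ E(B, W)`. -/
theorem Realizes.exists_push_eq (h : T.Realizes x y δ) (θ : Extn T.E Z W) (hθ : pull y θ = 0) :
    ∃ a : A ⟶ W, push a δ = θ := by
  obtain ⟨V, x', y', h'⟩ := T.exists_realizes θ
  obtain ⟨b, hb⟩ := h'.colift y hθ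
  obtain ⟨a, ha, _⟩ := T.et3_op h h' b (𝟙 Z) (by simp [hb])
  exact ⟨a, by rw [ha, pull_id]⟩

theorem Realizes.section_of_zero (h : T.Realizes x y 0) : ∃ t : Z ⟶ B, t ≫ y = 𝟙 Z :=
  h.colift (𝟙 Z) (pull_zero _)

/-- A conflation with class zero is a biproduct diagram. -/
theorem Realizes.splitting (h : T.Realizes x y 0) : ∃ (r : B ⟶ A) (t : Z ⟶ B),
    x ≫ r = 𝟙 A ∧ t ≫ y = 𝟙 Z ∧ x ≫ y = 0 ∧ t ≫ r = 0 ∧ r ≫ x + y ≫ t = 𝟙 B := by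
  obtain ⟨b, hb₁, hb₂⟩ := T.iso_of_realizes h (T.realizes_zero A Z)
  have e₁ : biprod.inl ≫ b.inv = x := by rw [Iso.comp_inv_eq, hb₁]
  have e₂ : b.inv ≫ y = biprod.snd := by rw [Iso.inv_comp_eq, hb₂]
  refine ⟨b.hom ≫ biprod.fst, biprod.inr ≫ b.inv, ?_, ?_, h.comp, ?_, ?_⟩
  · rw [← e₁]; simp
  · rw [← hb₂]; simp
  · simp
  · rw [← e₁, ← hb₂]
    have : b.hom ≫ (biprod.fst ≫ biprod.inl + biprod.snd ≫ biprod.inr) ≫ b.inv = 𝟙 _ := by simp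
    simpa only [Preadditive.comp_add, Preadditive.add_comp, Category.assoc] using this

/-- Half exactness of `E(W, -)`: the octahedral axiom, applied to `x` and to a realization of `θ`,
produces the preimage. -/
theorem Realizes.exists_push_of_push_eq_zero (h : T.Realizes x y δ) (θ : Extn T.E W B)
    (hθ : push y θ = 0) : ∃ θ' : Extn T.E W A, push x θ' = θ := by
  obtain ⟨G, g, g', hg⟩ := T.exists_realizes θ
  obtain ⟨H, h', d, e, δ'', _, _, _, hde, _, h6⟩ := T.et4 h hg
  rw [hθ] at hde
  obtain ⟨s, hs⟩ := hde.section_of_zero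
  refine ⟨pull s δ'', ?_⟩
  rw [push_pull, h6, ← pull_comp, hs, pull_id]

end Exactness

/-! ### Conflations of biproducts, homotopy pushouts and pullbacks -/

section Transport

variable {A B Z : C} {x : A ⟶ B} {y : B ⟶ Z} {δ : Extn T.E Z A}

/-- An endomorphism of a conflation which is the identity at both ends is invertible: its difference
with the identity factors through the inflation and is killed by it. -/
theorem Realizes.isIso_of_comm (h : T.Realizes x y δ) (b : B ⟶ B) (h₁ : x ≫ b = x)
    (h₂ : b ≫ y = y) : IsIso b := by
  refine isIso_of_sub_id_sq_eq_zero b ?_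
  obtain ⟨c, hc⟩ := h.lift (b - 𝟙 B) (by simp [h₂])
  conv_lhs => lhs; rw [← hc]
  simp [h₁]

/-- The realization is compatible with isomorphisms at the right end. -/
theorem Realizes.iso_right (h : T.Realizes x y δ) {Z' : C} (c : Z' ≅ Z) :
    T.Realizes x (y ≫ c.inv) (pull c.hom δ) := by
  obtain ⟨B', x', y', h'⟩ := T.exists_realizes (pull c.hom δ)
  obtain ⟨b, hb₁, hb₂⟩ := T.realizes_hom h' h (𝟙 A) c.hom (by rw [push_id])
  obtain ⟨b', hb₁', hb₂'⟩ := T.realizes_hom h h' (𝟙 A) c.inv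
    (by rw [push_id, ← pull_comp, c.inv_hom_id, pull_id])
  simp only [Category.id_comp] at hb₁ hb₁'
  have e₁ : IsIso (b ≫ b') := h'.isIso_of_comm _ (by rw [← Category.assoc, hb₁, hb₁'])
    (by rw [Category.assoc, ← hb₂', ← Category.assoc, ← hb₂, Category.assoc, c.hom_inv_id,
      Category.comp_id])
  have e₂ : IsIso (b' ≫ b) := h.isIso_of_comm _ (by rw [← Category.assoc, hb₁', hb₁])
    (by rw [Category.assoc, ← hb₂, ← Category.assoc, ← hb₂', Category.assoc, c.inv_hom_id,
      Category.comp_id])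
  have := isIso_of_isIso_comp b b' e₁ e₂
  exact T.realizes_of_iso (asIso b) hb₁ (by simp [← reassoc_of% hb₂]) h'

/-- The realization is compatible with isomorphisms at the left end. -/
theorem Realizes.iso_left (h : T.Realizes x y δ) {A' : C} (a : A ≅ A') :
    T.Realizes (a.inv ≫ x) y (push a.hom δ) := by
  obtain ⟨B', x', y', h'⟩ := T.exists_realizes (push a.hom δ)
  obtain ⟨b, hb₁, hb₂⟩ := T.realizes_hom h' h a.inv (𝟙 Z)
    (by rw [← push_comp, a.hom_inv_id, pull_id, push_id])
  obtain ⟨b', hb₁', hb₂'⟩ := T.realizes_hom h h' a.hom (𝟙 Z) (by rw [pull_id])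
  simp only [Category.comp_id] at hb₂ hb₂'
  have e₁ : IsIso (b ≫ b') := h'.isIso_of_comm _
    (by rw [← Category.assoc, hb₁, Category.assoc, hb₁', a.inv_hom_id_assoc])
    (by rw [Category.assoc, ← hb₂', ← hb₂])
  have e₂ : IsIso (b' ≫ b) := h.isIso_of_comm _
    (by rw [← Category.assoc, hb₁', Category.assoc, hb₁, a.hom_inv_id_assoc])
    (by rw [Category.assoc, ← hb₂, ← hb₂'])
  have := isIso_of_isIso_comp b b' e₁ e₂
  exact T.realizes_of_iso (asIso b) hb₁ (by simp [hb₂]) h'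

/-- The cone of an inflation is unique up to isomorphism. -/
theorem Realizes.cone_unique (h : T.Realizes x y δ) {Z' : C} {y' : B ⟶ Z'} {δ' : Extn T.E Z' A}
    (h' : T.Realizes x y' δ') : ∃ c : Z ≅ Z', y ≫ c.hom = y' := by
  obtain ⟨c, hc₁, hc₂⟩ := T.et3 h h' (𝟙 A) (𝟙 B) (by simp)
  obtain ⟨c', hc₁', hc₂'⟩ := T.et3 h' h (𝟙 A) (𝟙 B) (by simp)
  simp only [Category.id_comp, push_id] at hc₁ hc₂ hc₁' hc₂'
  have key : ∀ {Z : C} {y : B ⟶ Z} {δ : Extn T.E Z A}, T.Realizes x y δ → ∀ e : Z ⟶ Z,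
      y ≫ e = y → pull e δ = δ → IsIso e := by
    intro Z y δ h e h₁ h₂
    refine isIso_of_sub_id_sq_eq_zero e ?_
    obtain ⟨m, hm⟩ := h.colift (e - 𝟙 Z) (by rw [sub_pull, h₂, pull_id, sub_self])
    have : y ≫ (e - 𝟙 Z) = 0 := by simp [h₁]
    conv_lhs => lhs; rw [← hm]
    rw [Category.assoc, this, comp_zero]
  have e₁ : IsIso (c ≫ c') := key h _ (by rw [← Category.assoc, hc₂, hc₂'])
    (by rw [pull_comp, ← hc₁', ← hc₁])
  have e₂ : IsIso (c' ≫ c) := key h' _ (by rw [← Category.assoc, hc₂', hc₂])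
    (by rw [pull_comp, ← hc₁, ← hc₁'])
  have := isIso_of_isIso_comp c c' e₁ e₂
  exact ⟨asIso c, hc₂⟩

/-- The cocone of a deflation is unique up to isomorphism. -/
theorem Realizes.cocone_unique (h : T.Realizes x y δ) {A' : C} {x' : A' ⟶ B}
    {δ' : Extn T.E Z A'} (h' : T.Realizes x' y δ') : ∃ a : A ≅ A', a.hom ≫ x' = x := by
  obtain ⟨a, ha₁, ha₂⟩ := T.et3_op h h' (𝟙 B) (𝟙 Z) (by simp)
  obtain ⟨a', ha₁', ha₂'⟩ := T.et3_op h' h (𝟙 B) (𝟙 Z) (by simp)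
  simp only [Category.comp_id, pull_id] at ha₁ ha₂ ha₁' ha₂'
  have key : ∀ {A : C} {x : A ⟶ B} {δ : Extn T.E Z A}, T.Realizes x y δ → ∀ e : A ⟶ A,
      e ≫ x = x → push e δ = δ → IsIso e := by
    intro A x δ h e h₁ h₂
    refine isIso_of_sub_id_sq_eq_zero e ?_
    obtain ⟨m, hm⟩ := h.extend (e - 𝟙 A) (by rw [sub_push, h₂, push_id, sub_self])
    have : (e - 𝟙 A) ≫ x = 0 := by simp [h₁]
    conv_lhs => rhs; rw [← hm]
    rw [← Category.assoc, this, zero_comp]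
  have e₁ : IsIso (a ≫ a') := key h _ (by rw [Category.assoc, ← ha₂', ← ha₂])
    (by rw [push_comp, ha₁, ha₁'])
  have e₂ : IsIso (a' ≫ a) := key h' _ (by rw [Category.assoc, ← ha₂, ← ha₂'])
    (by rw [push_comp, ha₁', ha₁])
  have := isIso_of_isIso_comp a a' e₁ e₂
  exact ⟨asIso a, ha₂.symm⟩

end Transport

section Homotopy

variable {K B Z M : C} {x : K ⟶ B} {y : B ⟶ Z} {δ : Extn T.E Z K}

theorem Realizes.add_left (h : T.Realizes x y δ) (M : C) :
    T.Realizes (biprod.map (𝟙 M) x) (biprod.snd ≫ y) (push biprod.inr δ) := by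
  have h₁ := (T.realizes_sum (realizes_id_zero M (0 : C) (isZero_zero C)) h).iso_right
    (Z' := Z) ⟨biprod.inr, biprod.snd, by simp, by ext; simp⟩
  simp only [pull_zero, push_zero, zero_add, biprod.map_snd] at h₁
  rwa [← push_pull, ← pull_comp, biprod.inr_snd, pull_id] at h₁

theorem Realizes.add_right (h : T.Realizes x y δ) (M : C) :
    T.Realizes (x ≫ biprod.inr) (biprod.map (𝟙 M) y) (pull biprod.snd δ) := by
  have h₁ := (T.realizes_sum (realizes_zero_id (0 : C) M (isZero_zero C)) h).iso_left
    (A' := K) ⟨biprod.snd, biprod.inr, by ext; simp, by simp⟩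
  simp only [pull_zero, push_zero, zero_add, biprod.inr_map] at h₁
  rwa [← push_comp, biprod.inr_snd, push_id] at h₁

/-- If `x : K ⟶ B` is an inflation and `g : K ⟶ M` is arbitrary, then `(g, x) : K ⟶ M ⊞ B` is an
inflation, and its cone is an extension of the cone of `x` by `M`. -/
theorem Realizes.exists_cone_lift (h : T.Realizes x y δ) (g : K ⟶ M) :
    ∃ (H : C) (c : M ⊞ B ⟶ H) (γ : Extn T.E H K) (d : M ⟶ H) (e : H ⟶ Z),
      T.Realizes (biprod.lift g x) c γ ∧ T.Realizes d e (push g δ) := by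
  have h₁ : T.Realizes (biprod.lift g (𝟙 K)) (biprod.desc (-𝟙 M) g) 0 := by
    refine realizes_of_splitting biprod.snd (-biprod.inl) ?_ ?_ ?_ ?_ ?_
    · simp
    · simp
    · simp
    · simp
    · ext <;> simp
  -- `(g, x)` is the composite of the split inflation `(g, 1) : K ⟶ M ⊞ K` and of `1 ⊞ x`
  obtain ⟨H, c, d, e, γ, _, _, hc, hd, _, _⟩ := T.et4 h₁ (h.add_left M)
  refine ⟨H, c, γ, d, e, ?_, ?_⟩
  · have e : biprod.lift g (𝟙 K) ≫ biprod.map (𝟙 M) x = biprod.lift g x := by ext <;> simp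
    rwa [e] at hc
  · rwa [← push_comp, biprod.inr_desc] at hd

/-- If `y : B ⟶ Z` is a deflation and `g : M ⟶ Z` is arbitrary, then `(g, y) : M ⊞ B ⟶ Z` is a
deflation, and its cocone is an extension of `M` by the cocone of `y`. -/
theorem Realizes.exists_cocone_desc (h : T.Realizes x y δ) (g : M ⟶ Z) :
    ∃ (H : C) (c : H ⟶ M ⊞ B) (γ : Extn T.E Z H) (d : K ⟶ H) (e : H ⟶ M),
      T.Realizes c (biprod.desc g y) γ ∧ T.Realizes d e (pull g δ) := by
  have h₁ : T.Realizes (biprod.lift (-𝟙 M) g) (biprod.desc g (𝟙 Z)) 0 := by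
    refine realizes_of_splitting (-biprod.fst) biprod.inr ?_ ?_ ?_ ?_ ?_
    · simp
    · simp
    · simp
    · simp
    · ext <;> simp
  -- `(g, y)` is the composite of `1 ⊞ y` and of the split deflation `(g, 1) : M ⊞ Z ⟶ Z`
  obtain ⟨H, d, e, c, γ, _, _, hc, hd, _, _⟩ := T.et4_op (h.add_right M) h₁
  refine ⟨H, c, γ, d, e, ?_, ?_⟩
  · have e : biprod.map (𝟙 M) y ≫ biprod.desc g (𝟙 Z) = biprod.desc g y := by ext <;> simp
    rwa [e] at hc
  · rwa [← pull_comp, biprod.lift_snd] at hd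

/-- Homotopy pushout of two inflations: its two structure maps are again inflations, with the
pushed-forward classes. -/
theorem Realizes.exists_pushout (h : T.Realizes x y δ) {I S : C} {x' : K ⟶ I} {y' : I ⟶ S}
    {δ' : Extn T.E S K} (h' : T.Realizes x' y' δ') :
    ∃ (H : C) (d : B ⟶ H) (e : H ⟶ S) (d' : I ⟶ H) (e' : H ⟶ Z),
      T.Realizes d e (push x δ') ∧ T.Realizes d' e' (push x' δ) := by
  obtain ⟨H, c, γ, d, e, hc, hd⟩ := h'.exists_cone_lift x
  obtain ⟨H', c', γ', d', e', hc', hd'⟩ := h.exists_cone_lift x'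
  have hc'' := T.realizes_of_iso (biprod.braiding I B) (x' := biprod.lift x x')
    (y' := (biprod.braiding I B).inv ≫ c') (by ext <;> simp) (by simp) hc'
  obtain ⟨i, _⟩ := hc''.cone_unique hc
  exact ⟨H, d, e, d' ≫ i.hom, i.inv ≫ e', hd, T.realizes_of_iso i rfl (by simp) hd'⟩

/-- Homotopy pullback of two deflations: its two structure maps are again deflations, with the
pulled-back classes. -/
theorem Realizes.exists_pullback (h : T.Realizes x y δ) {K' B' : C} {x' : K' ⟶ B'}
    {y' : B' ⟶ Z} {δ' : Extn T.E Z K'} (h' : T.Realizes x' y' δ') :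
    ∃ (H : C) (d : K' ⟶ H) (e : H ⟶ B) (d' : K ⟶ H) (e' : H ⟶ B'),
      T.Realizes d e (pull y δ') ∧ T.Realizes d' e' (pull y' δ) := by
  obtain ⟨H, c, γ, d, e, hc, hd⟩ := h'.exists_cocone_desc y
  obtain ⟨H', c', γ', d', e', hc', hd'⟩ := h.exists_cocone_desc y'
  have hc'' := T.realizes_of_iso (biprod.braiding B' B) (x' := c' ≫ (biprod.braiding B' B).hom)
    (y' := biprod.desc y y') rfl (by ext <;> simp) hc'
  obtain ⟨i, _⟩ := hc''.cocone_unique hc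
  exact ⟨H, d, e, d' ≫ i.hom, i.inv ≫ e', hd, T.realizes_of_iso i rfl (by simp) hd'⟩

end Homotopy

end Extriangulation
namespace Extriangulation

variable {C : Type u} [SmallCategory C] [Preadditive C] [HasZeroObject C] [HasBinaryBiproducts C]
  {T : Extriangulation C}

/-! ### Higher extensions and rigidity -/

theorem subsingleton_extn_of_injective {I : C} (hI : T.injectives I) (Z : C) :
    Subsingleton (Extn T.E Z I) := by
  refine subsingleton_of_forall_eq 0 fun θ => ?_
  obtain ⟨B, x, y, h⟩ := T.exists_realizes θ
  obtain ⟨r, hr⟩ := hI x y ⟨θ, h⟩ (𝟙 I)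
  rw [← push_id θ, ← hr, push_comp, h.push_eq_zero, push_zero]

theorem isZero_injective {I : C} (hI : IsZero I) : T.injectives I :=
  fun _ _ _ _ _ _ _ => ⟨0, hI.eq_of_tgt _ _⟩

theorem injective_biprod {I J : C} (hI : T.injectives I) (hJ : T.injectives J) :
    T.injectives (I ⊞ J) := by
  intro A B Z x y h g
  obtain ⟨a, ha⟩ := hI x y h (g ≫ biprod.fst)
  obtain ⟨b, hb⟩ := hJ x y h (g ≫ biprod.snd)
  exact ⟨biprod.lift a b, by ext <;> simp [ha, hb]⟩

theorem tensorPush_add (W : C ⥤ AddCommGrpCat.{u}) {A A' : C} (a b : A ⟶ A')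
    (t : ⨁ Z : C, Extn T.E Z A ⊗[ℤ] W.obj Z) :
    tensorPush T.E W (a + b) t = tensorPush T.E W a t + tensorPush T.E W b t := by
  classical
  induction t using DirectSum.induction_on with
  | zero => simp
  | add x y hx hy => rw [map_add, map_add, map_add, hx, hy]; abel
  | of Z x =>
    induction x using TensorProduct.induction_on with
    | zero => simp
    | add x y hx hy => rw [map_add, map_add, map_add, map_add, hx, hy]; abel
    | tmul δ x =>
      simp only [tensorPush, DirectSum.map_of]
      rw [← map_add]
      congr 1
      change (push (a + b) δ) ⊗ₜ[ℤ] x = (push a δ) ⊗ₜ[ℤ] x + (push b δ) ⊗ₜ[ℤ] x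
      rw [add_push, TensorProduct.add_tmul]

instance tensorFunctor_additive (W : C ⥤ AddCommGrpCat.{u}) : (tensorFunctor T.E W).Additive where
  map_add {A A' a b} := by
    refine AddCommGrpCat.hom_ext (AddMonoidHom.ext fun x => ?_)
    obtain ⟨x, rfl⟩ := QuotientAddGroup.mk_surjective x
    exact congrArg QuotientAddGroup.mk (tensorPush_add W a b x)

theorem higherExt_additive (X : C) : ∀ k, (higherExt T.E X k).Additive
  | 0 => T.additive_right (op X)
  | _ + 1 => tensorFunctor_additive _

theorem subsingleton_higherExt_of_injective {I : C} (hI : T.injectives I) (X : C) :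
    ∀ k, Subsingleton ((higherExt T.E X k).obj I)
  | 0 => subsingleton_extn_of_injective hI X
  | k + 1 => by
    classical
    have h : ∀ t : ⨁ Z : C, Extn T.E Z I ⊗[ℤ] (higherExt T.E X k).obj Z, t = 0 := by
      intro t
      induction t using DirectSum.induction_on with
      | zero => rfl
      | add x y hx hy => rw [hx, hy, add_zero]
      | of Z x =>
        induction x using TensorProduct.induction_on with
        | zero => simp
        | add x y hx hy => rw [map_add, hx, hy, add_zero]
        | tmul δ x =>
          have := subsingleton_extn_of_injective hI Z
          rw [Subsingleton.elim δ 0, TensorProduct.zero_tmul, map_zero]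
    refine subsingleton_of_forall_eq (0 : _ ⧸ tensorRel T.E (higherExt T.E X k) I) fun t => ?_
    obtain ⟨t, rfl⟩ := QuotientAddGroup.mk_surjective t
    rw [h t]
    rfl

/-- Dimension shifting: if `A ⟶ I ⟶ S` is a conflation with `I` injective and `W(I) = 0`, then
`w ↦ δ ⊗ w` is an isomorphism between `W(S)` and the coend `∫^Z E(Z, A) ⊗ W(Z)`; here only the
simultaneous vanishing of both sides is recorded. -/
theorem Realizes.subsingleton_tensorFunctor_iff {A I S : C} {x : A ⟶ I} {y : I ⟶ S}
    {δ : Extn T.E S A} (h : T.Realizes x y δ) (hI : T.injectives I) (W : C ⥤ AddCommGrpCat.{u})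
    [W.Additive] (hW : Subsingleton (W.obj I)) :
    Subsingleton ((tensorFunctor T.E W).obj A) ↔ Subsingleton (W.obj S) := by
  classical
  have surj : ∀ {Z : C} (θ : Extn T.E Z A), ∃ c : Z ⟶ S, pull c δ = θ := fun {Z} θ =>
    h.exists_pull_eq θ ((subsingleton_extn_of_injective hI Z).elim _ _)
  constructor
  · intro hA
    have indep : ∀ {Z : C} (c c' : Z ⟶ S) (w : W.obj Z), pull c δ = pull c' δ →
        W.map c w = W.map c' w := by
      intro Z c c' w hc
      obtain ⟨b, hb⟩ := h.colift (c - c') (by rw [sub_pull, hc, sub_self])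
      rw [← sub_add_cancel c c', ← hb, W.map_add, W.map_comp]
      change W.map y (W.map b w) + W.map c' w = _
      rw [Subsingleton.elim (W.map b w) 0, map_zero, zero_add]
    choose l hl using @surj
    -- the inverse map sends `(δ · c) ⊗ w` to `W(c)(w)`
    let φ : ∀ Z : C, Extn T.E Z A ⊗[ℤ] W.obj Z →+ W.obj S := fun Z =>
      (TensorProduct.lift (LinearMap.mk₂ ℤ (fun (θ : Extn T.E Z A) (w : W.obj Z) => W.map (l θ) w)
        (fun θ θ' w => by
          have e := indep (l (θ + θ')) (l θ + l θ') w (by rw [add_pull, hl, hl, hl])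
          rw [e, W.map_add]
          rfl)
        (fun m θ w => by
          have hm : pull (m • l θ) δ = m • θ := by
            have := T.additive_left A
            have e := ConcreteCategory.congr_hom
              ((T.E.flip.obj A).map_zsmul (f := (l θ).op) (r := m)) δ
            refine e.trans ?_
            change m • pull (l θ) δ = _
            rw [hl]
          have e := indep (l (m • θ)) (m • l θ) w (by rw [hl, hm])
          rw [e, W.map_zsmul]
          rfl)
        (fun θ w w' => map_add _ _ _)
        (fun m θ w => map_zsmul (W.map (l θ)).hom _ _))).toAddMonoidHom
    have hφ : ∀ (Z : C) (θ : Extn T.E Z A) (w : W.obj Z), φ Z (θ ⊗ₜ w) = W.map (l θ) w :=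
      fun Z θ w => rfl
    let Φ : (⨁ Z : C, Extn T.E Z A ⊗[ℤ] W.obj Z) →+ W.obj S := DirectSum.toAddMonoid φ
    have hΦ : tensorRel T.E W A ≤ Φ.ker := by
      refine (AddSubgroup.closure_le _).2 ?_
      rintro _ ⟨Z, Z', f, θ, w, rfl⟩
      change Φ _ = 0
      rw [map_sub, sub_eq_zero]
      simp only [Φ, DirectSum.toAddMonoid_of, hφ]
      rw [indep (l (pull f θ)) (f ≫ l θ) w (by rw [hl, pull_comp, hl]), W.map_comp]
      rfl
    refine subsingleton_of_forall_eq 0 fun w => ?_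
    have h₀ : (QuotientAddGroup.mk (DirectSum.of (fun Z : C => Extn T.E Z A ⊗[ℤ] W.obj Z) S
        (δ ⊗ₜ w)) : _ ⧸ tensorRel T.E W A) = 0 := hA.elim _ _
    have h₁ : Φ _ = 0 := hΦ ((QuotientAddGroup.eq_zero_iff _).1 h₀)
    simp only [Φ, DirectSum.toAddMonoid_of, hφ] at h₁
    rw [indep (l δ) (𝟙 S) w (by rw [hl, pull_id]), W.map_id] at h₁
    exact h₁
  · intro hS
    refine subsingleton_of_forall_eq (0 : _ ⧸ tensorRel T.E W A) fun t => ?_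
    obtain ⟨t, rfl⟩ := QuotientAddGroup.mk_surjective t
    refine (QuotientAddGroup.eq_zero_iff _).2 ?_
    induction t using DirectSum.induction_on with
    | zero => exact zero_mem _
    | add x y hx hy => exact add_mem hx hy
    | of Z x =>
      induction x using TensorProduct.induction_on with
      | zero => rw [map_zero]; exact zero_mem _
      | add x y hx hy => rw [map_add]; exact add_mem hx hy
      | tmul θ w =>
        obtain ⟨c, rfl⟩ := surj θ
        have := AddSubgroup.subset_closure (k := {t | ∃ (Z Z' : C) (f : Z ⟶ Z') (δ : Extn T.E Z' A)
          (x : W.obj Z), t = DirectSum.of (fun Z : C => Extn T.E Z A ⊗[ℤ] W.obj Z) Z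
            (pull f δ ⊗ₜ x) - DirectSum.of (fun Z : C => Extn T.E Z A ⊗[ℤ] W.obj Z) Z'
            (δ ⊗ₜ W.map f x)}) ⟨Z, S, c, δ, w, rfl⟩
        rw [Subsingleton.elim (W.map c w) 0, TensorProduct.tmul_zero, map_zero, sub_zero] at this
        exact this

variable (T) in
/-- The objects `Y` with `𝔼^i(P, Y) = 0` for `1 ≤ i ≤ j`. -/
def extVanish (P : ObjectProperty C) (j : ℕ) : ObjectProperty C := fun Y =>
  ∀ k < j, ∀ X, P X → Subsingleton ((higherExt T.E X k).obj Y)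

section ExtVanish

variable {P : ObjectProperty C} {j : ℕ}

theorem extVanish_of_retract {Y H : C} (i : Y ⟶ H) (r : H ⟶ Y) (h : i ≫ r = 𝟙 Y)
    (hH : extVanish T P j H) : extVanish T P j Y := by
  intro k hk X hX
  have := hH k hk X hX
  refine subsingleton_of_forall_eq 0 fun t => ?_
  have e := ConcreteCategory.congr_hom ((higherExt T.E X k).map_comp i r) t
  rw [h, (higherExt T.E X k).map_id] at e
  refine e.trans ?_
  change (higherExt T.E X k).map r ((higherExt T.E X k).map i t) = 0
  rw [Subsingleton.elim ((higherExt T.E X k).map i t) 0, map_zero]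

/-- Dimension shifting along an injective object, for the classes `extVanish`. -/
theorem Realizes.extVanish_succ_iff {A I S : C} {x : A ⟶ I} {y : I ⟶ S}
    {δ : Extn T.E S A} (h : T.Realizes x y δ) (hI : T.injectives I) :
    extVanish T P (j + 1) A ↔
      (∀ X, P X → Subsingleton (Extn T.E X A)) ∧ extVanish T P j S := by
  have key : ∀ (X : C) (k : ℕ), Subsingleton ((higherExt T.E X (k + 1)).obj A) ↔
      Subsingleton ((higherExt T.E X k).obj S) := fun X k =>
    have := higherExt_additive (T := T) X k
    h.subsingleton_tensorFunctor_iff hI _ (subsingleton_higherExt_of_injective hI X k)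
  constructor
  · intro hA
    exact ⟨hA 0 (Nat.succ_pos j), fun k hk X hX => (key X k).1 (hA (k + 1) (by omega) X hX)⟩
  · rintro ⟨h₀, hS⟩ k hk X hX
    cases k with
    | zero => exact h₀ X hX
    | succ k => exact (key X k).2 (hS k (by omega) X hX)

/-- The class `extVanish` is closed under extensions: by dimension shifting and the horseshoe
construction, this reduces to the half exactness of `E(X, -)`. -/
theorem Realizes.extVanish_middle (hinj : T.EnoughInjectives) {A B Z : C} {x : A ⟶ B} {y : B ⟶ Z}
    {δ : Extn T.E Z A} (h : T.Realizes x y δ) (hA : extVanish T P j A) (hZ : extVanish T P j Z) :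
    extVanish T P j B := by
  induction j generalizing A B Z with
  | zero => exact fun k hk => absurd hk (Nat.not_lt_zero k)
  | succ j ih =>
    obtain ⟨I, S, a, b, ⟨α, hα⟩, hI⟩ := hinj A
    obtain ⟨J, U, c, d, ⟨β, hβ⟩, hJ⟩ := hinj Z
    obtain ⟨H, d₁, e₁, d₂, e₂, h₁, h₂⟩ := h.exists_pushout hα
    -- as `I` is injective, the pushout `H` is `I ⊞ Z`, which embeds into the injective `I ⊞ J`
    rw [(subsingleton_extn_of_injective hI Z).elim (push a δ) 0] at h₂
    obtain ⟨b₂, hb₂, hb₂'⟩ := T.iso_of_realizes h₂ (T.realizes_zero I Z)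
    have h₃ := (hβ.add_left I).iso_left b₂.symm
    obtain ⟨S', c', d', e', γ, _, _, hc', hd', _, _⟩ := T.et4 h₁ h₃
    obtain ⟨hA₀, hS⟩ := (hα.extVanish_succ_iff hI).1 hA
    obtain ⟨hZ₀, hU⟩ := (hβ.extVanish_succ_iff hJ).1 hZ
    refine (hc'.extVanish_succ_iff (injective_biprod hI hJ)).2 ⟨fun X hX => ?_, ih hd' hS hU⟩
    refine subsingleton_of_forall_eq 0 fun θ => ?_
    obtain ⟨θ', rfl⟩ := h.exists_push_of_push_eq_zero θ ((hZ₀ X hX).elim _ _)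
    rw [(hA₀ X hX).elim θ' 0, push_zero]

/-- The cone `Z` of `A ⟶ B` is a direct summand of the pushout of `B` and an injective object
containing `A`, which is an extension of a cosyzygy of `A` by `B`. -/
theorem Realizes.extVanish_cone (hinj : T.EnoughInjectives) {A B Z : C} {x : A ⟶ B} {y : B ⟶ Z}
    {δ : Extn T.E Z A} (h : T.Realizes x y δ) (hA : extVanish T P (j + 1) A)
    (hB : extVanish T P j B) : extVanish T P j Z := by
  obtain ⟨I, S, a, b, ⟨α, hα⟩, hI⟩ := hinj A
  obtain ⟨H, d₁, e₁, d₂, e₂, h₁, h₂⟩ := h.exists_pushout hα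
  rw [(subsingleton_extn_of_injective hI Z).elim (push a δ) 0] at h₂
  obtain ⟨t, ht⟩ := h₂.section_of_zero
  exact extVanish_of_retract t e₂ ht
    (h₁.extVanish_middle hinj hB ((hα.extVanish_succ_iff hI).1 hA).2)

/-- Each step of a `P`-resolution costs one degree of vanishing. -/
theorem extVanish_of_hasResolution (hinj : T.EnoughInjectives) {n : ℕ}
    (hrigid : T.IsRigid (n + 2) P) (m j : ℕ)
    (hm : m + j ≤ n + 1) (Z : C) (hZ : HasResolution T.IsConfl P m Z) : extVanish T P j Z := by
  induction m generalizing j Z with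
  | zero =>
    obtain ⟨X, hX, ⟨e⟩⟩ := hZ
    exact extVanish_of_retract e.inv e.hom e.inv_hom_id
      fun k hk X' hX' => hrigid k (by omega) X' X hX' hX
  | succ m ih =>
    obtain ⟨K, X, i, p, ⟨δ, h⟩, hX, hK⟩ := hZ
    exact h.extVanish_cone hinj (ih (j + 1) (by omega) K hK)
      fun k hk X' hX' => hrigid k (by omega) X' X hX' hX

/-- If `P` is `(n + 2)`-rigid, then `E(P, P^∧_n) = 0`. -/
theorem subsingleton_extn_of_res (hinj : T.EnoughInjectives) {n : ℕ}
    (hrigid : T.IsRigid (n + 2) P) {X Y : C}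
    (hX : P X) (hY : T.res P n Y) : Subsingleton (Extn T.E X Y) := by
  obtain ⟨m, hm, hY⟩ := hY
  exact extVanish_of_hasResolution hinj hrigid m 1 (by omega) Y hY 0 (by omega) X hX

end ExtVanish

end Extriangulation
/-! ### Classes closed under `add` -/

section Add

variable {A : Type w} [Category.{v} A]

theorem free_biprod [HasZeroMorphisms A] [HasBinaryBiproducts A] {P : ObjectProperty A} {X Y : A}
    (hX : P X) (hY : P Y) : free P (X ⊞ Y) := by
  let F : Fin 2 → A := fun j => match j with | 0 => X | 1 => Y
  let i : ∀ j, F j ⟶ X ⊞ Y := fun j => match j with | 0 => biprod.inl | 1 => biprod.inr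
  refine ⟨2, F, i, fun j => ?_, ⟨Cofan.IsColimit.mk _ (fun s => biprod.desc (s.inj 0) (s.inj 1))
    (fun s j => ?_) (fun s m hm => ?_)⟩⟩
  · match j with
    | 0 => exact hX
    | 1 => exact hY
  · match j with
    | 0 => exact biprod.inl_desc _ _
    | 1 => exact biprod.inr_desc _ _
  · refine biprod.hom_ext' _ _ ?_ ?_
    · exact (hm 0).trans (biprod.inl_desc _ _).symm
    · exact (hm 1).trans (biprod.inr_desc _ _).symm

theorem free_of_mem {P : ObjectProperty A} {X : A} (hX : P X) : free P X :=
  ⟨1, fun _ => X, fun _ => 𝟙 X, fun _ => hX,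
    ⟨Cofan.IsColimit.mk _ (fun s => s.inj 0) (fun s j => by
      rw [Subsingleton.elim j 0]; exact Category.id_comp _)
      (fun s m hm => (Category.id_comp m).symm.trans (hm 0))⟩⟩

theorem add_of_free [HasZeroMorphisms A] [HasZeroObject A] {P : ObjectProperty A} {X : A}
    (hX : free P X) : add P X := by
  refine ⟨0, BinaryCofan.mk (𝟙 X) 0, ⟨?_⟩, hX⟩
  exact BinaryCofan.IsColimit.mk _ (fun f _ => f) (fun f g => Category.id_comp _)
    (fun f g => (isZero_zero A).eq_of_src _ _)
    (fun f g m hm _ => (Category.id_comp m).symm.trans hm)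

/-- `add P` is closed under direct summands with a complement. -/
theorem add_of_summand [Preadditive A] [HasBinaryBiproducts A] {P : ObjectProperty A}
    {Z B M : A} (u : Z ⟶ M) (v : M ⟶ Z) (g : B ⟶ M) (f : M ⟶ B) (huv : u ≫ v = 𝟙 Z)
    (hgf : g ≫ f = 𝟙 B) (huf : u ≫ f = 0) (hgv : g ≫ v = 0) (h : v ≫ u + f ≫ g = 𝟙 M)
    (hM : add P M) : add P Z := by
  obtain ⟨M', c, ⟨hc⟩, hP⟩ := hM
  let l : M ⟶ c.pt := c.inl
  let r : M' ⟶ c.pt := c.inr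
  let D : ∀ {V : A}, (M ⟶ V) → (M' ⟶ V) → (c.pt ⟶ V) := fun s t => hc.desc (BinaryCofan.mk s t)
  have hl : ∀ {V : A} (s : M ⟶ V) (t : M' ⟶ V), l ≫ D s t = s := fun s t =>
    hc.fac (BinaryCofan.mk s t) ⟨WalkingPair.left⟩
  have hr : ∀ {V : A} (s : M ⟶ V) (t : M' ⟶ V), r ≫ D s t = t := fun s t =>
    hc.fac (BinaryCofan.mk s t) ⟨WalkingPair.right⟩
  have uniq : ∀ {V : A} (s : Z ⟶ V) (t : B ⊞ M' ⟶ V) (m : c.pt ⟶ V), (u ≫ l) ≫ m = s →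
      biprod.desc (g ≫ l) r ≫ m = t → m = D (v ≫ s + f ≫ biprod.inl ≫ t) (biprod.inr ≫ t) := by
    rintro V _ _ m rfl rfl
    refine BinaryCofan.IsColimit.hom_ext hc ?_ ?_
    · change l ≫ m = l ≫ D _ _
      rw [hl, biprod.inl_desc_assoc]
      simp only [← Category.assoc, ← Preadditive.add_comp, h, Category.id_comp]
    · change r ≫ m = r ≫ D _ _
      rw [hr, biprod.inr_desc_assoc]
  refine ⟨B ⊞ M', BinaryCofan.mk (u ≫ l) (biprod.desc (g ≫ l) r),
    ⟨BinaryCofan.IsColimit.mk _ (fun s t => D (v ≫ s + f ≫ biprod.inl ≫ t) (biprod.inr ≫ t))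
      (fun s t => ?_) (fun s t => ?_) uniq⟩, hP⟩
  · change (u ≫ l) ≫ D _ _ = s
    rw [Category.assoc, hl, Preadditive.comp_add, reassoc_of% huv, reassoc_of% huf]
    simp
  · change biprod.desc (g ≫ l) r ≫ D _ _ = t
    ext
    · simp [hl, reassoc_of% hgv, reassoc_of% hgf]
    · simp [hr]

end Add

namespace Extriangulation

variable {C : Type u} [SmallCategory C] [Preadditive C] [HasZeroObject C] [HasBinaryBiproducts C]

/-- An `(n + 2)`-rigid class `P = add(P)` containing the injectives, in a category with enough
injectives. -/
structure RigidSetting (T : Extriangulation C) (n : ℕ) (P : ObjectProperty C) : Prop where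
  enough : T.EnoughInjectives
  add_eq : P = add P
  rigid : T.IsRigid (n + 2) P
  injectives_le : T.injectives ≤ P

namespace RigidSetting

variable {T : Extriangulation C} {n : ℕ} {P : ObjectProperty C} (s : T.RigidSetting n P)

/-! ### The classes `P^∧_m` -/

include s

theorem zero_mem {Z : C} (hZ : IsZero Z) : P Z := s.injectives_le _ (isZero_injective hZ)

theorem biprod_mem {X Y : C} (hX : P X) (hY : P Y) : P (X ⊞ Y) := by
  rw [s.add_eq]
  exact add_of_free (free_biprod hX hY)

theorem summand_mem {Z B M : C} {g : B ⟶ M} {v : M ⟶ Z} (h : T.Realizes g v 0) (hM : P M) :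
    P Z := by
  obtain ⟨f, u, h₁, h₂, h₃, h₄, h₅⟩ := h.splitting
  rw [s.add_eq] at hM ⊢
  exact add_of_summand u v g f h₂ h₁ h₄ h₃ (by rw [add_comm, h₅]) hM

theorem iso_mem {X Y : C} (e : X ≅ Y) (hX : P X) : P Y :=
  s.summand_mem (g := (0 : (0 : C) ⟶ X)) (v := e.hom) (T.realizes_of_iso e.symm (by simp) (by simp)
    (realizes_zero_id (0 : C) Y (isZero_zero C))) hX

theorem hasResolution_succ (m : ℕ) (Z : C) (h : HasResolution T.IsConfl P m Z) :
    HasResolution T.IsConfl P (m + 1) Z := by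
  induction m generalizing Z with
  | zero =>
    obtain ⟨X, hX, ⟨e⟩⟩ := h
    exact ⟨0, Z, 0, 𝟙 Z, ⟨0, realizes_zero_id _ _ (isZero_zero C)⟩, s.iso_mem e hX,
      0, s.zero_mem (isZero_zero C), ⟨Iso.refl _⟩⟩
  | succ m ih =>
    obtain ⟨K, X, i, p, hc, hX, hK⟩ := h
    exact ⟨K, X, i, p, hc, hX, ih K hK⟩

theorem hasResolution_of_res {m : ℕ} {Z : C} (h : T.res P m Z) :
    HasResolution T.IsConfl P m Z := by
  obtain ⟨k, hk, h⟩ := h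
  induction m, hk using Nat.le_induction with
  | base => exact h
  | succ m _ ih => exact s.hasResolution_succ m Z ih

omit s in
theorem res_mono {k m : ℕ} (hkm : k ≤ m) {Z : C} (h : T.res P k Z) : T.res P m Z := by
  obtain ⟨l, hl, h⟩ := h
  exact ⟨l, hl.trans hkm, h⟩

omit s in
theorem res_of_mem (m : ℕ) {X : C} (hX : P X) : T.res P m X :=
  ⟨0, Nat.zero_le _, X, hX, ⟨Iso.refl _⟩⟩

theorem mem_of_res_zero {X : C} (hX : T.res P 0 X) : P X := by
  obtain ⟨Y, hY, ⟨e⟩⟩ := s.hasResolution_of_res hX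
  exact s.iso_mem e hY

omit s in
theorem res_of_realizes {m : ℕ} {K X Z : C} {i : K ⟶ X} {p : X ⟶ Z} {δ : Extn T.E Z K}
    (h : T.Realizes i p δ) (hX : P X) (hK : T.res P m K) : T.res P (m + 1) Z := by
  obtain ⟨k, hk, hK⟩ := hK
  exact ⟨k + 1, by omega, K, X, i, p, ⟨δ, h⟩, hX, hK⟩

theorem exists_realizes_of_res {m : ℕ} {Z : C} (h : T.res P (m + 1) Z) :
    ∃ (K X : C) (i : K ⟶ X) (p : X ⟶ Z) (δ : Extn T.E Z K),
      T.Realizes i p δ ∧ P X ∧ T.res P m K := by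
  obtain ⟨K, X, i, p, ⟨δ, h⟩, hX, hK⟩ := s.hasResolution_of_res h
  exact ⟨K, X, i, p, δ, h, hX, m, le_rfl, hK⟩

theorem res_iso {m : ℕ} {Z Z' : C} (e : Z ≅ Z') (h : T.res P m Z) : T.res P m Z' := by
  cases m with
  | zero => exact res_of_mem 0 (s.iso_mem e (s.mem_of_res_zero h))
  | succ m =>
    obtain ⟨K, X, i, p, δ, h, hX, hK⟩ := s.exists_realizes_of_res h
    exact res_of_realizes (h.iso_right e.symm) hX hK

theorem res_biprod {m : ℕ} {Z Z' : C} (h : T.res P m Z) (h' : T.res P m Z') :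
    T.res P m (Z ⊞ Z') := by
  induction m generalizing Z Z' with
  | zero => exact res_of_mem 0 (s.biprod_mem (s.mem_of_res_zero h) (s.mem_of_res_zero h'))
  | succ m ih =>
    obtain ⟨K, X, i, p, δ, h, hX, hK⟩ := s.exists_realizes_of_res h
    obtain ⟨K', X', i', p', δ', h', hX', hK'⟩ := s.exists_realizes_of_res h'
    exact res_of_realizes (T.realizes_sum h h') (s.biprod_mem hX hX') (ih hK hK')

theorem subsingleton_extn {X Y : C} (hX : P X) (hY : T.res P n Y) : Subsingleton (Extn T.E X Y) :=
  subsingleton_extn_of_res s.enough s.rigid hX hY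

theorem extn_eq_zero {X Y : C} (hX : P X) (hY : T.res P n Y) (δ : Extn T.E X Y) : δ = 0 :=
  (s.subsingleton_extn hX hY).elim _ _

/-- The complement of an object of `P^∧_m` in an object of `P^∧_m` lies in `P^∧_m`, for
`m ≤ n + 1`. The category is not assumed to be weakly idempotent complete, so that the complement
has to be given. -/
theorem res_complement {m : ℕ} (hm : m ≤ n + 1) {B M Z : C} {g : B ⟶ M} {v : M ⟶ Z}
    (h : T.Realizes g v 0) (hB : T.res P m B) (hM : T.res P m M) : T.res P m Z := by
  induction m generalizing B M Z with
  | zero => exact res_of_mem 0 (s.summand_mem h (s.mem_of_res_zero hM))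
  | succ m ih =>
    obtain ⟨K, X, i, p, δ, hδ, hX, hK⟩ := s.exists_realizes_of_res hM
    obtain ⟨K', X', i', p', δ', hδ', hX', hK'⟩ := s.exists_realizes_of_res hB
    obtain ⟨r, t, hgr, -, -, -, -⟩ := h.splitting
    obtain ⟨f, hf⟩ := hδ'.colift (p ≫ r) (s.extn_eq_zero hX (res_mono (by omega) hK') _)
    obtain ⟨L, d, e, l, γ, hl₁, hl₂, hl, hde, -, -⟩ := T.et4_op hδ h
    -- the homotopy pullback of `L` and `X'` over `B` is both `K ⊞ X'` and `K' ⊞ L`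
    obtain ⟨H, d₁, e₁, d₂, e₂, h₁, h₂⟩ := hde.exists_pullback hδ'
    have he : pull e δ' = 0 := (hδ'.pull_eq_zero_iff e).2
      ⟨l ≫ f, by rw [Category.assoc, hf, reassoc_of% hl₂, hgr, Category.comp_id]⟩
    rw [he] at h₁
    rw [s.extn_eq_zero hX' (res_mono (by omega) hK) (pull p' _)] at h₂
    obtain ⟨b, -, -⟩ := T.iso_of_realizes (T.realizes_zero K X') h₂
    exact res_of_realizes hl hX
      (ih (by omega) h₁ hK' (s.res_iso b (s.res_biprod hK (res_of_mem m hX'))))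

/-- A morphism `a` which is a split monomorphism up to the ideal `[P]` becomes, after adding maps to
an object of `P` and to an injective, the inflation of a split conflation. -/
theorem exists_split_of_retraction {K M X : C} (a : K ⟶ M) (f : K ⟶ X) (r : M ⟶ K) (t : X ⟶ K)
    (h : a ≫ r + f ≫ t = 𝟙 K) (hK : T.res P (n + 1) K) (hM : T.res P (n + 1) M) (hX : P X) :
    ∃ (I : C) (i : K ⟶ I) (N : C) (b : M ⊞ (X ⊞ I) ⟶ N), T.injectives I ∧ T.res P (n + 1) N ∧
      T.Realizes (biprod.lift a (biprod.lift f i)) b 0 := by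
  -- the component `i` makes `(a, f, i)` an inflation; its class dies because of the retraction
  obtain ⟨I, Z, i, p, ⟨δ, hδ⟩, hI⟩ := s.enough K
  obtain ⟨H, c, γ, -, -, hγ, -⟩ := hδ.exists_cone_lift f
  obtain ⟨N, b, θ, -, -, hθ, -⟩ := hγ.exists_cone_lift a
  have hr : biprod.lift a (biprod.lift f i) ≫ biprod.desc r (biprod.desc t 0) = 𝟙 K := by
    simpa using h
  have h₀ : θ = 0 := by
    rw [← push_id θ, ← hr, push_comp, hθ.push_eq_zero, push_zero]
  rw [h₀] at hθ
  exact ⟨I, i, N, b, hI, s.res_complement le_rfl hθ hK (s.res_biprod hM (s.res_biprod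
    (res_of_mem _ hX) (res_of_mem _ (s.injectives_le _ hI)))), hθ⟩

end RigidSetting
end Extriangulation
/-! ### Exactness in categories of functors to abelian groups -/

section FunctorCategory

variable {J : Type w} [Category.{v} J]

theorem exact_iff_app (S : ShortComplex (J ⥤ AddCommGrpCat.{u})) :
    S.Exact ↔ ∀ (j : J) (x : S.X₂.obj j), S.g.app j x = 0 → ∃ y, S.f.app j y = x := by
  have h : S.Exact ↔ ∀ j, (S.map ((evaluation J AddCommGrpCat.{u}).obj j)).Exact := by
    refine ⟨fun h j => h.map _, fun h => ?_⟩
    rw [ShortComplex.exact_iff_isZero_homology]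
    refine (Functor.isZero_iff _).2 fun j => ?_
    exact IsZero.of_iso ((ShortComplex.exact_iff_isZero_homology _).1 (h j))
      (S.mapHomologyIso ((evaluation J AddCommGrpCat.{u}).obj j)).symm
  rw [h]
  exact forall_congr' fun j => ShortComplex.ab_exact_iff _

theorem epi_iff_app {G H : J ⥤ AddCommGrpCat.{u}} (f : G ⟶ H) :
    Epi f ↔ ∀ j, Function.Surjective (f.app j) := by
  rw [NatTrans.epi_iff_epi_app]
  exact forall_congr' fun j => AddCommGrpCat.epi_iff_surjective _

theorem mono_iff_app {G H : J ⥤ AddCommGrpCat.{u}} (f : G ⟶ H) :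
    Mono f ↔ ∀ j, Function.Injective (f.app j) := by
  rw [NatTrans.mono_iff_mono_app]
  exact forall_congr' fun j => AddCommGrpCat.mono_iff_injective _

end FunctorCategory

/-! ### Presented functors on the quotient by an ideal -/

namespace HomIdeal

section

variable {D : Type w} [Category.{v} D] [Preadditive D] (I : HomIdeal D)

instance proj_additive : I.proj.Additive :=
  CategoryTheory.Quotient.functor_additive I.rel _

theorem proj_map_eq_iff {X Y : D} (f g : X ⟶ Y) :
    I.proj.map f = I.proj.map g ↔ f - g ∈ I.carrier X Y :=
  CategoryTheory.Quotient.functor_map_eq_iff I.rel f g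

theorem hasBinaryBiproducts_quot [HasBinaryBiproducts D] : HasBinaryBiproducts I.Quot where
  has_binary_biproduct X Y :=
    hasBinaryBiproduct_of_total (I.proj.mapBinaryBicone (BinaryBiproduct.bicone X.as Y.as)) (by
      have e := congrArg I.proj.map (biprod.total (X := X.as) (Y := Y.as))
      rw [I.proj.map_add, I.proj.map_comp, I.proj.map_comp, I.proj.map_id] at e
      exact e)

theorem hasZeroObject_quot [HasZeroObject D] : HasZeroObject I.Quot :=
  ⟨⟨I.proj.obj 0, I.proj.map_isZero (isZero_zero D)⟩⟩

end

variable {D : Type u} [SmallCategory D] [Preadditive D] {I : HomIdeal D}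

/-- The action of a morphism of `D` on the values of a functor on `D/I`. -/
def act (G : I.Quot ⥤ AddCommGrpCat.{u}) {Y Y' : D} (a : Y ⟶ Y') :
    G.obj (I.proj.obj Y) →+ G.obj (I.proj.obj Y') :=
  (G.map (I.proj.map a)).hom

/-- The component of a morphism of functors on `D/I` at an object of `D`. -/
def nat {G G' : I.Quot ⥤ AddCommGrpCat.{u}} (φ : G ⟶ G') (Y : D) :
    G.obj (I.proj.obj Y) →+ G'.obj (I.proj.obj Y) :=
  (φ.app (I.proj.obj Y)).hom

section act

variable (G : I.Quot ⥤ AddCommGrpCat.{u}) {Y Y' Y'' : D}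

theorem act_id (z : G.obj (I.proj.obj Y)) : act G (𝟙 Y) z = z := by
  simp [act]

theorem act_comp (a : Y ⟶ Y') (b : Y' ⟶ Y'') (z : G.obj (I.proj.obj Y)) :
    act G (a ≫ b) z = act G b (act G a z) := by
  simp [act]

theorem act_congr {a b : Y ⟶ Y'} (h : I.proj.map a = I.proj.map b) (z : G.obj (I.proj.obj Y)) :
    act G a z = act G b z := by
  rw [act, h]; rfl

theorem nat_act {G G' : I.Quot ⥤ AddCommGrpCat.{u}} (φ : G ⟶ G') (a : Y ⟶ Y')
    (z : G.obj (I.proj.obj Y)) : nat φ Y' (act G a z) = act G' a (nat φ Y z) :=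
  ConcreteCategory.congr_hom (φ.naturality (I.proj.map a)) z

theorem nat_comp {G G' G'' : I.Quot ⥤ AddCommGrpCat.{u}} (φ : G ⟶ G') (ψ : G' ⟶ G'')
    (z : G.obj (I.proj.obj Y)) : nat (φ ≫ ψ) Y z = nat ψ Y (nat φ Y z) := rfl

theorem hom_ext_nat {G G' : I.Quot ⥤ AddCommGrpCat.{u}} {φ ψ : G ⟶ G'}
    (h : ∀ (Y : D) (z : G.obj (I.proj.obj Y)), nat φ Y z = nat ψ Y z) : φ = ψ :=
  NatTrans.ext (funext fun Y => AddCommGrpCat.hom_ext (AddMonoidHom.ext (h Y.as)))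

theorem additive_of_act
    (h : ∀ (Y Y' : D) (a b : Y ⟶ Y') z, act G (a + b) z = act G a z + act G b z) :
    G.Additive where
  map_add {X Y f g} := by
    obtain ⟨f, rfl⟩ := I.proj.map_surjective (X := X.as) (Y := Y.as) f
    obtain ⟨g, rfl⟩ := I.proj.map_surjective (X := X.as) (Y := Y.as) g
    rw [← I.proj.map_add]
    exact AddCommGrpCat.hom_ext (AddMonoidHom.ext (h _ _ f g))

variable [G.Additive]

theorem act_add (a b : Y ⟶ Y') (z : G.obj (I.proj.obj Y)) :
    act G (a + b) z = act G a z + act G b z := by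
  simp only [act, Functor.map_add]; rfl

theorem act_sub (a b : Y ⟶ Y') (z : G.obj (I.proj.obj Y)) :
    act G (a - b) z = act G a z - act G b z := by
  simp only [act, Functor.map_sub]; rfl

theorem act_zero (z : G.obj (I.proj.obj Y)) : act G (0 : Y ⟶ Y') z = 0 := by
  simp only [act, Functor.map_zero]; rfl

end act

/-- The element `z ∈ G(V)` generates the functor `G` on `D/I`, with relations generated by
`j : V ⟶ X`: the sequence `Hom(X, -) ⟶ Hom(V, -) ⟶ G ⟶ 0` defined by `j` and `z` is exact. -/
structure IsPresentedBy (G : I.Quot ⥤ AddCommGrpCat.{u}) {V X : D} (j : V ⟶ X)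
    (z : G.obj (I.proj.obj V)) : Prop where
  rel : act G j z = 0
  gen : ∀ (Y : D) (g : G.obj (I.proj.obj Y)), ∃ f : V ⟶ Y, act G f z = g
  ker : ∀ (Y : D) (f : V ⟶ Y), act G f z = 0 → ∃ h : X ⟶ Y, I.proj.map f = I.proj.map (j ≫ h)

/-- Two functors with the same presentation are isomorphic. -/
theorem IsPresentedBy.nonempty_iso {G G' : I.Quot ⥤ AddCommGrpCat.{u}} [G.Additive] [G'.Additive]
    {V X : D} {j : V ⟶ X} {z : G.obj (I.proj.obj V)} {z' : G'.obj (I.proj.obj V)}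
    (h : IsPresentedBy G j z) (h' : IsPresentedBy G' j z') : Nonempty (G ≅ G') := by
  have key : ∀ {G G' : I.Quot ⥤ AddCommGrpCat.{u}} [G.Additive] [G'.Additive]
      {z : G.obj (I.proj.obj V)} {z' : G'.obj (I.proj.obj V)}, IsPresentedBy G j z →
      IsPresentedBy G' j z' → ∀ (Y : D) (f f' : V ⟶ Y), act G f z = act G f' z →
      act G' f z' = act G' f' z' := by
    intro G G' _ _ z z' h h' Y f f' hf
    obtain ⟨k, hk⟩ := h.ker Y (f - f') (by rw [act_sub, hf, sub_self])
    rw [← sub_eq_zero, ← act_sub, act_congr G' hk, act_comp, h'.rel, map_zero]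
  choose l hl using h.gen
  let φ : G ⟶ G' :=
    { app := fun Y => AddCommGrpCat.ofHom (AddMonoidHom.mk'
        (fun g : G.obj (I.proj.obj Y.as) => (act G' (l Y.as g) z' : G'.obj (I.proj.obj Y.as)))
        (fun a b => by
          rw [← act_add]
          exact key h h' _ _ _ (by rw [act_add, hl, hl, hl])))
      naturality := fun Y Y' f => by
        obtain ⟨f, rfl⟩ := I.proj.map_surjective (X := Y.as) (Y := Y'.as) f
        refine AddCommGrpCat.hom_ext (AddMonoidHom.ext fun g => ?_)
        change act G' (l Y'.as (act G f g)) z' = act G' f (act G' (l Y.as g) z')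
        rw [← act_comp]
        exact key h h' _ _ _ (by rw [act_comp, hl, hl]) }
  have hφ : ∀ Y : I.Quot, IsIso (φ.app Y) := fun Y => by
    rw [ConcreteCategory.isIso_iff_bijective]
    constructor
    · intro a b hab
      have e := key h' h _ _ _ hab
      rwa [hl, hl] at e
    · intro g
      obtain ⟨f, hf⟩ := h'.gen Y.as g
      refine ⟨act G f z, ?_⟩
      rw [← hf]
      exact key h h' _ _ _ (hl _ _)
  exact ⟨@asIso _ _ _ _ φ (NatIso.isIso_of_isIso_app φ)⟩

/-- The presentation by representable functors, as exactness of a sequence of functors. -/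
theorem exists_isPresentedBy_iff (G : I.Quot ⥤ AddCommGrpCat.{u}) [G.Additive] (X V : D) :
    (∃ (j : V ⟶ X) (z : G.obj (I.proj.obj V)), IsPresentedBy G j z) ↔
    ∃ (α : preadditiveCoyoneda.obj (op (I.proj.obj X)) ⟶
        preadditiveCoyoneda.obj (op (I.proj.obj V)))
      (π : preadditiveCoyoneda.obj (op (I.proj.obj V)) ⟶ G) (zero : α ≫ π = 0),
      (ShortComplex.mk α π zero).Exact ∧ Epi π := by
  constructor
  · rintro ⟨j, z, h⟩
    let π : preadditiveCoyoneda.obj (op (I.proj.obj V)) ⟶ G :=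
      { app := fun Y => AddCommGrpCat.ofHom (AddMonoidHom.mk'
          (fun f : I.proj.obj V ⟶ Y => G.map f z)
          (fun a b => ConcreteCategory.congr_hom (G.map_add (f := a) (g := b)) z))
        naturality := fun Y Y' f => by
          refine AddCommGrpCat.hom_ext (AddMonoidHom.ext fun g => ?_)
          exact ConcreteCategory.congr_hom (G.map_comp g f) z }
    have zero : preadditiveCoyoneda.map (I.proj.map j).op ≫ π = 0 := by
      refine NatTrans.ext (funext fun Y => AddCommGrpCat.hom_ext (AddMonoidHom.ext fun g => ?_))
      refine (ConcreteCategory.congr_hom (G.map_comp (I.proj.map j) g) z).trans ?_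
      change G.map g (act G j z) = 0
      rw [h.rel, map_zero]
    refine ⟨_, π, zero, ?_, ?_⟩
    · rw [exact_iff_app]
      intro Y f hf
      obtain ⟨f, rfl⟩ := I.proj.map_surjective (X := V) (Y := Y.as) f
      obtain ⟨k, hk⟩ := h.ker Y.as f hf
      exact ⟨I.proj.map k, by rw [hk, I.proj.map_comp]; rfl⟩
    · rw [epi_iff_app]
      intro Y g
      obtain ⟨f, hf⟩ := h.gen Y.as g
      exact ⟨I.proj.map f, hf⟩
  · rintro ⟨α, π, zero, hex, hepi⟩
    rw [exact_iff_app] at hex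
    rw [epi_iff_app] at hepi
    obtain ⟨β, hβ⟩ := preadditiveCoyoneda.map_surjective α
    obtain ⟨j, hj⟩ := I.proj.map_surjective (X := V) (Y := X) β.unop
    have hβ' : β = (I.proj.map j).op := by rw [hj]; rfl
    subst hβ'
    subst hβ
    let z : G.obj (I.proj.obj V) := π.app (I.proj.obj V) (𝟙 (I.proj.obj V))
    have hz : ∀ (Y : D) (f : V ⟶ Y), π.app (I.proj.obj Y) (I.proj.map f) = act G f z := by
      intro Y f
      have e := ConcreteCategory.congr_hom (π.naturality (I.proj.map f)) (𝟙 (I.proj.obj V))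
      refine Eq.trans ?_ e
      change _ = π.app (I.proj.obj Y) (𝟙 (I.proj.obj V) ≫ I.proj.map f)
      rw [Category.id_comp]
    refine ⟨j, z, ?_, fun Y g => ?_, fun Y f hf => ?_⟩
    · rw [← hz]
      have e := ConcreteCategory.congr_hom (congrArg (fun t => NatTrans.app t (I.proj.obj X)) zero)
        (𝟙 (I.proj.obj X))
      refine Eq.trans ?_ e
      change _ = π.app (I.proj.obj X) (I.proj.map j ≫ 𝟙 (I.proj.obj X))
      rw [Category.comp_id]
    · obtain ⟨f, hf⟩ := hepi (I.proj.obj Y) g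
      obtain ⟨f, rfl⟩ := I.proj.map_surjective f
      exact ⟨f, by rw [← hz, hf]⟩
    · obtain ⟨k, hk⟩ := hex (I.proj.obj Y) (I.proj.map f) ((hz Y f).trans hf)
      obtain ⟨k, rfl⟩ := I.proj.map_surjective k
      exact ⟨k, by rw [I.proj.map_comp]; exact hk.symm⟩

section Extension

variable {S : ShortComplex (I.Quot ⥤ AddCommGrpCat.{u})}

theorem nat_g_f (S : ShortComplex (I.Quot ⥤ AddCommGrpCat.{u})) (Y : D)
    (x : S.X₁.obj (I.proj.obj Y)) : nat S.g Y (nat S.f Y x) = 0 := by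
  rw [← nat_comp, S.zero]; rfl

theorem nat_injective (h : S.ShortExact) (Y : D) : Function.Injective (nat S.f Y) :=
  (mono_iff_app S.f).1 h.mono_f _

theorem nat_surjective (h : S.ShortExact) (Y : D) : Function.Surjective (nat S.g Y) :=
  (epi_iff_app S.g).1 h.epi_g _

theorem nat_exact (h : S.ShortExact) (Y : D) (x : S.X₂.obj (I.proj.obj Y))
    (hx : nat S.g Y x = 0) : ∃ y, nat S.f Y y = x :=
  (exact_iff_app S).1 h.exact _ x hx

variable [HasBinaryBiproducts D]

/-- Extensions of additive functors are additive. -/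
theorem additive_of_shortExact (h : S.ShortExact) [S.X₁.Additive] [S.X₃.Additive] :
    S.X₂.Additive := by
  have h0 : ∀ (Y Y' : D) x, act S.X₂ (0 : Y ⟶ Y') x = 0 := by
    intro Y Y' x
    obtain ⟨w, hw⟩ := nat_exact h Y' (act S.X₂ (0 : Y ⟶ Y') x) (by rw [nat_act, act_zero])
    have e : act S.X₂ (0 : Y' ⟶ Y') (act S.X₂ (0 : Y ⟶ Y') x) = act S.X₂ (0 : Y ⟶ Y') x := by
      rw [← act_comp, comp_zero]
    rw [← e, ← hw, ← nat_act, act_zero, map_zero]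
  have h1 : ∀ (Y : D) (x : S.X₂.obj (I.proj.obj (Y ⊞ Y))),
      x = act S.X₂ biprod.inl (act S.X₂ biprod.fst x) +
        act S.X₂ biprod.inr (act S.X₂ biprod.snd x) := by
    intro Y x
    rw [← sub_eq_zero]
    set y := x - (act S.X₂ biprod.inl (act S.X₂ biprod.fst x) +
      act S.X₂ biprod.inr (act S.X₂ biprod.snd x)) with hy
    obtain ⟨w, hw⟩ := nat_exact h _ y (by
      rw [hy, map_sub, map_add, nat_act, nat_act, nat_act, nat_act, ← act_comp, ← act_comp,
        ← act_add, biprod.total, act_id, sub_self])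
    have hf : act S.X₂ biprod.fst y = 0 := by
      rw [hy, map_sub, map_add, ← act_comp S.X₂ biprod.inl, ← act_comp S.X₂ biprod.inr,
        biprod.inl_fst, biprod.inr_fst, act_id, h0, add_zero, sub_self]
    have hs : act S.X₂ biprod.snd y = 0 := by
      rw [hy, map_sub, map_add, ← act_comp S.X₂ biprod.inl, ← act_comp S.X₂ biprod.inr,
        biprod.inl_snd, biprod.inr_snd, act_id, h0, zero_add, sub_self]
    rw [← hw, ← nat_act] at hf hs
    rw [← hw, ← act_id S.X₁ w, ← biprod.total, act_add, act_comp, act_comp,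
      nat_injective h _ (hf.trans (map_zero _).symm), nat_injective h _ (hs.trans (map_zero _).symm),
      map_zero, map_zero, add_zero, map_zero]
  refine additive_of_act _ fun Y Y' a b z => ?_
  have e : a + b = biprod.lift (𝟙 Y) (𝟙 Y) ≫ biprod.desc a b := by simp
  rw [e, act_comp, h1 Y (act S.X₂ (biprod.lift (𝟙 Y) (𝟙 Y)) z), map_add, ← act_comp, ← act_comp,
    ← act_comp, ← act_comp, ← act_comp, ← act_comp]
  simp

/-- The horseshoe construction: an extension of two presented functors is presented. -/
theorem IsPresentedBy.extension (h : S.ShortExact) [S.X₁.Additive] [S.X₃.Additive]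
    {V X V' X' : D} {j : V ⟶ X} {j' : V' ⟶ X'} {z : S.X₁.obj (I.proj.obj V)}
    {z' : S.X₃.obj (I.proj.obj V')} (hz : IsPresentedBy S.X₁ j z)
    (hz' : IsPresentedBy S.X₃ j' z') :
    ∃ (k : V ⊞ V' ⟶ X ⊞ X') (y : S.X₂.obj (I.proj.obj (V ⊞ V'))), IsPresentedBy S.X₂ k y := by
  have := additive_of_shortExact h
  obtain ⟨x, hx⟩ := nat_surjective h V' z'
  obtain ⟨w, hw⟩ := nat_exact h X' (act S.X₂ j' x) (by rw [nat_act, hx, hz'.rel])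
  obtain ⟨c, rfl⟩ := hz.gen X' w
  rw [nat_act] at hw
  set y := nat S.f V z with hy
  -- the element `x` satisfies the relation `j' x = c y`
  have hact : ∀ {Y : D} (a : V ⊞ V' ⟶ Y),
      act S.X₂ a (act S.X₂ biprod.inl y + act S.X₂ biprod.inr x) =
        act S.X₂ (biprod.inl ≫ a) y + act S.X₂ (biprod.inr ≫ a) x := by
    intro Y a
    rw [map_add, act_comp, act_comp]
  refine ⟨biprod.desc (biprod.lift j (-c)) (biprod.lift 0 j'),
    act S.X₂ biprod.inl y + act S.X₂ biprod.inr x, ?_, fun Y g => ?_, fun Y a ha => ?_⟩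
  · have e₁ : biprod.lift j (-c) = j ≫ biprod.inl - c ≫ (biprod.inr : X' ⟶ X ⊞ X') := by
      ext <;> simp
    have e₂ : biprod.lift 0 j' = j' ≫ (biprod.inr : X' ⟶ X ⊞ X') := by ext <;> simp
    rw [hact, biprod.inl_desc, biprod.inr_desc, e₁, e₂, act_sub, act_comp, act_comp, act_comp, hw,
      hy, ← nat_act, hz.rel, map_zero, map_zero]
    abel
  · obtain ⟨a', ha'⟩ := hz'.gen Y (nat S.g Y g)
    obtain ⟨t, ht⟩ := nat_exact h Y (g - act S.X₂ a' x) (by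
      rw [map_sub, nat_act, hx, ha', sub_self])
    obtain ⟨a, rfl⟩ := hz.gen Y t
    refine ⟨biprod.desc a a', ?_⟩
    rw [hact, biprod.inl_desc, biprod.inr_desc, hy, ← nat_act, ht, sub_add_cancel]
  · rw [hact] at ha
    have ha₃ := congrArg (nat S.g Y) ha
    rw [map_add, nat_act, nat_act, hx, hy, nat_g_f, map_zero, zero_add, map_zero] at ha₃
    obtain ⟨h₃, hh₃⟩ := hz'.ker Y _ ha₃
    rw [act_congr _ hh₃, act_comp S.X₂ j' h₃, ← hw, ← act_comp, ← act_add, hy, ← nat_act,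
      ← map_zero (nat S.f Y)] at ha
    obtain ⟨h₁, hh₁⟩ := hz.ker Y _ (nat_injective h Y ha)
    refine ⟨biprod.desc h₁ h₃, ?_⟩
    have e : a = biprod.fst ≫ biprod.inl ≫ a + biprod.snd ≫ biprod.inr ≫ a := by
      rw [← Category.assoc, ← Category.assoc, ← Preadditive.add_comp, biprod.total,
        Category.id_comp]
    have e₁ : I.proj.map (biprod.inl ≫ a) = I.proj.map (j ≫ h₁ - c ≫ h₃) := by
      rw [I.proj.map_sub, ← hh₁, I.proj.map_add, add_sub_cancel_right]
    conv_lhs => rw [e, I.proj.map_add, I.proj.map_comp biprod.fst, I.proj.map_comp biprod.snd,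
      e₁, hh₃]
    rw [← I.proj.map_comp, ← I.proj.map_comp, ← I.proj.map_add]
    congr 1
    ext <;> simp [sub_eq_add_neg]

end Extension

end HomIdeal

theorem hasBinaryBiproducts_fullSubcategory {A : Type w} [Category.{v} A] [Preadditive A]
    [HasBinaryBiproducts A] (Q : ObjectProperty A) (hQ : ∀ X Y, Q X → Q Y → Q (X ⊞ Y)) :
    HasBinaryBiproducts Q.FullSubcategory where
  has_binary_biproduct X Y := by
    let b : BinaryBicone X Y :=
      { pt := ⟨X.obj ⊞ Y.obj, hQ _ _ X.property Y.property⟩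
        fst := ObjectProperty.homMk biprod.fst
        snd := ObjectProperty.homMk biprod.snd
        inl := ObjectProperty.homMk biprod.inl
        inr := ObjectProperty.homMk biprod.inr
        inl_fst := by ext; simp
        inl_snd := by ext; simp
        inr_fst := by ext; simp
        inr_snd := by ext; simp }
    refine hasBinaryBiproduct_of_total b ?_
    refine ObjectProperty.hom_ext _ ?_
    exact biprod.total (X := X.obj) (Y := Y.obj)

namespace Extriangulation

variable {C : Type u} [SmallCategory C] [Preadditive C] [HasZeroObject C] [HasBinaryBiproducts C]
  {T : Extriangulation C} {n : ℕ} {P : ObjectProperty C}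

/-! ### The functor `𝕂` -/

open HomIdeal

instance costableExt_additive (M : Cᵒᵖ) : (T.costableExt P n M).Additive :=
  additive_of_act _ fun _ _ a b z => T.add_push a.hom b.hom z

/-- An extension, as an element of a value of the functor `E(M, -)` on the co-stable category. -/
def toCostable {M : C} {V : (T.res P n).FullSubcategory} (δ : Extn T.E M V.obj) :
    (T.costableExt P n (op M)).obj ((T.injIdeal (T.res P n)).proj.obj V) := δ

namespace RigidSetting

variable (s : T.RigidSetting n P)
include s

theorem mem_idealP_iff {X Y : (T.res P (n + 1)).FullSubcategory} (f : X ⟶ Y) :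
    f ∈ (T.idealP P n).carrier X Y ↔
      ∃ (Z : C) (a : X.obj ⟶ Z) (b : Z ⟶ Y.obj), P Z ∧ a ≫ b = f.hom := by
  constructor
  · intro hf
    change f ∈ AddSubgroup.closure _ at hf
    induction hf using AddSubgroup.closure_induction with
    | mem f hf =>
      obtain ⟨Z, a, b, hZ, rfl⟩ := hf
      exact ⟨Z.obj, a.hom, b.hom, hZ, rfl⟩
    | zero => exact ⟨0, 0, 0, s.zero_mem (isZero_zero C), by simp⟩
    | add f g _ _ hf hg =>
      obtain ⟨Z, a, b, hZ, hf⟩ := hf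
      obtain ⟨Z', a', b', hZ', hg⟩ := hg
      refine ⟨Z ⊞ Z', biprod.lift a a', biprod.desc b b', s.biprod_mem hZ hZ', ?_⟩
      rw [biprod.lift_desc, hf, hg]
      rfl
    | neg f _ hf =>
      obtain ⟨Z, a, b, hZ, hf⟩ := hf
      refine ⟨Z, -a, b, hZ, ?_⟩
      rw [Preadditive.neg_comp, hf]
      rfl
  · rintro ⟨Z, a, b, hZ, h⟩
    exact AddSubgroup.subset_closure ⟨⟨Z, res_of_mem _ hZ⟩, ObjectProperty.homMk a,
      ObjectProperty.homMk b, hZ, ObjectProperty.hom_ext _ h⟩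

/-- `E(f, -)` vanishes on `P^∧_n` if `f` factors through an object of `P`. -/
theorem gFactors : T.GFactors P n := by
  intro X Y f g h
  obtain ⟨Z, a, b, hZ, hab⟩ := (s.mem_idealP_iff _).1 h
  refine Quiver.Hom.unop_inj (hom_ext_nat fun V θ => ?_)
  have key : ∀ θ : Extn T.E Y.obj V.obj, pull f.hom θ = pull g.hom θ := by
    intro θ
    rw [← sub_eq_zero, ← sub_pull]
    change pull (f - g).hom θ = 0
    rw [← hab, pull_comp, s.extn_eq_zero hZ V.property (pull b θ), pull_zero]
  exact key θ

/-- The functor `E(M, -)` is presented by the class of a conflation `K ⟶ X ⟶ M` with `X` in `P`. -/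
theorem isPresentedBy_costableExt {V X : (T.res P n).FullSubcategory} {M : C} {j : V ⟶ X}
    {p : X.obj ⟶ M} {δ : Extn T.E M V.obj} (h : T.Realizes j.hom p δ) (hX : P X.obj) :
    IsPresentedBy (T.costableExt P n (op M)) j (toCostable δ) where
  rel := h.push_eq_zero
  gen Y θ := by
    obtain ⟨a, ha⟩ := h.exists_push_eq θ (s.extn_eq_zero hX Y.property _)
    exact ⟨ObjectProperty.homMk a, ha⟩
  ker Y f hf := by
    obtain ⟨b, hb⟩ := h.extend f.hom hf
    exact ⟨ObjectProperty.homMk b, congrArg _ (ObjectProperty.hom_ext _ hb.symm)⟩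

theorem exists_realizes_of_obj (M : (T.res P (n + 1)).FullSubcategory) :
    ∃ (V X : (T.res P n).FullSubcategory) (j : V ⟶ X) (p : X.obj ⟶ M.obj)
      (δ : Extn T.E M.obj V.obj), T.Realizes j.hom p δ ∧ P X.obj := by
  obtain ⟨K, X, i, p, δ, h, hX, hK⟩ := s.exists_realizes_of_res M.property
  exact ⟨⟨K, hK⟩, ⟨X, res_of_mem n hX⟩, ObjectProperty.homMk i, p, δ, h, hX⟩

/-- An additive functor presented by `j : V ⟶ X` with `X` in `P` is isomorphic to `E(M, -)`, where
`M` is the cone of the inflation `V ⟶ X ⊞ I` obtained from `j` by adding a map to an injective. -/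
theorem exists_iso_of_isPresentedBy {V X : (T.res P n).FullSubcategory} {j : V ⟶ X}
    {G : T.Costable P n ⥤ AddCommGrpCat.{u}} [G.Additive]
    {z : G.obj ((T.injIdeal (T.res P n)).proj.obj V)}
    (h : IsPresentedBy G j z) (hX : P X.obj) :
    ∃ M : (T.res P (n + 1)).FullSubcategory, Nonempty (T.costableExt P n (op M.obj) ≅ G) := by
  obtain ⟨I, S, i, p, ⟨δ, hδ⟩, hI⟩ := s.enough V.obj
  obtain ⟨M, c, γ, -, -, hγ, -⟩ := hδ.exists_cone_lift j.hom
  have hXI : P (X.obj ⊞ I) := s.biprod_mem hX (s.injectives_le _ hI)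
  let X' : (T.res P n).FullSubcategory := ⟨X.obj ⊞ I, res_of_mem n hXI⟩
  let j' : V ⟶ X' := ObjectProperty.homMk (biprod.lift j.hom i)
  have h₁ : IsPresentedBy (T.costableExt P n (op M)) j' (toCostable (V := V) γ) :=
    s.isPresentedBy_costableExt (j := j') hγ hXI
  -- modulo maps factoring through an injective, `j'` is `j` followed by the inclusion of `X`
  have hj' : (T.injIdeal (T.res P n)).proj.map j' = (T.injIdeal (T.res P n)).proj.map
      (j ≫ (ObjectProperty.homMk biprod.inl : X ⟶ X')) := by
    rw [proj_map_eq_iff]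
    intro Z θ
    have e : (j' - j ≫ (ObjectProperty.homMk biprod.inl : X ⟶ X')).hom = i ≫ biprod.inr := by
      change biprod.lift j.hom i - j.hom ≫ biprod.inl = i ≫ biprod.inr
      ext <;> simp
    rw [e, push_comp, (subsingleton_extn_of_injective hI Z).elim (push i θ) 0, push_zero]
  have h₂ : IsPresentedBy G j' z := by
    refine ⟨?_, h.gen, fun Y f hf => ?_⟩
    · rw [act_congr G hj', act_comp, h.rel, map_zero]
    · obtain ⟨k, hk⟩ := h.ker Y f hf
      refine ⟨(ObjectProperty.homMk biprod.fst : X' ⟶ X) ≫ k, ?_⟩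
      rw [hk, ← Category.assoc]
      congr 2
      ext
      exact (biprod.lift_fst _ _).symm
  exact ⟨⟨M, res_of_realizes hγ hXI V.property⟩, h₁.nonempty_iso h₂⟩

/-- Every natural transformation `E(N, -) ⟶ E(M, -)` on `P^∧_n` comes from a morphism `M ⟶ N`,
because it sends the class of a conflation `K ⟶ X ⟶ N` to a class killed by `K ⟶ X`. -/
theorem exists_map_eq (M N : (T.res P (n + 1)).FullSubcategory)
    (φ : T.costableExt P n (op N.obj) ⟶ T.costableExt P n (op M.obj)) :
    ∃ g : M ⟶ N, (T.functorG P n).map g.op = φ := by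
  obtain ⟨V, X, j, p, δ, h, hX⟩ := s.exists_realizes_of_obj N
  have hδ := s.isPresentedBy_costableExt h hX
  have e₀ : push j.hom (nat φ V (toCostable δ) : Extn T.E M.obj V.obj) = 0 := by
    change act (T.costableExt P n (op M.obj)) j (nat φ V (toCostable δ)) = 0
    rw [← nat_act, hδ.rel, map_zero]
  obtain ⟨g, hg⟩ := h.exists_pull_eq _ e₀
  refine ⟨ObjectProperty.homMk g, hom_ext_nat fun Y θ => ?_⟩
  obtain ⟨a, rfl⟩ := hδ.gen Y θ
  refine ((nat_act ((T.functorG P n).map (ObjectProperty.homMk g : M ⟶ N).op) a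
    (toCostable δ)).trans ?_).trans (nat_act φ a (toCostable δ)).symm
  exact congrArg (act (T.costableExt P n (op M.obj)) a) hg

theorem mem_idealP_of_map_eq {M N : (T.res P (n + 1)).FullSubcategory} (f g : M ⟶ N)
    (h : (T.functorG P n).map f.op = (T.functorG P n).map g.op) :
    (T.idealP P n).proj.map f = (T.idealP P n).proj.map g := by
  obtain ⟨V, X, j, p, δ, hδ, hX⟩ := s.exists_realizes_of_obj N
  have e : pull f.hom δ = pull g.hom δ := congrArg (fun φ => nat φ V (toCostable δ)) h
  obtain ⟨b, hb⟩ := hδ.colift (f.hom - g.hom) (by rw [sub_pull, e, sub_self])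
  exact ((T.idealP P n).proj_map_eq_iff f g).2 ((s.mem_idealP_iff _).2 ⟨X.obj, b, p, hX, hb⟩)

theorem functorK_full (hG : T.GFactors P n) : (T.functorK hG).Full where
  map_surjective {N M} φ := by
    obtain ⟨g, hg⟩ := s.exists_map_eq M.unop.as N.unop.as φ
    exact ⟨((T.idealP P n).proj.map g).op, hg⟩

theorem functorK_faithful (hG : T.GFactors P n) : (T.functorK hG).Faithful where
  map_injective {N M} f g h := by
    obtain ⟨f', hf⟩ := (T.idealP P n).proj.map_surjective (X := M.unop.as) (Y := N.unop.as) f.unop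
    obtain ⟨g', hg⟩ := (T.idealP P n).proj.map_surjective (X := M.unop.as) (Y := N.unop.as) g.unop
    obtain rfl : f = ((T.idealP P n).proj.map f').op := by rw [hf]; rfl
    obtain rfl : g = ((T.idealP P n).proj.map g').op := by rw [hg]; rfl
    exact congrArg Quiver.Hom.op (s.mem_idealP_of_map_eq f' g' h)

/-- The essential image of `𝕂` consists of the functors presented by some `j : V ⟶ X` with `X` in
`P` and `V` in `P^∧_n`. -/
theorem essImage_functorK_iff (hG : T.GFactors P n) (G : T.Costable P n ⥤ AddCommGrpCat.{u}) :
    (T.functorK hG).essImage G ↔ G.Additive ∧ ∃ (X V : (T.res P n).FullSubcategory) (j : V ⟶ X)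
      (z : G.obj ((T.injIdeal (T.res P n)).proj.obj V)), P X.obj ∧ IsPresentedBy G j z := by
  constructor
  · rintro ⟨M, ⟨e⟩⟩
    obtain ⟨V, X, j, p, δ, h, hX⟩ := s.exists_realizes_of_obj M.unop.as
    have h' := s.isPresentedBy_costableExt h hX
    have e' : T.costableExt P n (op M.unop.as.obj) ≅ G := e
    refine ⟨Functor.additive_of_iso e', X, V, j, nat e'.hom V (toCostable δ), hX, ?_, fun Y g => ?_,
      fun Y f hf => h'.ker Y f ?_⟩
    · rw [← nat_act, h'.rel, map_zero]
    · obtain ⟨f, hf⟩ := h'.gen Y (nat e'.inv Y g)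
      refine ⟨f, ?_⟩
      rw [← nat_act, hf, ← nat_comp, e'.inv_hom_id]
      rfl
    · have h₁ := congrArg (nat e'.inv Y) hf
      rwa [← nat_act, ← nat_comp, e'.hom_inv_id, map_zero] at h₁
  · rintro ⟨_, X, V, j, z, hX, h⟩
    obtain ⟨M, ⟨e⟩⟩ := s.exists_iso_of_isPresentedBy h hX
    exact ⟨op ((T.idealP P n).proj.obj M), ⟨e⟩⟩

theorem essImage_functorK (hG : T.GFactors P n) : (T.functorK hG).essImage = T.classL P n := by
  ext G
  rw [s.essImage_functorK_iff hG]
  refine and_congr_right fun hGadd => exists_congr fun X => exists_congr fun V => ?_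
  constructor
  · rintro ⟨j, z, hX, h⟩
    obtain ⟨α, π, zero, h⟩ := (exists_isPresentedBy_iff G X V).1 ⟨j, z, h⟩
    exact ⟨α, π, zero, hX, h⟩
  · rintro ⟨α, π, zero, hX, h⟩
    obtain ⟨j, z, h⟩ := (exists_isPresentedBy_iff G X V).2 ⟨α, π, zero, h⟩
    exact ⟨j, z, hX, h⟩

/-- The essential image of `𝕂` is closed under extensions. -/
theorem essImage_functorK_extension (hG : T.GFactors P n)
    (S : ShortComplex (T.Costable P n ⥤ AddCommGrpCat.{u})) (hS : S.ShortExact)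
    (h₁ : (T.functorK hG).essImage S.X₁) (h₃ : (T.functorK hG).essImage S.X₃) :
    (T.functorK hG).essImage S.X₂ := by
  rw [s.essImage_functorK_iff hG] at h₁ h₃ ⊢
  obtain ⟨_, X, V, j, z, hX, h₁⟩ := h₁
  obtain ⟨_, X', V', j', z', hX', h₃⟩ := h₃
  have := hasBinaryBiproducts_fullSubcategory (T.res P n) fun _ _ => s.res_biprod
  obtain ⟨k, y, h⟩ := h₁.extension hS h₃
  -- `X ⊞ X'` in the full subcategory is also a biproduct in `C`
  have := preservesBinaryBiproducts_of_preservesBiproducts (T.res P n).ι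
  let e := (T.res P n).ι.mapBiprod X X'
  exact ⟨additive_of_shortExact hS, X ⊞ X', V ⊞ V', k, y,
    s.iso_mem e.symm (s.biprod_mem hX hX'), h⟩

theorem zero_essImage_functorK (hG : T.GFactors P n) {Z : T.Costable P n ⥤ AddCommGrpCat.{u}}
    (hZ : IsZero Z) : (T.functorK hG).essImage Z := by
  refine ⟨op ((T.idealP P n).proj.obj ⟨0, res_of_mem _ (s.zero_mem (isZero_zero C))⟩),
    ⟨IsZero.iso ?_ hZ⟩⟩
  refine (Functor.isZero_iff _).2 fun Y => ?_
  have : Subsingleton (Extn T.E 0 Y.as.obj) :=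
    s.subsingleton_extn (s.zero_mem (isZero_zero C)) Y.as.property
  exact AddCommGrpCat.isZero_of_subsingleton (AddCommGrpCat.of (Extn T.E 0 Y.as.obj))

end RigidSetting

end Extriangulation

/-! ### Exact structures induced by extension closed embeddings -/

universe v₁ w₁

section Embedding

variable {A : Type w} [Category.{v} A] [Preadditive A] {B : Type w₁} [Category.{v₁} B] [Abelian B]

/-- A fully faithful additive functor into an abelian category whose essential image contains the
zero objects and is closed under extensions. -/
structure IsExactEmbedding (F : A ⥤ B) : Prop where
  full : F.Full
  faithful : F.Faithful
  zero_mem : ∀ Z : B, IsZero Z → F.essImage Z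
  ext_mem : ∀ S : ShortComplex B, S.ShortExact → F.essImage S.X₁ → F.essImage S.X₃ →
    F.essImage S.X₂

theorem shortExact_cokernel {U V : B} (u : U ⟶ V) [Mono u] :
    (ShortComplex.mk u (cokernel.π u) (cokernel.condition u)).ShortExact :=
  ShortComplex.ShortExact.mk' (ShortComplex.exact_cokernel u) ‹_›
    (inferInstance : Epi (cokernel.π u))

theorem shortExact_kernel {U V : B} (u : U ⟶ V) [Epi u] :
    (ShortComplex.mk (kernel.ι u) u (kernel.condition u)).ShortExact :=
  ShortComplex.ShortExact.mk' (ShortComplex.exact_kernel u)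
    (inferInstance : Mono (kernel.ι u)) ‹_›

/-- The short sequences which an additive functor `F` sends to short exact sequences. -/
def inducedClass (F : A ⥤ B) [F.Additive] : ObjectProperty (ShortComplex A) := fun S =>
  (S.map F).ShortExact

variable {F : A ⥤ B} [F.Additive]

theorem mem_inducedClass_of_splitting {S : ShortComplex A} (s : S.Splitting) :
    inducedClass F S := (s.map F).shortExact

theorem isConflation_of_biproduct {X Y Z : A} {f : X ⟶ Y} {g : Y ⟶ Z} (r : Y ⟶ X) (t : Z ⟶ Y)
    (zero : f ≫ g = 0) (h₁ : f ≫ r = 𝟙 X) (h₂ : t ≫ g = 𝟙 Z) (h : r ≫ f + g ≫ t = 𝟙 Y) :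
    IsConflation (inducedClass F) f g :=
  ⟨zero, mem_inducedClass_of_splitting { r := r, s := t, f_r := h₁, s_g := h₂, id := h }⟩

namespace IsExactEmbedding

variable (hF : IsExactEmbedding F)
include hF

theorem hasBinaryBiproducts : HasBinaryBiproducts A where
  has_binary_biproduct X Y := by
    have := hF.full
    have := hF.faithful
    have hs : (ShortComplex.mk (biprod.inl : F.obj X ⟶ F.obj X ⊞ F.obj Y) biprod.snd
        (by simp)).ShortExact :=
      (ShortComplex.Splitting.ofHasBinaryBiproduct (F.obj X) (F.obj Y)).shortExact
    obtain ⟨Z, ⟨e⟩⟩ := hF.ext_mem _ hs ⟨X, ⟨Iso.refl _⟩⟩ ⟨Y, ⟨Iso.refl _⟩⟩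
    let e : F.obj Z ≅ F.obj X ⊞ F.obj Y := e
    let b : BinaryBicone X Y :=
      { pt := Z
        fst := F.preimage (e.hom ≫ biprod.fst)
        snd := F.preimage (e.hom ≫ biprod.snd)
        inl := F.preimage (biprod.inl ≫ e.inv)
        inr := F.preimage (biprod.inr ≫ e.inv)
        inl_fst := F.map_injective (by simp)
        inl_snd := F.map_injective (by simp)
        inr_fst := F.map_injective (by simp)
        inr_snd := F.map_injective (by simp) }
    refine hasBinaryBiproduct_of_total b (F.map_injective ?_)
    rw [F.map_add, F.map_comp, F.map_comp, F.map_id]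
    simp only [b, F.map_preimage, Category.assoc]
    rw [← Preadditive.comp_add, ← Category.assoc biprod.fst, ← Category.assoc biprod.snd,
      ← Preadditive.add_comp, biprod.total, Category.id_comp, e.hom_inv_id]

omit [F.Additive] in
theorem hasZeroObject : HasZeroObject A := by
  have := hF.faithful
  obtain ⟨Z, ⟨e⟩⟩ := hF.zero_mem 0 (isZero_zero B)
  refine ⟨⟨Z, (IsZero.iff_id_eq_zero Z).2 (F.map_injective ?_)⟩⟩
  exact ((isZero_zero B).of_iso e).eq_of_src _ _

theorem hasFiniteBiproducts : HasFiniteBiproducts A := by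
  have := hF.hasBinaryBiproducts
  have := hF.hasZeroObject
  have := hasFiniteProducts_of_has_binary_and_terminal (C := A)
  exact HasFiniteBiproducts.of_hasFiniteProducts

omit [Preadditive A] [F.Additive] in
theorem ext_of_mono {U V : B} (u : U ⟶ V) [Mono u] (hU : F.essImage U)
    (hV : F.essImage (cokernel u)) : F.essImage V :=
  hF.ext_mem _ (shortExact_cokernel u) hU hV

omit [Preadditive A] [F.Additive] in
theorem ext_of_epi {U V : B} (u : U ⟶ V) [Epi u] (hU : F.essImage (kernel u))
    (hV : F.essImage V) : F.essImage U :=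
  hF.ext_mem _ (shortExact_kernel u) hU hV

/-- A morphism sent to a monomorphism with cokernel in the essential image is an admissible
monomorphism. -/
theorem isAdmMono_of_mono_map {X Y : A} (f : X ⟶ Y) [Mono (F.map f)]
    (hc : F.essImage (cokernel (F.map f))) : IsAdmMono (inducedClass F) f := by
  have := hF.full
  have := hF.faithful
  obtain ⟨Z, ⟨e⟩⟩ := hc
  have zero : f ≫ F.preimage (cokernel.π (F.map f) ≫ e.inv) = 0 := F.map_injective (by simp)
  refine ⟨Z, F.preimage (cokernel.π (F.map f) ≫ e.inv), zero, ?_⟩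
  refine ShortComplex.shortExact_of_iso ?_ (shortExact_cokernel (F.map f))
  refine ShortComplex.isoMk (Iso.refl _) (Iso.refl _) e.symm ?_ ?_
  · exact (Category.id_comp _).trans (Category.comp_id _).symm
  · exact (Category.id_comp _).trans (F.map_preimage _)

/-- A morphism sent to an epimorphism with kernel in the essential image is an admissible
epimorphism. -/
theorem isAdmEpi_of_epi_map {X Y : A} (g : X ⟶ Y) [Epi (F.map g)]
    (hc : F.essImage (kernel (F.map g))) : IsAdmEpi (inducedClass F) g := by
  have := hF.full
  have := hF.faithful
  obtain ⟨Z, ⟨e⟩⟩ := hc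
  have zero : F.preimage (e.hom ≫ kernel.ι (F.map g)) ≫ g = 0 := F.map_injective (by simp)
  refine ⟨Z, F.preimage (e.hom ≫ kernel.ι (F.map g)), zero, ?_⟩
  refine ShortComplex.shortExact_of_iso ?_ (shortExact_kernel (F.map g))
  refine ShortComplex.isoMk e.symm (Iso.refl _) (Iso.refl _) ?_ ?_
  · refine (congrArg (e.inv ≫ ·) (F.map_preimage _)).trans ?_
    exact (e.inv_hom_id_assoc _).trans (Category.comp_id _).symm
  · exact (Category.id_comp _).trans (Category.comp_id _).symm

omit hF in
theorem essImage_cokernel {X Y : A} {f : X ⟶ Y} (h : IsAdmMono (inducedClass F) f) :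
    Mono (F.map f) ∧ F.essImage (cokernel (F.map f)) := by
  obtain ⟨Z, g, zero, h⟩ := h
  exact ⟨h.mono_f, Z, ⟨IsColimit.coconePointUniqueUpToIso h.gIsCokernel (colimit.isColimit _)⟩⟩

omit hF in
theorem essImage_kernel {X Y : A} {g : X ⟶ Y} (h : IsAdmEpi (inducedClass F) g) :
    Epi (F.map g) ∧ F.essImage (kernel (F.map g)) := by
  obtain ⟨Z, f, zero, h⟩ := h
  exact ⟨h.epi_g, Z, ⟨IsLimit.conePointUniqueUpToIso h.fIsKernel (limit.isLimit _)⟩⟩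

theorem comp_admMono {X Y Z : A} (f : X ⟶ Y) (g : Y ⟶ Z) (hf : IsAdmMono (inducedClass F) f)
    (hg : IsAdmMono (inducedClass F) g) : IsAdmMono (inducedClass F) (f ≫ g) := by
  obtain ⟨_, hf⟩ := essImage_cokernel hf
  obtain ⟨_, hg⟩ := essImage_cokernel hg
  have : Mono (F.map (f ≫ g)) := by rw [F.map_comp]; infer_instance
  refine hF.isAdmMono_of_mono_map _ ?_
  rw [F.map_comp]
  -- the cokernel of `f ≫ g` is the pushout of `g` and the cokernel of `f`
  have sq := IsPushout.of_hasPushout (F.map g) (cokernel.π (F.map f))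
  have := isIso_cokernel_map_of_isPushout sq.flip.flip
  have h₁ : F.essImage (pushout (F.map g) (cokernel.π (F.map f))) :=
    hF.ext_of_mono (pushout.inr (F.map g) (cokernel.π (F.map f))) hf
      (F.essImage.prop_of_iso (asIso (cokernel.map _ _ _ _ sq.w)) hg)
  have zero : (F.map f ≫ F.map g) ≫ pushout.inl (F.map g) (cokernel.π (F.map f)) = 0 := by
    rw [Category.assoc, sq.w, cokernel.condition_assoc, zero_comp]
  refine F.essImage.prop_of_iso (IsColimit.coconePointUniqueUpToIso (CokernelCofork.IsColimit.ofπ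
    (pushout.inl (F.map g) (cokernel.π (F.map f))) zero
    (fun k hk => sq.desc k (cokernel.desc _ (F.map g ≫ k) (by simpa using hk)) (by simp))
    (fun k hk => by simp) (fun k hk m hm => ?_)) (colimit.isColimit _)) h₁
  refine sq.hom_ext (by simpa using hm) ?_
  rw [← cancel_epi (cokernel.π (F.map f)), sq.inr_desc, cokernel.π_desc, ← hm, ← sq.w_assoc]

theorem comp_admEpi {X Y Z : A} (f : X ⟶ Y) (g : Y ⟶ Z) (hf : IsAdmEpi (inducedClass F) f)
    (hg : IsAdmEpi (inducedClass F) g) : IsAdmEpi (inducedClass F) (f ≫ g) := by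
  obtain ⟨_, hf⟩ := essImage_kernel hf
  obtain ⟨_, hg⟩ := essImage_kernel hg
  have : Epi (F.map (f ≫ g)) := by rw [F.map_comp]; infer_instance
  refine hF.isAdmEpi_of_epi_map _ ?_
  rw [F.map_comp]
  -- the kernel of `f ≫ g` is the pullback of `f` and the kernel of `g`
  have sq := (IsPullback.of_hasPullback (F.map f) (kernel.ι (F.map g))).flip
  have := isIso_kernel_map_of_isPullback sq
  have h₁ : F.essImage (pullback (F.map f) (kernel.ι (F.map g))) :=
    hF.ext_of_epi (pullback.snd (F.map f) (kernel.ι (F.map g)))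
      (F.essImage.prop_of_iso (asIso (kernel.map _ _ _ _ sq.w)).symm hf) hg
  have zero : pullback.fst (F.map f) (kernel.ι (F.map g)) ≫ F.map f ≫ F.map g = 0 := by
    rw [← Category.assoc, ← sq.w, Category.assoc, kernel.condition, comp_zero]
  refine F.essImage.prop_of_iso (IsLimit.conePointUniqueUpToIso (KernelFork.IsLimit.ofι
    (pullback.fst (F.map f) (kernel.ι (F.map g))) zero
    (fun k hk => sq.lift (kernel.lift _ (k ≫ F.map f) (by simpa using hk)) k (by simp))
    (fun k hk => by simp) (fun k hk m hm => ?_)) (limit.isLimit _)) h₁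
  refine sq.hom_ext ?_ (by simpa using hm)
  rw [← cancel_mono (kernel.ι (F.map g)), sq.lift_fst, kernel.lift_ι, ← hm, Category.assoc,
    Category.assoc, sq.w]

theorem exists_pushout {X Y X' : A} (f : X ⟶ Y) (a : X ⟶ X')
    (hf : IsAdmMono (inducedClass F) f) :
    ∃ (Y' : A) (b : Y ⟶ Y') (f' : X' ⟶ Y'), IsPushout f a b f' ∧
      IsAdmMono (inducedClass F) f' := by
  have := hF.full
  have := hF.faithful
  obtain ⟨_, hf⟩ := essImage_cokernel hf
  have sq := IsPushout.of_hasPushout (F.map f) (F.map a)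
  have := isIso_cokernel_map_of_isPushout sq
  have hc : F.essImage (cokernel (pushout.inr (F.map f) (F.map a))) :=
    F.essImage.prop_of_iso (asIso (cokernel.map _ _ _ _ sq.w)) hf
  obtain ⟨Y', ⟨e⟩⟩ := hF.ext_of_mono (pushout.inr (F.map f) (F.map a)) ⟨X', ⟨Iso.refl _⟩⟩ hc
  have hb := F.map_preimage (pushout.inl (F.map f) (F.map a) ≫ e.inv)
  have hf' := F.map_preimage (pushout.inr (F.map f) (F.map a) ≫ e.inv)
  have sq' : IsPushout (F.map f) (F.map a)
      (F.map (F.preimage (pushout.inl (F.map f) (F.map a) ≫ e.inv)))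
      (F.map (F.preimage (pushout.inr (F.map f) (F.map a) ≫ e.inv))) := by
    rw [hb, hf']
    exact sq.of_iso (Iso.refl _) (Iso.refl _) (Iso.refl _) e.symm (by simp) (by simp) (by simp)
      (by simp)
  refine ⟨Y', _, _, sq'.of_map F (F.map_injective (by simpa using sq'.w)), ?_⟩
  have : Mono (F.map (F.preimage (pushout.inr (F.map f) (F.map a) ≫ e.inv))) := by
    rw [hf']; infer_instance
  have := isIso_cokernel_map_of_isPushout sq'
  exact hF.isAdmMono_of_mono_map _
    (F.essImage.prop_of_iso (asIso (cokernel.map _ _ _ _ sq'.w)) hf)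

theorem exists_pullback {Y Z Z' : A} (g : Y ⟶ Z) (c : Z' ⟶ Z)
    (hg : IsAdmEpi (inducedClass F) g) :
    ∃ (Y' : A) (b : Y' ⟶ Y) (g' : Y' ⟶ Z'), IsPullback b g' g c ∧
      IsAdmEpi (inducedClass F) g' := by
  have := hF.full
  have := hF.faithful
  obtain ⟨_, hg⟩ := essImage_kernel hg
  have sq := IsPullback.of_hasPullback (F.map g) (F.map c)
  have := isIso_kernel_map_of_isPullback sq.flip
  have hc : F.essImage (kernel (pullback.snd (F.map g) (F.map c))) :=
    F.essImage.prop_of_iso (asIso (kernel.map _ _ _ _ sq.flip.w)).symm hg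
  obtain ⟨Y', ⟨e⟩⟩ := hF.ext_of_epi (pullback.snd (F.map g) (F.map c)) hc ⟨Z', ⟨Iso.refl _⟩⟩
  have hb := F.map_preimage (e.hom ≫ pullback.fst (F.map g) (F.map c))
  have hg' := F.map_preimage (e.hom ≫ pullback.snd (F.map g) (F.map c))
  have sq' : IsPullback (F.map (F.preimage (e.hom ≫ pullback.fst (F.map g) (F.map c))))
      (F.map (F.preimage (e.hom ≫ pullback.snd (F.map g) (F.map c)))) (F.map g) (F.map c) := by
    rw [hb, hg']
    exact sq.of_iso e.symm (Iso.refl _) (Iso.refl _) (Iso.refl _) (by simp) (by simp) (by simp)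
      (by simp)
  refine ⟨Y', _, _, sq'.of_map F (F.map_injective (by simpa using sq'.w)), ?_⟩
  have : Epi (F.map (F.preimage (e.hom ≫ pullback.snd (F.map g) (F.map c)))) := by
    rw [hg']; infer_instance
  have := isIso_kernel_map_of_isPullback sq'.flip
  exact hF.isAdmEpi_of_epi_map _
    (F.essImage.prop_of_iso (asIso (kernel.map _ _ _ _ sq'.flip.w)).symm hg)

omit hF in
theorem of_iso {S S' : ShortComplex A} (e : S ≅ S') (h : inducedClass F S) : inducedClass F S' :=
  ShortComplex.shortExact_of_iso (F.mapShortComplex.mapIso e) h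

/-- In a conflation, the first map is a kernel of the second one. -/
theorem exists_lift {S : ShortComplex A} (h : inducedClass F S) {W : A} (k : W ⟶ S.X₂)
    (hk : k ≫ S.g = 0) : ∃ l : W ⟶ S.X₁, l ≫ S.f = k := by
  have := hF.full
  have := hF.faithful
  have h' : (S.map F).ShortExact := h
  have := h'.mono_f
  have hk' : F.map k ≫ F.map S.g = 0 := by rw [← F.map_comp, hk, F.map_zero]
  obtain ⟨l, hl⟩ : ∃ l : F.obj W ⟶ F.obj S.X₁, l ≫ F.map S.f = F.map k :=
    ⟨h'.exact.lift _ hk', h'.exact.lift_f _ hk'⟩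
  exact ⟨F.preimage l, F.map_injective (by rw [F.map_comp, F.map_preimage, hl])⟩

/-- In a conflation, the second map is a cokernel of the first one. -/
theorem exists_desc {S : ShortComplex A} (h : inducedClass F S) {W : A} (k : S.X₂ ⟶ W)
    (hk : S.f ≫ k = 0) : ∃ l : S.X₃ ⟶ W, S.g ≫ l = k := by
  have := hF.full
  have := hF.faithful
  have h' : (S.map F).ShortExact := h
  have := h'.epi_g
  have hk' : F.map S.f ≫ F.map k = 0 := by rw [← F.map_comp, hk, F.map_zero]
  obtain ⟨l, hl⟩ : ∃ l : F.obj S.X₃ ⟶ F.obj W, F.map S.g ≫ l = F.map k :=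
    ⟨h'.exact.desc _ hk', h'.exact.g_desc _ hk'⟩
  exact ⟨F.preimage l, F.map_injective (by rw [F.map_comp, F.map_preimage, hl])⟩

theorem mono_f {S : ShortComplex A} (h : inducedClass F S) : Mono S.f :=
  have := hF.faithful
  have : Mono (F.map S.f) := ShortComplex.ShortExact.mono_f h
  F.mono_of_mono_map this

theorem epi_g {S : ShortComplex A} (h : inducedClass F S) : Epi S.g :=
  have := hF.faithful
  have : Epi (F.map S.g) := ShortComplex.ShortExact.epi_g h
  F.epi_of_epi_map this

/-- The class of the short sequences sent to short exact sequences by an extension closed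
embedding into an abelian category is an exact structure. -/
theorem isExactCategory : IsExactCategory (inducedClass F) where
  additive := hF.hasFiniteBiproducts
  isLimit S hS := by
    have := hF.mono_f hS
    choose l hl using fun {W : A} (k : W ⟶ S.X₂) (hk : k ≫ S.g = 0) => hF.exists_lift hS k hk
    exact ⟨KernelFork.IsLimit.ofι _ _ (fun k hk => l k hk) (fun k hk => hl k hk)
      (fun k hk m hm => by rw [← cancel_mono S.f, hm, hl])⟩
  isColimit S hS := by
    have := hF.epi_g hS
    choose l hl using fun {W : A} (k : S.X₂ ⟶ W) (hk : S.f ≫ k = 0) => hF.exists_desc hS k hk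
    exact ⟨CokernelCofork.IsColimit.ofπ _ _ (fun k hk => l k hk) (fun k hk => hl k hk)
      (fun k hk m hm => by rw [← cancel_epi S.g, hm, hl])⟩
  of_iso S S' e h := of_iso e h
  id_admMono X := by
    have := hF.hasZeroObject
    exact ⟨0, 0, isConflation_of_biproduct (𝟙 X) 0 (by simp) (by simp)
      ((isZero_zero A).eq_of_src _ _) (by simp)⟩
  id_admEpi X := by
    have := hF.hasZeroObject
    exact ⟨0, 0, isConflation_of_biproduct 0 (𝟙 X) (by simp) ((isZero_zero A).eq_of_src _ _)
      (by simp) (by simp)⟩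
  comp_admMono _ _ _ f g := hF.comp_admMono f g
  comp_admEpi _ _ _ f g := hF.comp_admEpi f g
  pushout _ _ _ f a := hF.exists_pushout f a
  pullback _ _ _ g c := hF.exists_pullback g c

end IsExactEmbedding

end Embedding

/-! ### The category of conflations as an extension closed subcategory -/

section Degreewise

variable {A : Type w} [Category.{v} A] [Preadditive A] {B : Type w₁} [Category.{v₁} B] [Abelian B]

theorem shortExact_shortComplex_iff (R : ShortComplex (ShortComplex B)) :
    R.ShortExact ↔ (R.map ShortComplex.π₁).ShortExact ∧ (R.map ShortComplex.π₂).ShortExact ∧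
      (R.map ShortComplex.π₃).ShortExact := by
  refine ⟨fun h => ⟨h.map_of_exact _, h.map_of_exact _, h.map_of_exact _⟩, ?_⟩
  rintro ⟨h₁, h₂, h₃⟩
  have m₁ : Mono R.f.τ₁ := h₁.mono_f
  have m₂ : Mono R.f.τ₂ := h₂.mono_f
  have m₃ : Mono R.f.τ₃ := h₃.mono_f
  have e₁ : Epi R.g.τ₁ := h₁.epi_g
  have e₂ : Epi R.g.τ₂ := h₂.epi_g
  have e₃ : Epi R.g.τ₃ := h₃.epi_g
  refine ShortComplex.ShortExact.mk' ?_ ⟨fun a b h => ?_⟩ ⟨fun a b h => ?_⟩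
  · rw [ShortComplex.exact_iff_isZero_homology, IsZero.iff_id_eq_zero]
    have z₁ : IsZero R.homology.X₁ :=
      ((ShortComplex.exact_iff_isZero_homology _).1 h₁.exact).of_iso
        (R.mapHomologyIso ShortComplex.π₁).symm
    have z₂ : IsZero R.homology.X₂ :=
      ((ShortComplex.exact_iff_isZero_homology _).1 h₂.exact).of_iso
        (R.mapHomologyIso ShortComplex.π₂).symm
    have z₃ : IsZero R.homology.X₃ :=
      ((ShortComplex.exact_iff_isZero_homology _).1 h₃.exact).of_iso
        (R.mapHomologyIso ShortComplex.π₃).symm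
    exact ShortComplex.hom_ext _ _ (z₁.eq_of_src _ _) (z₂.eq_of_src _ _) (z₃.eq_of_src _ _)
  · exact ShortComplex.hom_ext _ _
      ((cancel_mono R.f.τ₁).1 (congrArg ShortComplex.Hom.τ₁ h))
      ((cancel_mono R.f.τ₂).1 (congrArg ShortComplex.Hom.τ₂ h))
      ((cancel_mono R.f.τ₃).1 (congrArg ShortComplex.Hom.τ₃ h))
  · exact ShortComplex.hom_ext _ _
      ((cancel_epi R.g.τ₁).1 (congrArg ShortComplex.Hom.τ₁ h))
      ((cancel_epi R.g.τ₂).1 (congrArg ShortComplex.Hom.τ₂ h))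
      ((cancel_epi R.g.τ₃).1 (congrArg ShortComplex.Hom.τ₃ h))

/-- An extension of two short exact sequences, in the category of short complexes, is a short exact
sequence. -/
theorem shortExact_of_extension (R : ShortComplex (ShortComplex B)) (hR : R.ShortExact)
    (h₁ : R.X₁.ShortExact) (h₃ : R.X₃.ShortExact) : R.X₂.ShortExact := by
  obtain ⟨r₁, r₂, r₃⟩ := (shortExact_shortComplex_iff R).1 hR
  have m₁ := h₁.mono_f
  have m₃ := h₃.mono_f
  have e₁ := h₁.epi_g
  have e₃ := h₃.epi_g
  have n₁ : Mono R.f.τ₁ := r₁.mono_f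
  have n₂ : Mono R.f.τ₂ := r₂.mono_f
  have n₃ : Mono R.f.τ₃ := r₃.mono_f
  have d₁ : Epi R.g.τ₁ := r₁.epi_g
  have d₃ : Epi R.g.τ₃ := r₃.epi_g
  have n₂' : Mono (R.map ShortComplex.π₂).f := n₂
  let f : R.map ShortComplex.π₁ ⟶ R.map ShortComplex.π₂ :=
    { τ₁ := R.X₁.f, τ₂ := R.X₂.f, τ₃ := R.X₃.f, comm₁₂ := R.f.comm₁₂.symm,
      comm₂₃ := R.g.comm₁₂.symm }
  let g : R.map ShortComplex.π₂ ⟶ R.map ShortComplex.π₃ :=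
    { τ₁ := R.X₁.g, τ₂ := R.X₂.g, τ₃ := R.X₃.g, comm₁₂ := R.f.comm₂₃.symm,
      comm₂₃ := R.g.comm₂₃.symm }
  have hm : Mono R.X₂.f :=
    ShortComplex.mono_of_mono_of_mono_of_mono (φ := f) r₁.exact n₂ m₁ m₃
  have he : Epi R.X₂.g :=
    ShortComplex.epi_of_epi_of_epi_of_epi (φ := g) r₃.exact r₂.epi_g e₁ e₃
  refine ShortComplex.ShortExact.mk' ?_ hm he
  rw [ShortComplex.exact_iff_exact_up_to_refinements]
  intro W x hx
  have hz : (x ≫ R.g.τ₂) ≫ R.X₃.g = 0 := by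
    rw [Category.assoc, R.g.comm₂₃, ← Category.assoc, hx, zero_comp]
  obtain ⟨z, hz⟩ : ∃ z, z ≫ R.X₃.f = x ≫ R.g.τ₂ := ⟨h₃.exact.lift _ hz, h₃.exact.lift_f _ hz⟩
  obtain ⟨W', p, hp, w, hw⟩ := surjective_up_to_refinements_of_epi R.g.τ₁ z
  have hv : (p ≫ x - w ≫ R.X₂.f) ≫ R.g.τ₂ = 0 := by
    rw [Preadditive.sub_comp, Category.assoc, Category.assoc, ← hz, ← R.g.comm₁₂,
      ← Category.assoc, ← Category.assoc, hw, sub_self]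
  obtain ⟨y, hy⟩ : ∃ y : W' ⟶ R.X₁.X₂, y ≫ R.f.τ₂ = p ≫ x - w ≫ R.X₂.f :=
    ⟨r₂.exact.lift _ hv, r₂.exact.lift_f _ hv⟩
  have hu : y ≫ R.X₁.g = 0 := by
    rw [← cancel_mono R.f.τ₃, Category.assoc, ← R.f.comm₂₃, ← Category.assoc, hy,
      Preadditive.sub_comp, Category.assoc, Category.assoc, hx, R.X₂.zero, comp_zero, comp_zero,
      sub_zero, zero_comp]
  obtain ⟨t, ht⟩ : ∃ t : W' ⟶ R.X₁.X₁, t ≫ R.X₁.f = y :=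
    ⟨h₁.exact.lift _ hu, h₁.exact.lift_f _ hu⟩
  refine ⟨W', p, hp, w + t ≫ R.f.τ₁, ?_⟩
  rw [Preadditive.add_comp, Category.assoc, R.f.comm₁₂, ← Category.assoc, ht, hy,
    add_sub_cancel]

variable (F : A ⥤ B) [F.Additive]

/-- The functor from the category of conflations to the short complexes in the abelian category. -/
abbrev conflationsFunctor : Conflations (inducedClass F) ⥤ ShortComplex B :=
  (inducedClass F).ι ⋙ F.mapShortComplex

instance : (conflationsFunctor F).Additive where
  map_add {S S' f g} := by
    ext
    · exact F.map_add
    · exact F.map_add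
    · exact F.map_add

theorem degreewise_iff (T : ShortComplex (Conflations (inducedClass F))) :
    degreewise (inducedClass F) T ↔ inducedClass (conflationsFunctor F) T := by
  refine Iff.trans ?_ (shortExact_shortComplex_iff (T.map (conflationsFunctor F))).symm
  have z₁ : T.f.hom.τ₁ ≫ T.g.hom.τ₁ = 0 :=
    congrArg (fun t => ShortComplex.Hom.τ₁ (InducedCategory.Hom.hom t)) T.zero
  have z₂ : T.f.hom.τ₂ ≫ T.g.hom.τ₂ = 0 :=
    congrArg (fun t => ShortComplex.Hom.τ₂ (InducedCategory.Hom.hom t)) T.zero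
  have z₃ : T.f.hom.τ₃ ≫ T.g.hom.τ₃ = 0 :=
    congrArg (fun t => ShortComplex.Hom.τ₃ (InducedCategory.Hom.hom t)) T.zero
  exact ⟨fun h => ⟨h.1.2, h.2.1.2, h.2.2.2⟩, fun h => ⟨⟨z₁, h.1⟩, ⟨z₂, h.2.1⟩, ⟨z₃, h.2.2⟩⟩⟩

variable {F}

namespace IsExactEmbedding

variable (hF : IsExactEmbedding F)
include hF

omit hF in
theorem shortExact_of_mem_essImage {R : ShortComplex B} (h : (conflationsFunctor F).essImage R) :
    R.ShortExact := by
  obtain ⟨S, ⟨e⟩⟩ := h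
  exact ShortComplex.shortExact_of_iso e S.property

omit hF in
theorem essImage_of_mem_essImage {R : ShortComplex B} (h : (conflationsFunctor F).essImage R) :
    F.essImage R.X₁ ∧ F.essImage R.X₂ ∧ F.essImage R.X₃ := by
  obtain ⟨S, ⟨e⟩⟩ := h
  exact ⟨⟨_, ⟨ShortComplex.π₁.mapIso e⟩⟩, ⟨_, ⟨ShortComplex.π₂.mapIso e⟩⟩,
    ⟨_, ⟨ShortComplex.π₃.mapIso e⟩⟩⟩

theorem mem_essImage_conflationsFunctor {R : ShortComplex B} (hR : R.ShortExact)
    (h₁ : F.essImage R.X₁) (h₂ : F.essImage R.X₂) (h₃ : F.essImage R.X₃) :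
    (conflationsFunctor F).essImage R := by
  have := hF.full
  have := hF.faithful
  obtain ⟨X₁, ⟨e₁⟩⟩ := h₁
  obtain ⟨X₂, ⟨e₂⟩⟩ := h₂
  obtain ⟨X₃, ⟨e₃⟩⟩ := h₃
  let S : ShortComplex A := ShortComplex.mk (F.preimage (e₁.hom ≫ R.f ≫ e₂.inv))
    (F.preimage (e₂.hom ≫ R.g ≫ e₃.inv)) (F.map_injective (by simp))
  have c₁₂ : F.map S.f ≫ e₂.hom = e₁.hom ≫ R.f := by
    rw [F.map_preimage, Category.assoc, Category.assoc, e₂.inv_hom_id, Category.comp_id]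
  have c₂₃ : F.map S.g ≫ e₃.hom = e₂.hom ≫ R.g := by
    rw [F.map_preimage, Category.assoc, Category.assoc, e₃.inv_hom_id, Category.comp_id]
  have e : S.map F ≅ R := ShortComplex.isoMk e₁ e₂ e₃ c₁₂.symm c₂₃.symm
  exact ⟨⟨S, ShortComplex.shortExact_of_iso e.symm hR⟩, ⟨e⟩⟩

/-- The category of conflations is in turn an extension closed subcategory of an abelian
category. -/
theorem conflations : IsExactEmbedding (conflationsFunctor F) where
  full := by
    have := hF.full
    have := hF.faithful
    refine ⟨fun {S S'} φ => ?_⟩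
    obtain ⟨f₁, h₁⟩ : ∃ f : S.obj.X₁ ⟶ S'.obj.X₁, F.map f = φ.τ₁ := F.map_surjective _
    obtain ⟨f₂, h₂⟩ : ∃ f : S.obj.X₂ ⟶ S'.obj.X₂, F.map f = φ.τ₂ := F.map_surjective _
    obtain ⟨f₃, h₃⟩ : ∃ f : S.obj.X₃ ⟶ S'.obj.X₃, F.map f = φ.τ₃ := F.map_surjective _
    have c₁₂ : F.map f₁ ≫ F.map S'.obj.f = F.map S.obj.f ≫ F.map f₂ :=
      (congrArg (· ≫ F.map S'.obj.f) h₁).trans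
        (φ.comm₁₂.trans (congrArg (F.map S.obj.f ≫ ·) h₂.symm))
    have c₂₃ : F.map f₂ ≫ F.map S'.obj.g = F.map S.obj.g ≫ F.map f₃ :=
      (congrArg (· ≫ F.map S'.obj.g) h₂).trans
        (φ.comm₂₃.trans (congrArg (F.map S.obj.g ≫ ·) h₃.symm))
    exact ⟨ObjectProperty.homMk
      { τ₁ := f₁
        τ₂ := f₂
        τ₃ := f₃
        comm₁₂ := F.map_injective (by rw [F.map_comp, F.map_comp, c₁₂])
        comm₂₃ := F.map_injective (by rw [F.map_comp, F.map_comp, c₂₃]) },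
      ShortComplex.hom_ext _ _ h₁ h₂ h₃⟩
  faithful := by
    have := hF.faithful
    refine ⟨fun {S S' f g} h => ObjectProperty.hom_ext _ (ShortComplex.hom_ext _ _ ?_ ?_ ?_)⟩
    · exact F.map_injective (congrArg ShortComplex.Hom.τ₁ h)
    · exact F.map_injective (congrArg ShortComplex.Hom.τ₂ h)
    · exact F.map_injective (congrArg ShortComplex.Hom.τ₃ h)
  zero_mem Z hZ := by
    have h₁ : IsZero Z.X₁ := ShortComplex.π₁.map_isZero hZ
    have h₂ : IsZero Z.X₂ := ShortComplex.π₂.map_isZero hZ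
    have h₃ : IsZero Z.X₃ := ShortComplex.π₃.map_isZero hZ
    exact hF.mem_essImage_conflationsFunctor
      (ShortComplex.ShortExact.mk' (ShortComplex.exact_of_isZero_X₂ _ h₂)
        ⟨fun _ _ _ => h₁.eq_of_tgt _ _⟩ ⟨fun _ _ _ => h₃.eq_of_src _ _⟩)
      (hF.zero_mem _ h₁) (hF.zero_mem _ h₂) (hF.zero_mem _ h₃)
  ext_mem R hR h₁ h₃ := by
    obtain ⟨r₁, r₂, r₃⟩ := (shortExact_shortComplex_iff R).1 hR
    obtain ⟨a₁, a₂, a₃⟩ := essImage_of_mem_essImage h₁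
    obtain ⟨c₁, c₂, c₃⟩ := essImage_of_mem_essImage h₃
    exact hF.mem_essImage_conflationsFunctor
      (shortExact_of_extension R hR (shortExact_of_mem_essImage h₁)
        (shortExact_of_mem_essImage h₃))
      (hF.ext_mem _ r₁ a₁ c₁) (hF.ext_mem (R.map ShortComplex.π₂) r₂ a₂ c₂)
      (hF.ext_mem _ r₃ a₃ c₃)

theorem isExactCategory_degreewise : IsExactCategory (degreewise (inducedClass F)) := by
  have : degreewise (inducedClass F) = inducedClass (conflationsFunctor F) :=
    funext fun T => propext (degreewise_iff F T)
  rw [this]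
  exact hF.conflations.isExactCategory

end IsExactEmbedding

end Degreewise

/-! ### Splitting conflations as a pseudo-cluster tilting subcategory -/

section Split

variable {A : Type w} [Category.{v} A] [Preadditive A] {B : Type w₁} [Category.{v₁} B] [Abelian B]
  {F : A ⥤ B} [F.Additive]

/-- The morphisms of conflations whose third component lifts along the second map of the target;
equivalently, those homotopic to zero. -/
def IsNull {ε : ObjectProperty (ShortComplex A)} {S S' : Conflations ε} (f : S ⟶ S') : Prop :=
  ∃ s : S.obj.X₃ ⟶ S'.obj.X₂, s ≫ S'.obj.g = f.hom.τ₃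

namespace IsNull

variable {ε : ObjectProperty (ShortComplex A)} {S S' S'' : Conflations ε}

theorem precomp (f : S ⟶ S') {g : S' ⟶ S''} (h : IsNull g) : IsNull (f ≫ g) := by
  obtain ⟨s, hs⟩ := h
  exact ⟨f.hom.τ₃ ≫ s, (Category.assoc _ _ _).trans (congrArg (f.hom.τ₃ ≫ ·) hs)⟩

theorem postcomp {f : S ⟶ S'} (g : S' ⟶ S'') (h : IsNull f) : IsNull (f ≫ g) := by
  obtain ⟨s, hs⟩ := h
  refine ⟨s ≫ g.hom.τ₂, ?_⟩
  rw [Category.assoc, g.hom.comm₂₃, ← Category.assoc, hs]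
  rfl

theorem zero : IsNull (0 : S ⟶ S') := ⟨0, zero_comp⟩

theorem add {f g : S ⟶ S'} (hf : IsNull f) (hg : IsNull g) : IsNull (f + g) := by
  obtain ⟨s, hs⟩ := hf
  obtain ⟨t, ht⟩ := hg
  exact ⟨s + t, (Preadditive.add_comp _ _ _ _ _ _).trans (congrArg₂ (· + ·) hs ht)⟩

theorem neg {f : S ⟶ S'} (hf : IsNull f) : IsNull (-f) := by
  obtain ⟨s, hs⟩ := hf
  exact ⟨-s, (Preadditive.neg_comp _ _).trans (congrArg (-·) hs)⟩

theorem of_split_right (h : splitConflations ε S') (f : S ⟶ S') : IsNull f := by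
  obtain ⟨σ⟩ := h
  exact ⟨f.hom.τ₃ ≫ σ.s, by rw [Category.assoc, σ.s_g, Category.comp_id]⟩

theorem of_mem {f : S ⟶ S'} (h : f ∈ (HomIdeal.ofObjects (splitConflations ε)).carrier S S') :
    IsNull f := by
  change f ∈ AddSubgroup.closure _ at h
  induction h using AddSubgroup.closure_induction with
  | mem f hf =>
    obtain ⟨D, s, t, hD, rfl⟩ := hf
    exact (of_split_right hD s).postcomp t
  | zero => exact zero
  | add f g _ _ hf hg => exact hf.add hg
  | neg f _ hf => exact hf.neg

end IsNull

namespace IsExactEmbedding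

variable (hF : IsExactEmbedding F)
include hF

/-- A morphism of conflations is determined by its middle component. -/
theorem conflation_hom_ext {S S' : Conflations (inducedClass F)} {f g : S ⟶ S'}
    (h : f.hom.τ₂ = g.hom.τ₂) : f = g := by
  have := hF.mono_f S'.property
  have := hF.epi_g S.property
  refine ObjectProperty.hom_ext _ (ShortComplex.hom_ext _ _ ?_ h ?_)
  · rw [← cancel_mono S'.obj.f, f.hom.comm₁₂, g.hom.comm₁₂, h]
  · rw [← cancel_epi S.obj.g, ← f.hom.comm₂₃, ← g.hom.comm₂₃, h]

/-- A morphism between the middle terms extends to the conflations as soon as it is compatible with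
the kernels. -/
theorem exists_conflation_hom {S S' : Conflations (inducedClass F)} (k : S.obj.X₂ ⟶ S'.obj.X₂)
    (hk : S.obj.f ≫ k ≫ S'.obj.g = 0) : ∃ f : S ⟶ S', f.hom.τ₂ = k := by
  obtain ⟨l, hl⟩ := hF.exists_lift S'.property (S.obj.f ≫ k) (by rw [Category.assoc, hk])
  obtain ⟨m, hm⟩ := hF.exists_desc S.property (k ≫ S'.obj.g) hk
  exact ⟨ObjectProperty.homMk { τ₁ := l, τ₂ := k, τ₃ := m, comm₁₂ := hl, comm₂₃ := hm.symm }, rfl⟩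

theorem split_of_isNull_id {S : Conflations (inducedClass F)} (h : IsNull (𝟙 S)) :
    splitConflations (inducedClass F) S := by
  obtain ⟨s, hs⟩ := h
  have hs : s ≫ S.obj.g = 𝟙 S.obj.X₃ := hs
  have := hF.mono_f S.property
  obtain ⟨r, hr⟩ := hF.exists_lift S.property (𝟙 _ - S.obj.g ≫ s)
    (by rw [Preadditive.sub_comp, Category.assoc, hs]; simp)
  refine ⟨{ r := r, s := s, s_g := hs, f_r := ?_, id := by rw [hr]; simp }⟩
  rw [← cancel_mono S.obj.f, Category.assoc, hr, Preadditive.comp_sub, ← Category.assoc]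
  simp

/-- The class of the splitting conflations is closed under finite coproducts and direct summands,
because its objects are those whose identity belongs to the ideal of null-homotopic morphisms. -/
theorem splitConflations_add :
    splitConflations (inducedClass F) = add (splitConflations (inducedClass F)) := by
  have := hF.conflations.hasZeroObject
  refine funext fun S => propext ⟨fun h => add_of_free (free_of_mem h), ?_⟩
  rintro ⟨S', c, ⟨hc⟩, m, X, i, hX, ⟨hY⟩⟩
  have hpt : IsNull (𝟙 c.pt) := by
    have total : ∑ j, (Bicone.ofColimitCocone hY).π j ≫ (Bicone.ofColimitCocone hY).ι j = 𝟙 c.pt :=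
      IsBilimit.total (biconeIsBilimitOfColimitCoconeOfIsColimit hY)
    rw [← total]
    refine Finset.sum_induction _ (fun f : c.pt ⟶ c.pt => IsNull f)
      (fun _ _ => IsNull.add) IsNull.zero fun j _ => ?_
    exact (IsNull.of_split_right (hX j) _).postcomp _
  refine hF.split_of_isNull_id ?_
  have e : 𝟙 S = (show S ⟶ c.pt from c.inl) ≫ 𝟙 c.pt ≫ hc.desc (BinaryCofan.mk (𝟙 S) 0) := by
    rw [Category.id_comp]
    exact (hc.fac (BinaryCofan.mk (𝟙 S) 0) ⟨WalkingPair.left⟩).symm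
  rw [e]
  exact (hpt.postcomp _).precomp _

variable (F) in
omit hF in
/-- The splitting conflation `X ⟶ X ⊞ Y ⟶ Y`. -/
noncomputable abbrev biprodConflation [HasBinaryBiproducts A] (X Y : A) :
    Conflations (inducedClass F) :=
  ⟨ShortComplex.mk (biprod.inl : X ⟶ X ⊞ Y) biprod.snd (by simp),
    mem_inducedClass_of_splitting (ShortComplex.Splitting.ofHasBinaryBiproduct X Y)⟩

variable (F) in
omit hF in
/-- The splitting conflation `X ⟶ X ⟶ 0`. -/
noncomputable abbrev leftConflation [HasZeroObject A] (X : A) : Conflations (inducedClass F) :=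
  ⟨ShortComplex.mk (𝟙 X) (0 : X ⟶ 0) (by simp), mem_inducedClass_of_splitting
    { r := 𝟙 X, s := 0, s_g := (isZero_zero A).eq_of_src _ _ }⟩

variable (F) in
omit hF in
/-- The splitting conflation `0 ⟶ X ⟶ X`. -/
noncomputable abbrev rightConflation [HasZeroObject A] (X : A) : Conflations (inducedClass F) :=
  ⟨ShortComplex.mk (0 : 0 ⟶ X) (𝟙 X) (by simp), mem_inducedClass_of_splitting
    { r := 0, s := 𝟙 X, f_r := (isZero_zero A).eq_of_src _ _ }⟩

omit hF in
theorem split_biprodConflation [HasBinaryBiproducts A] (X Y : A) :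
    splitConflations (inducedClass F) (biprodConflation F X Y) :=
  ⟨ShortComplex.Splitting.ofHasBinaryBiproduct X Y⟩

omit hF in
theorem split_leftConflation [HasZeroObject A] (X : A) :
    splitConflations (inducedClass F) (leftConflation F X) :=
  ⟨{ r := 𝟙 X, s := 0, s_g := (isZero_zero A).eq_of_src _ _ }⟩

omit hF in
theorem split_rightConflation [HasZeroObject A] (X : A) :
    splitConflations (inducedClass F) (rightConflation F X) :=
  ⟨{ r := 0, s := 𝟙 X, f_r := (isZero_zero A).eq_of_src _ _ }⟩

omit hF in
/-- The morphism from a conflation `K ⟶ M ⟶ N` to `M ⟶ M ⊞ N ⟶ N`. -/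
noncomputable abbrev toBiprod [HasBinaryBiproducts A] (S : Conflations (inducedClass F)) :
    S ⟶ biprodConflation F S.obj.X₂ S.obj.X₃ :=
  ObjectProperty.homMk
    { τ₁ := S.obj.f
      τ₂ := biprod.lift (𝟙 _) S.obj.g
      τ₃ := 𝟙 _
      comm₁₂ := by ext <;> simp
      comm₂₃ := by simp }

omit hF in
/-- The morphism to a conflation `K ⟶ M ⟶ N` from `K ⟶ K ⊞ M ⟶ M`. -/
noncomputable abbrev fromBiprod [HasBinaryBiproducts A] (S : Conflations (inducedClass F)) :
    biprodConflation F S.obj.X₁ S.obj.X₂ ⟶ S :=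
  ObjectProperty.homMk
    { τ₁ := 𝟙 _
      τ₂ := biprod.desc S.obj.f (𝟙 _)
      τ₃ := S.obj.g
      comm₁₂ := by simp
      comm₂₃ := by ext <;> simp }

/-- A null-homotopic morphism with components `f₂` and `s` factors through `toBiprod`, by the morphism
with middle component `(f₂ - g s, s)`. -/
theorem exists_toBiprod_comp [HasBinaryBiproducts A] {S S' : Conflations (inducedClass F)}
    {f : S ⟶ S'} (hf : IsNull f) : ∃ h, toBiprod S ≫ h = f := by
  obtain ⟨s, hs⟩ := hf
  have hu : (f.hom.τ₂ - S.obj.g ≫ s) ≫ S'.obj.g = 0 := by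
    rw [Preadditive.sub_comp, Category.assoc, hs, f.hom.comm₂₃, sub_self]
  obtain ⟨h, hh⟩ := hF.exists_conflation_hom (S := biprodConflation F S.obj.X₂ S.obj.X₃) (S' := S')
    (biprod.desc (f.hom.τ₂ - S.obj.g ≫ s) s) (by rw [biprod.inl_desc_assoc, hu])
  refine ⟨h, hF.conflation_hom_ext ?_⟩
  refine (congrArg (biprod.lift (𝟙 _) S.obj.g ≫ ·) hh).trans ?_
  simp [biprod.lift_desc]

/-- A null-homotopic morphism with components `f₂` and `s` factors through `fromBiprod`: the difference
`f₂ - g s` lifts to the kernel of the target. -/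
theorem exists_comp_fromBiprod [HasBinaryBiproducts A] {S S' : Conflations (inducedClass F)}
    {f : S ⟶ S'} (hf : IsNull f) : ∃ h, h ≫ fromBiprod S' = f := by
  obtain ⟨s, hs⟩ := hf
  obtain ⟨r, hr⟩ := hF.exists_lift S'.property (f.hom.τ₂ - S.obj.g ≫ s)
    (by rw [Preadditive.sub_comp, Category.assoc, hs, f.hom.comm₂₃, sub_self])
  obtain ⟨h, hh⟩ := hF.exists_conflation_hom (S' := biprodConflation F S'.obj.X₁ S'.obj.X₂) (S := S)
    (biprod.lift r (S.obj.g ≫ s)) (by rw [biprod.lift_snd, ← Category.assoc]; simp)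
  refine ⟨h, hF.conflation_hom_ext ?_⟩
  refine (congrArg (· ≫ biprod.desc S'.obj.f (𝟙 _)) hh).trans ?_
  simp [biprod.lift_desc, hr]

/-- The ideal generated by the splitting conflations consists of the morphisms homotopic to
zero. -/
theorem mem_ideal_split_iff {S S' : Conflations (inducedClass F)} (f : S ⟶ S') :
    f ∈ (HomIdeal.ofObjects (splitConflations (inducedClass F))).carrier S S' ↔ IsNull f := by
  refine ⟨IsNull.of_mem, fun hf => ?_⟩
  have := hF.hasBinaryBiproducts
  obtain ⟨h, rfl⟩ := hF.exists_toBiprod_comp hf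
  exact AddSubgroup.subset_closure ⟨_, _, _, split_biprodConflation _ _, rfl⟩

theorem exists_preenvelope (S : Conflations (inducedClass F)) :
    ∃ (D₀ D₁ : Conflations (inducedClass F)) (α : S ⟶ D₀) (p : D₀ ⟶ D₁),
      IsConflation (degreewise (inducedClass F)) α p ∧ splitConflations (inducedClass F) D₀ ∧
      splitConflations (inducedClass F) D₁ ∧
      IsPreenvelope (splitConflations (inducedClass F)) α := by
  have := hF.hasBinaryBiproducts
  have := hF.hasZeroObject
  let p : biprodConflation F S.obj.X₂ S.obj.X₃ ⟶ leftConflation F S.obj.X₃ :=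
    ObjectProperty.homMk
      { τ₁ := S.obj.g
        τ₂ := biprod.desc S.obj.g (-𝟙 _)
        τ₃ := 0
        comm₁₂ := by simp
        comm₂₃ := by simp }
  have hm : IsConflation (inducedClass F) (biprod.lift (𝟙 S.obj.X₂) S.obj.g)
      (biprod.desc S.obj.g (-𝟙 _)) := by
    refine isConflation_of_biproduct biprod.fst (-biprod.inr) (by simp [biprod.lift_desc])
      (by simp) (by simp) ?_
    ext <;> simp
  refine ⟨_, _, toBiprod S, p, ⟨hF.conflation_hom_ext hm.1, ⟨S.obj.zero, S.property⟩, hm, ?_⟩,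
    split_biprodConflation _ _, split_leftConflation _, split_biprodConflation _ _,
    fun D hD f => hF.exists_toBiprod_comp (IsNull.of_split_right hD f)⟩
  · exact isConflation_of_biproduct (𝟙 _) 0 comp_zero (Category.comp_id _)
      ((isZero_zero A).eq_of_src _ _)
      ((congrArg₂ (· + ·) (Category.comp_id _) comp_zero).trans (add_zero _))

theorem exists_precover (S : Conflations (inducedClass F)) :
    ∃ (D₁ D₀ : Conflations (inducedClass F)) (i : D₁ ⟶ D₀) (β : D₀ ⟶ S),
      IsConflation (degreewise (inducedClass F)) i β ∧ splitConflations (inducedClass F) D₀ ∧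
      splitConflations (inducedClass F) D₁ ∧
      IsPrecover (splitConflations (inducedClass F)) β := by
  have := hF.hasBinaryBiproducts
  have := hF.hasZeroObject
  let i : rightConflation F S.obj.X₁ ⟶ biprodConflation F S.obj.X₁ S.obj.X₂ :=
    ObjectProperty.homMk
      { τ₁ := 0
        τ₂ := biprod.lift (-𝟙 _) S.obj.f
        τ₃ := S.obj.f
        comm₁₂ := by simp
        comm₂₃ := by simp }
  have hm : IsConflation (inducedClass F) (biprod.lift (-𝟙 _) S.obj.f)
      (biprod.desc S.obj.f (𝟙 S.obj.X₂)) := by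
    refine isConflation_of_biproduct (-biprod.fst) biprod.inr (by simp [biprod.lift_desc])
      (by simp) (by simp) ?_
    ext <;> simp
  refine ⟨_, _, i, fromBiprod S, ⟨hF.conflation_hom_ext hm.1, ?_, hm, ⟨S.obj.zero, S.property⟩⟩,
    split_biprodConflation _ _, split_rightConflation _, split_biprodConflation _ _,
    fun D hD f => hF.exists_comp_fromBiprod ?_⟩
  · exact isConflation_of_biproduct 0 (𝟙 _) zero_comp ((isZero_zero A).eq_of_src _ _)
      (Category.comp_id _)
      ((congrArg₂ (· + ·) zero_comp (Category.comp_id _)).trans (zero_add _))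
  · have h := (IsNull.of_split_right hD (𝟙 D)).postcomp f
    rwa [Category.id_comp] at h

theorem isPseudoClusterTilting :
    IsPseudoClusterTilting (degreewise (inducedClass F)) (splitConflations (inducedClass F)) where
  add_eq := hF.splitConflations_add
  preenvelope := hF.exists_preenvelope
  precover := hF.exists_precover

end IsExactEmbedding

end Split

theorem IsPseudoClusterTilting.resDimLE_eq_top {A : Type w} [Category.{v} A] [Preadditive A]
    {ε : ObjectProperty (ShortComplex A)} {D : ObjectProperty A}
    (h : IsPseudoClusterTilting ε D) : resDimLE (IsConflation ε) D 1 = ⊤ := by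
  refine top_le_iff.1 fun M _ => ?_
  obtain ⟨D₁, D₀, i, β, hc, h₀, h₁, -⟩ := h.precover M
  exact ⟨1, le_rfl, D₁, D₀, i, β, hc, h₀, D₁, h₁, ⟨Iso.refl _⟩⟩

theorem IsPseudoClusterTilting.coresDimLE_eq_top {A : Type w} [Category.{v} A] [Preadditive A]
    {ε : ObjectProperty (ShortComplex A)} {D : ObjectProperty A}
    (h : IsPseudoClusterTilting ε D) : coresDimLE (IsConflation ε) D 1 = ⊤ := by
  refine top_le_iff.1 fun M _ => ?_
  obtain ⟨D₀, D₁, α, p, hc, h₀, h₁, -⟩ := h.preenvelope M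
  exact ⟨1, le_rfl, D₀, D₁, α, p, hc, h₀, D₁, h₁, ⟨Iso.refl _⟩⟩

/-! ### The category of conflations modulo the splitting ones -/

section Defect

variable {A : Type w} [Category.{v} A] [Preadditive A]

/-- The morphism `π` is a cokernel of the morphism of representable functors given by `g`. -/
structure IsDefect {Y Z : A} (g : Y ⟶ Z) {G : Aᵒᵖ ⥤ AddCommGrpCat.{v}}
    (π : preadditiveYoneda.obj Z ⟶ G) : Prop where
  surjective : ∀ (W : A) (y : G.obj (op W)), ∃ f : W ⟶ Z, π.app (op W) f = y
  eq_zero_iff : ∀ (W : A) (f : W ⟶ Z), π.app (op W) f = 0 ↔ ∃ k : W ⟶ Y, k ≫ g = f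

instance preadditiveYoneda_additive : (preadditiveYoneda (C := A)).Additive where
  map_add {_ _ f g} := NatTrans.ext (funext fun _ => AddCommGrpCat.hom_ext
    (AddMonoidHom.ext fun k => Preadditive.comp_add _ _ _ k f g))

theorem yoneda_naturality {Z : A} {G : Aᵒᵖ ⥤ AddCommGrpCat.{v}} (π : preadditiveYoneda.obj Z ⟶ G)
    {W W' : A} (a : W' ⟶ W) (f : W ⟶ Z) :
    π.app (op W') (a ≫ f) = G.map a.op (π.app (op W) f) :=
  ConcreteCategory.congr_hom (π.naturality a.op) f

theorem yoneda_hom_ext {Z : A} {G : Aᵒᵖ ⥤ AddCommGrpCat.{v}} {π π' : preadditiveYoneda.obj Z ⟶ G}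
    (h : π.app (op Z) (𝟙 Z) = π'.app (op Z) (𝟙 Z)) : π = π' := by
  refine NatTrans.ext (funext fun W => AddCommGrpCat.hom_ext (AddMonoidHom.ext fun f => ?_))
  change π.app (op W.unop) (show W.unop ⟶ Z from f) = π'.app (op W.unop) (show W.unop ⟶ Z from f)
  rw [← Category.comp_id (show W.unop ⟶ Z from f), yoneda_naturality, yoneda_naturality, h]

namespace IsDefect

variable {Y Z : A} {g : Y ⟶ Z} {G : Aᵒᵖ ⥤ AddCommGrpCat.{v}} {π : preadditiveYoneda.obj Z ⟶ G}

/-- Representable functors are projective. -/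
theorem exists_map_comp (h : IsDefect g π) {W : A} (τ : preadditiveYoneda.obj W ⟶ G) :
    ∃ n : W ⟶ Z, preadditiveYoneda.map n ≫ π = τ := by
  obtain ⟨n, hn⟩ := h.surjective W (τ.app (op W) (𝟙 W))
  refine ⟨n, yoneda_hom_ext ?_⟩
  rw [← hn]
  exact congrArg (π.app (op W)) (Category.id_comp n)

theorem map_comp_eq_zero (h : IsDefect g π) : preadditiveYoneda.map g ≫ π = 0 := by
  refine NatTrans.ext (funext fun W => AddCommGrpCat.hom_ext (AddMonoidHom.ext fun k => ?_))
  exact (h.eq_zero_iff W.unop _).2 ⟨k, rfl⟩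

theorem epi (h : IsDefect g π) : Epi π := (epi_iff_app π).2 fun W => h.surjective W.unop

theorem exact (h : IsDefect g π) :
    (ShortComplex.mk (preadditiveYoneda.map g) π h.map_comp_eq_zero).Exact :=
  (exact_iff_app _).2 fun W f hf => (h.eq_zero_iff W.unop f).1 hf

theorem of_cokernel (g : Y ⟶ Z) : IsDefect g (cokernel.π (preadditiveYoneda.map g)) where
  surjective W := (epi_iff_app (cokernel.π (preadditiveYoneda.map g))).1 inferInstance (op W)
  eq_zero_iff W f := by
    refine ⟨(exact_iff_app _).1 (ShortComplex.exact_cokernel (preadditiveYoneda.map g)) (op W) f, ?_⟩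
    rintro ⟨k, rfl⟩
    exact ConcreteCategory.congr_hom
      (congrArg (fun t => NatTrans.app t (op W)) (cokernel.condition (preadditiveYoneda.map g))) k

theorem nonempty_iso (h : IsDefect g π) : Nonempty (cokernel (preadditiveYoneda.map g) ≅ G) := by
  have := h.epi
  exact ⟨IsColimit.coconePointUniqueUpToIso (colimit.isColimit _) h.exact.gIsCokernel⟩

variable {Y' Z' : A} {g' : Y' ⟶ Z'} {G' : Aᵒᵖ ⥤ AddCommGrpCat.{v}}
  {π' : preadditiveYoneda.obj Z' ⟶ G'} {n : Z ⟶ Z'} {φ : G ⟶ G'}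

theorem app_comp (hn : preadditiveYoneda.map n ≫ π' = π ≫ φ) {W : A} (f : W ⟶ Z) :
    π'.app (op W) (f ≫ n) = φ.app (op W) (π.app (op W) f) :=
  ConcreteCategory.congr_hom (congrArg (fun t => NatTrans.app t (op W)) hn) f

theorem exists_comm (h : IsDefect g π) (h' : IsDefect g' π')
    (hn : preadditiveYoneda.map n ≫ π' = π ≫ φ) : ∃ m : Y ⟶ Y', m ≫ g' = g ≫ n := by
  rw [← h'.eq_zero_iff, app_comp hn, (h.eq_zero_iff Y g).2 ⟨𝟙 Y, Category.id_comp g⟩]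
  exact map_zero _

/-- The kernel of a morphism of defects: base change along `n`, and then along the resulting
morphism. -/
theorem kernel (h : IsDefect g π) (h' : IsDefect g' π')
    (hn : preadditiveYoneda.map n ≫ π' = π ≫ φ) {V b q} (sq : IsPullback b q g' n)
    {Q : A} {c : Q ⟶ Y} {r : Q ⟶ V} (sq' : IsPullback c r g q) :
    ∃ κ : preadditiveYoneda.obj V ⟶ kernel φ, IsDefect r κ := by
  have zero : (preadditiveYoneda.map q ≫ π) ≫ φ = 0 := by
    rw [Category.assoc, ← hn, ← Category.assoc, ← Functor.map_comp, ← sq.w, Functor.map_comp,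
      Category.assoc, h'.map_comp_eq_zero, comp_zero]
  have key : ∀ {W : A} (l : W ⟶ V), (kernel.ι φ).app (op W)
      ((kernel.lift φ _ zero).app (op W) l) = π.app (op W) (l ≫ q) := fun l =>
    ConcreteCategory.congr_hom (congrArg (fun t => NatTrans.app t _) (kernel.lift_ι φ _ zero)) l
  have inj := fun W : A => (mono_iff_app (kernel.ι φ)).1 inferInstance (op W)
  refine ⟨kernel.lift φ _ zero, fun W y => ?_, fun W l => ?_⟩
  · obtain ⟨f, hf⟩ := h.surjective W ((kernel.ι φ).app (op W) y)
    have e : π'.app (op W) (f ≫ n) = 0 := by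
      rw [app_comp hn, hf]
      exact ConcreteCategory.congr_hom
        (congrArg (fun t => NatTrans.app t (op W)) (kernel.condition φ)) y
    obtain ⟨k, hk⟩ := (h'.eq_zero_iff W _).1 e
    refine ⟨sq.lift k f hk, inj W ?_⟩
    rw [key, sq.lift_snd, hf]
  · have e : (kernel.lift φ _ zero).app (op W) l = 0 ↔ π.app (op W) (l ≫ q) = 0 := by
      rw [← key]
      exact ⟨fun e => by rw [e, map_zero], fun e => inj W (e.trans (map_zero _).symm)⟩
    rw [e, h.eq_zero_iff]
    refine ⟨fun ⟨k, hk⟩ => ⟨sq'.lift k l hk, sq'.lift_snd _ _ _⟩, ?_⟩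
    rintro ⟨k, rfl⟩
    exact ⟨k ≫ c, by rw [Category.assoc, Category.assoc, sq'.w]⟩

/-- The cokernel of a morphism of defects is the quotient of `Hom(-, Z')` by the maps factoring
through `g'` or `n`. -/
theorem cokernel [HasBinaryBiproducts A] (h : IsDefect g π) (h' : IsDefect g' π')
    (hn : preadditiveYoneda.map n ≫ π' = π ≫ φ) :
    IsDefect (biprod.desc g' n) (π' ≫ cokernel.π φ) where
  surjective W y := by
    obtain ⟨x, rfl⟩ := (epi_iff_app (cokernel.π φ)).1 inferInstance (op W) y
    obtain ⟨f, rfl⟩ := h'.surjective W x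
    exact ⟨f, rfl⟩
  eq_zero_iff W f := by
    change (cokernel.π φ).app (op W) (π'.app (op W) f) = 0 ↔ _
    constructor
    · intro hf
      obtain ⟨y, hy⟩ := (exact_iff_app _).1 (ShortComplex.exact_cokernel φ) (op W) _ hf
      obtain ⟨a, rfl⟩ := h.surjective W y
      have e : π'.app (op W) (f - a ≫ n) = 0 := by
        refine ((π'.app (op W)).hom.map_sub f (a ≫ n)).trans (sub_eq_zero.2 ?_)
        exact hy.symm.trans (app_comp hn a).symm
      obtain ⟨k, hk⟩ := (h'.eq_zero_iff W _).1 e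
      exact ⟨biprod.lift k a, by rw [biprod.lift_desc, hk, sub_add_cancel]⟩
    · rintro ⟨k, rfl⟩
      have e : k ≫ biprod.desc g' n = (k ≫ biprod.fst) ≫ g' + (k ≫ biprod.snd) ≫ n := by
        rw [biprod.desc_eq, Preadditive.comp_add, Category.assoc, Category.assoc]
      have e₁ : π'.app (op W) ((k ≫ biprod.fst) ≫ g') = 0 := (h'.eq_zero_iff W _).2 ⟨_, rfl⟩
      have e₂ : π'.app (op W) (k ≫ biprod.desc g' n) =
          φ.app (op W) (π.app (op W) (k ≫ biprod.snd)) := by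
        rw [e]
        refine ((π'.app (op W)).hom.map_add _ _).trans ?_
        exact (congrArg₂ (· + ·) e₁ (app_comp hn _)).trans (zero_add _)
      rw [e₂]
      exact ConcreteCategory.congr_hom
        (congrArg (fun t => NatTrans.app t (op W)) (cokernel.condition φ)) _

end IsDefect

variable {B : Type w₁} [Category.{v₁} B] [Abelian B] {F : A ⥤ B} [F.Additive]

/-- If `g'` is an admissible epimorphism with kernel `K` and `n : N ⟶ Z`, then the kernel of
`(g', n) : Y ⊞ N ⟶ Z` is an extension of `N` by `K`. -/
theorem IsExactEmbedding.admEpi_desc (hF : IsExactEmbedding F) [HasBinaryBiproducts A]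
    {Y N Z : A} (g : Y ⟶ Z) (n : N ⟶ Z) (hg : IsAdmEpi (inducedClass F) g) :
    IsAdmEpi (inducedClass F) (biprod.desc g n) := by
  obtain ⟨K, f, zero, hS⟩ := hg
  have hS : ((ShortComplex.mk f g zero).map F).ShortExact := hS
  have hm : Mono (F.map f) := hS.mono_f
  have hm' : Mono ((ShortComplex.mk f g zero).map F).f := hm
  have he : Epi (F.map g) := hS.epi_g
  have hgd : F.map biprod.inl ≫ F.map (biprod.desc g n) = F.map g := by
    rw [← F.map_comp, biprod.inl_desc]
  have hnd : F.map biprod.inr ≫ F.map (biprod.desc g n) = F.map n := by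
    rw [← F.map_comp, biprod.inr_desc]
  have hls : F.map (biprod.inl : Y ⟶ Y ⊞ N) ≫ F.map biprod.snd = 0 := by
    rw [← F.map_comp, biprod.inl_snd, F.map_zero]
  have hrs : F.map (biprod.inr : N ⟶ Y ⊞ N) ≫ F.map biprod.snd = 𝟙 _ := by
    rw [← F.map_comp, biprod.inr_snd, F.map_id]
  have hlf : F.map (biprod.inl : Y ⟶ Y ⊞ N) ≫ F.map biprod.fst = 𝟙 _ := by
    rw [← F.map_comp, biprod.inl_fst, F.map_id]
  have htot : F.map biprod.fst ≫ F.map biprod.inl + F.map biprod.snd ≫ F.map biprod.inr =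
      𝟙 (F.obj (Y ⊞ N)) := by
    rw [← F.map_comp, ← F.map_comp, ← F.map_add, biprod.total, F.map_id]
  have hepi : Epi (F.map (biprod.desc g n)) := by
    have : Epi (F.map biprod.inl ≫ F.map (biprod.desc g n)) := by rw [hgd]; exact he
    exact epi_of_epi (F.map biprod.inl) _
  refine hF.isAdmEpi_of_epi_map _ ?_
  have hk : (F.map f ≫ F.map biprod.inl) ≫ F.map (biprod.desc g n) = 0 := by
    rw [Category.assoc, hgd, ← F.map_comp, zero, F.map_zero]
  -- the sequence `F(K) ⟶ kernel F(g, n) ⟶ F(N)`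
  let T : ShortComplex B := ShortComplex.mk (kernel.lift _ _ hk)
    (kernel.ι (F.map (biprod.desc g n)) ≫ F.map biprod.snd)
    (by rw [kernel.lift_ι_assoc, Category.assoc, hls, comp_zero])
  have hT : T.ShortExact := by
    refine ShortComplex.ShortExact.mk' ?_ ?_ ?_
    · rw [ShortComplex.exact_iff_exact_up_to_refinements]
      intro W x hx
      have hx : x ≫ kernel.ι (F.map (biprod.desc g n)) ≫ F.map biprod.snd = 0 := hx
      have e : x ≫ kernel.ι (F.map (biprod.desc g n)) =
          (x ≫ kernel.ι (F.map (biprod.desc g n)) ≫ F.map biprod.fst) ≫ F.map biprod.inl := by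
        have := congrArg ((x ≫ kernel.ι (F.map (biprod.desc g n))) ≫ ·) htot
        simp only [Preadditive.comp_add, Category.comp_id, Category.assoc] at this
        rw [← this]
        have h0 := congrArg (· ≫ F.map (biprod.inr : N ⟶ Y ⊞ N)) hx
        simp only [Category.assoc, zero_comp] at h0
        rw [h0, add_zero]
        simp only [Category.assoc]
      have hy : (x ≫ kernel.ι (F.map (biprod.desc g n)) ≫ F.map biprod.fst) ≫ F.map g = 0 := by
        rw [← hgd, ← Category.assoc, ← e, Category.assoc, kernel.condition, comp_zero]
      obtain ⟨z, hz⟩ : ∃ z : W ⟶ F.obj K,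
          z ≫ F.map f = x ≫ kernel.ι (F.map (biprod.desc g n)) ≫ F.map biprod.fst :=
        ⟨hS.exact.lift _ hy, hS.exact.lift_f _ hy⟩
      refine ⟨W, 𝟙 W, inferInstance, z, ?_⟩
      rw [Category.id_comp, ← cancel_mono (kernel.ι (F.map (biprod.desc g n))), e, ← hz]
      exact (Category.assoc _ _ _).trans
        ((congrArg (z ≫ ·) (kernel.lift_ι _ _ hk)).symm.trans (Category.assoc _ _ _).symm)
    · have : Mono (F.map (biprod.inl : Y ⟶ Y ⊞ N)) :=
        mono_of_mono_fac hlf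
      have : Mono (kernel.lift _ _ hk ≫ kernel.ι _) := by
        rw [kernel.lift_ι]; infer_instance
      exact mono_of_mono _ (kernel.ι (F.map (biprod.desc g n)))
    · rw [epi_iff_surjective_up_to_refinements]
      intro W t
      obtain ⟨W', p, hp, y, hy⟩ := surjective_up_to_refinements_of_epi (F.map g)
        ((show W ⟶ F.obj N from t) ≫ F.map n)
      have h0 : (p ≫ t ≫ F.map biprod.inr - y ≫ F.map biprod.inl) ≫
          F.map (biprod.desc g n) = 0 := by
        rw [Preadditive.sub_comp, Category.assoc, Category.assoc, Category.assoc, hgd, hnd, hy,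
          sub_self]
      refine ⟨W', p, hp, kernel.lift _ _ h0, ?_⟩
      change p ≫ t = kernel.lift _ _ h0 ≫ kernel.ι _ ≫ F.map biprod.snd
      rw [kernel.lift_ι_assoc, Preadditive.sub_comp, Category.assoc, Category.assoc, Category.assoc,
        hls, hrs, comp_zero, sub_zero, Category.comp_id]
  exact hF.ext_mem T hT ⟨K, ⟨Iso.refl _⟩⟩ ⟨N, ⟨Iso.refl _⟩⟩

/-- The contravariant defect of a conflation `K ⟶ M ⟶ N`: the cokernel of
`Hom(-, M) ⟶ Hom(-, N)`. -/
noncomputable def defectFunctor (ε : ObjectProperty (ShortComplex A)) :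
    Conflations ε ⥤ Aᵒᵖ ⥤ AddCommGrpCat.{v} where
  obj S := cokernel (preadditiveYoneda.map S.obj.g)
  map {S S'} f := cokernel.map _ _ (preadditiveYoneda.map f.hom.τ₂)
    (preadditiveYoneda.map f.hom.τ₃) (by rw [← Functor.map_comp, ← Functor.map_comp, f.hom.comm₂₃])
  map_id S := by
    rw [← cancel_epi (cokernel.π (preadditiveYoneda.map S.obj.g)), cokernel.π_desc]
    change preadditiveYoneda.map (𝟙 S.obj.X₃) ≫ _ = _
    rw [CategoryTheory.Functor.map_id, Category.id_comp, Category.comp_id]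
  map_comp {S S' S''} f f' := by
    rw [← cancel_epi (cokernel.π (preadditiveYoneda.map S.obj.g)), cokernel.π_desc,
      cokernel.π_desc_assoc, Category.assoc, cokernel.π_desc]
    change preadditiveYoneda.map (f.hom.τ₃ ≫ f'.hom.τ₃) ≫ _ = _
    rw [Functor.map_comp, Category.assoc]

/-- The projection from a representable functor to the defect of a conflation. -/
noncomputable def defectπ {ε : ObjectProperty (ShortComplex A)} (S : Conflations ε) :
    preadditiveYoneda.obj S.obj.X₃ ⟶ (defectFunctor ε).obj S :=
  cokernel.π (preadditiveYoneda.map S.obj.g)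

theorem isDefect_defectπ {ε : ObjectProperty (ShortComplex A)} (S : Conflations ε) :
    IsDefect S.obj.g (defectπ S) := IsDefect.of_cokernel S.obj.g

theorem defectFunctor_comm {ε : ObjectProperty (ShortComplex A)} {S S' : Conflations ε}
    (f : S ⟶ S') :
    defectπ S ≫ (defectFunctor ε).map f = preadditiveYoneda.map f.hom.τ₃ ≫ defectπ S' :=
  cokernel.π_desc _ _ _

/-- The defect identifies exactly the morphisms with null-homotopic difference. -/
theorem defectFunctor_map_eq_iff {ε : ObjectProperty (ShortComplex A)} {S S' : Conflations ε}
    (f f' : S ⟶ S') : (defectFunctor ε).map f = (defectFunctor ε).map f' ↔ IsNull (f - f') := by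
  have := (isDefect_defectπ S).epi
  rw [← cancel_epi (defectπ S), defectFunctor_comm, defectFunctor_comm, ← sub_eq_zero,
    ← Preadditive.sub_comp, ← Functor.map_sub]
  refine Iff.trans ?_ ((isDefect_defectπ S').eq_zero_iff _ (f.hom.τ₃ - f'.hom.τ₃))
  constructor
  · intro h
    have e := ConcreteCategory.congr_hom (congrArg (fun t => NatTrans.app t (op S.obj.X₃)) h)
      (𝟙 S.obj.X₃)
    refine Eq.trans ?_ e
    exact congrArg ((defectπ S').app (op S.obj.X₃)) (Category.id_comp (f.hom.τ₃ - f'.hom.τ₃)).symm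
  · intro h
    refine yoneda_hom_ext (Eq.trans ?_ h)
    exact congrArg ((defectπ S').app (op S.obj.X₃)) (Category.id_comp (f.hom.τ₃ - f'.hom.τ₃))

/-- The functor induced by the defect on the quotient by the ideal generated by the splitting
conflations. -/
noncomputable def stableDefect (ε : ObjectProperty (ShortComplex A)) :
    (HomIdeal.ofObjects (splitConflations ε)).Quot ⥤ Aᵒᵖ ⥤ AddCommGrpCat.{v} :=
  CategoryTheory.Quotient.lift _ (defectFunctor ε) fun _ _ f f' h =>
    (defectFunctor_map_eq_iff f f').2 (IsNull.of_mem h)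

theorem essImage_stableDefect_iff {ε : ObjectProperty (ShortComplex A)}
    (G : Aᵒᵖ ⥤ AddCommGrpCat.{v}) :
    (stableDefect ε).essImage G ↔ (defectFunctor ε).essImage G :=
  ⟨fun ⟨S, e⟩ => ⟨S.as, e⟩, fun ⟨S, e⟩ => ⟨(HomIdeal.proj _).obj S, e⟩⟩

namespace IsExactEmbedding

variable (hF : IsExactEmbedding F)
include hF

/-- A morphism of defects lifts to a morphism of representables, hence to a commutative square, which
completes to a morphism of conflations. -/
theorem defectFunctor_full : (defectFunctor (inducedClass F)).Full where
  map_surjective {S S'} φ := by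
    have d := isDefect_defectπ S
    have d' := isDefect_defectπ S'
    have := d.epi
    obtain ⟨n, hn⟩ := d'.exists_map_comp (defectπ S ≫ φ)
    obtain ⟨m, hm⟩ := d.exists_comm d' hn
    obtain ⟨f, rfl⟩ := hF.exists_conflation_hom (S := S) (S' := S') m
      (by rw [hm, ← Category.assoc, S.obj.zero, zero_comp])
    have := hF.epi_g S.property
    obtain rfl : f.hom.τ₃ = n := by
      rw [← cancel_epi S.obj.g, ← f.hom.comm₂₃, hm]
    refine ⟨f, ?_⟩
    rw [← cancel_epi (defectπ S), defectFunctor_comm, hn]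

omit hF in
theorem mem_essImage_defectFunctor {Y Z : A} {g : Y ⟶ Z} (hg : IsAdmEpi (inducedClass F) g)
    {G : Aᵒᵖ ⥤ AddCommGrpCat.{v}} {π : preadditiveYoneda.obj Z ⟶ G} (h : IsDefect g π) :
    (defectFunctor (inducedClass F)).essImage G := by
  obtain ⟨K, f, zero, hS⟩ := hg
  exact ⟨⟨_, hS⟩, h.nonempty_iso⟩

omit hF in
theorem exists_isDefect {G : Aᵒᵖ ⥤ AddCommGrpCat.{v}}
    (hG : (defectFunctor (inducedClass F)).essImage G) :
    ∃ (Y Z : A) (g : Y ⟶ Z) (π : preadditiveYoneda.obj Z ⟶ G),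
      IsAdmEpi (inducedClass F) g ∧ IsDefect g π := by
  obtain ⟨S, ⟨e⟩⟩ := hG
  let e : cokernel (preadditiveYoneda.map S.obj.g) ≅ G := e
  have d := IsDefect.of_cokernel S.obj.g
  refine ⟨_, _, S.obj.g, cokernel.π _ ≫ e.hom, ⟨_, S.obj.f, S.obj.zero, S.property⟩, ?_, ?_⟩
  · intro W y
    obtain ⟨f, hf⟩ := d.surjective W (e.inv.app (op W) y)
    refine ⟨f, (congrArg (e.hom.app (op W)) hf).trans ?_⟩
    exact ConcreteCategory.congr_hom (congrArg (fun t => NatTrans.app t (op W)) e.inv_hom_id) y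
  · intro W f
    rw [← d.eq_zero_iff]
    change e.hom.app (op W) ((cokernel.π (preadditiveYoneda.map S.obj.g)).app (op W) f) = 0 ↔ _
    exact map_eq_zero_iff (e.hom.app (op W)).hom ((mono_iff_app e.hom).1 inferInstance (op W))

theorem stableDefect_full : (stableDefect (inducedClass F)).Full where
  map_surjective {S S'} φ := by
    obtain ⟨f, hf⟩ := hF.defectFunctor_full.map_surjective (X := S.as) (Y := S'.as) φ
    exact ⟨(HomIdeal.proj _).map f, hf⟩

theorem stableDefect_faithful : (stableDefect (inducedClass F)).Faithful where
  map_injective {S S'} f f' h := by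
    obtain ⟨f, rfl⟩ := (HomIdeal.proj _).map_surjective (X := S.as) (Y := S'.as) f
    obtain ⟨f', rfl⟩ := (HomIdeal.proj _).map_surjective (X := S.as) (Y := S'.as) f'
    rw [HomIdeal.proj_map_eq_iff, hF.mem_ideal_split_iff]
    exact (defectFunctor_map_eq_iff f f').1 h

theorem essImage_kernel_defect {G G' : Aᵒᵖ ⥤ AddCommGrpCat.{v}} (φ : G ⟶ G')
    (hG : (defectFunctor (inducedClass F)).essImage G)
    (hG' : (defectFunctor (inducedClass F)).essImage G') :
    (defectFunctor (inducedClass F)).essImage (kernel φ) := by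
  obtain ⟨Y, Z, g, π, hg, h⟩ := exists_isDefect hG
  obtain ⟨Y', Z', g', π', hg', h'⟩ := exists_isDefect hG'
  obtain ⟨n, hn⟩ := h'.exists_map_comp (π ≫ φ)
  obtain ⟨V, b, q, sq, -⟩ := hF.exists_pullback g' n hg'
  obtain ⟨Q, c, r, sq', hr⟩ := hF.exists_pullback g q hg
  obtain ⟨κ, hκ⟩ := h.kernel h' hn sq sq'
  exact mem_essImage_defectFunctor hr hκ

theorem essImage_cokernel_defect {G G' : Aᵒᵖ ⥤ AddCommGrpCat.{v}} (φ : G ⟶ G')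
    (hG : (defectFunctor (inducedClass F)).essImage G)
    (hG' : (defectFunctor (inducedClass F)).essImage G') :
    (defectFunctor (inducedClass F)).essImage (cokernel φ) := by
  have := hF.hasBinaryBiproducts
  obtain ⟨Y, Z, g, π, hg, h⟩ := exists_isDefect hG
  obtain ⟨Y', Z', g', π', hg', h'⟩ := exists_isDefect hG'
  obtain ⟨n, hn⟩ := h'.exists_map_comp (π ≫ φ)
  exact mem_essImage_defectFunctor (hF.admEpi_desc g' n hg') (h.cokernel h' hn)

/-- The category of conflations modulo the splitting ones is equivalent, via the defect, to a
subcategory closed under kernels and cokernels of the category of modules. -/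
theorem nonempty_abelian_quot :
    Nonempty (Abelian (HomIdeal.ofObjects (splitConflations (inducedClass F))).Quot) := by
  have := hF.conflations.hasBinaryBiproducts
  have := hF.conflations.hasZeroObject
  have := (HomIdeal.ofObjects (splitConflations (inducedClass F))).hasBinaryBiproducts_quot
  have := (HomIdeal.ofObjects (splitConflations (inducedClass F))).hasZeroObject_quot
  have := hF.stableDefect_full
  have := hF.stableDefect_faithful
  have : HasFiniteProducts (HomIdeal.ofObjects (splitConflations (inducedClass F))).Quot :=
    hasFiniteProducts_of_has_binary_and_terminal
  let Q : ObjectProperty (Aᵒᵖ ⥤ AddCommGrpCat.{v}) := (stableDefect (inducedClass F)).essImage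
  have hz : Q.ContainsZero := by
    have := hF.hasZeroObject
    have h0 : IsAdmEpi (inducedClass F) (0 : (0 : A) ⟶ 0) :=
      ⟨0, 0, isConflation_of_biproduct 0 0 (by simp) ((isZero_zero A).eq_of_src _ _)
        ((isZero_zero A).eq_of_src _ _) ((isZero_zero A).eq_of_src _ _)⟩
    refine ⟨⟨_, ?_, (essImage_stableDefect_iff _).2
      (mem_essImage_defectFunctor h0 (IsDefect.of_cokernel 0))⟩⟩
    refine IsZero.of_epi (cokernel.π _) ?_
    exact preadditiveYoneda.map_isZero (isZero_zero A)
  have hk : Q.IsClosedUnderKernels := ⟨by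
    rintro _ ⟨φ, k, hk, h, h'⟩
    refine (stableDefect (inducedClass F)).essImage.prop_of_iso
      (IsLimit.conePointUniqueUpToIso (limit.isLimit _) hk) ?_
    exact (essImage_stableDefect_iff _).2 (hF.essImage_kernel_defect φ
      ((essImage_stableDefect_iff _).1 h) ((essImage_stableDefect_iff _).1 h'))⟩
  have hc : Q.IsClosedUnderCokernels := ⟨by
    rintro _ ⟨φ, k, hk, h, h'⟩
    refine (stableDefect (inducedClass F)).essImage.prop_of_iso
      (IsColimit.coconePointUniqueUpToIso (colimit.isColimit _) hk) ?_
    exact (essImage_stableDefect_iff _).2 (hF.essImage_cokernel_defect φ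
      ((essImage_stableDefect_iff _).1 h) ((essImage_stableDefect_iff _).1 h'))⟩
  let e : (HomIdeal.ofObjects (splitConflations (inducedClass F))).Quot ⥤ Q.FullSubcategory :=
    (stableDefect (inducedClass F)).toEssImage
  have he : e.IsEquivalence := {}
  -- finite products are transported along the equivalence, rather than computed in the modules
  have hp : HasFiniteProducts Q.FullSubcategory :=
    ⟨fun m => Adjunction.hasLimitsOfShape_of_equivalence e.inv⟩
  let ab : Abelian Q.FullSubcategory := {}
  exact ⟨abelianOfEquivalence e⟩

end IsExactEmbedding

end Defect

/-! ### The exact structure defined by `𝕂` -/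

/-- A conflation whose first map is a split monomorphism splits. -/
theorem IsExactEmbedding.split_of_retraction {A : Type w} [Category.{v} A] [Preadditive A]
    {B : Type*} [Category* B] [Abelian B] {F : A ⥤ B} [F.Additive] (hF : IsExactEmbedding F)
    {S : ShortComplex A} (hS : inducedClass F S) (r : S.X₂ ⟶ S.X₁) (hr : S.f ≫ r = 𝟙 _) :
    Nonempty S.Splitting := by
  have := hF.epi_g hS
  obtain ⟨s, hs⟩ := hF.exists_desc hS (𝟙 _ - r ≫ S.f) (by
    rw [Preadditive.comp_sub, ← Category.assoc, hr]; simp)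
  refine ⟨{ r := r, s := s, f_r := hr, s_g := ?_, id := by rw [hs]; simp }⟩
  rw [← cancel_epi S.g, ← Category.assoc, hs, Preadditive.sub_comp, Category.assoc, S.zero]
  simp

namespace Extriangulation

variable {C : Type u} [SmallCategory C] [Preadditive C] [HasZeroObject C] [HasBinaryBiproducts C]
  {T : Extriangulation C} {n : ℕ} {P : ObjectProperty C}

instance functorK_additive (h : T.GFactors P n) : (T.functorK h).Additive where
  map_add {N M} f g := by
    obtain ⟨f', hf⟩ := (T.idealP P n).proj.map_surjective (X := M.unop.as) (Y := N.unop.as) f.unop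
    obtain ⟨g', hg⟩ := (T.idealP P n).proj.map_surjective (X := M.unop.as) (Y := N.unop.as) g.unop
    obtain rfl : f = ((T.idealP P n).proj.map f').op := by rw [hf]; rfl
    obtain rfl : g = ((T.idealP P n).proj.map g').op := by rw [hg]; rfl
    exact HomIdeal.hom_ext_nat fun Y θ => T.add_pull f'.hom g'.hom θ

/-- The covariant form of `𝕂`. -/
abbrev opK (h : T.GFactors P n) : T.M₂ P n ⥤ (T.Costable P n ⥤ AddCommGrpCat.{u})ᵒᵖ :=
  (T.functorK h).rightOp

theorem epsK_eq (h : T.GFactors P n) : T.epsK h = inducedClass (T.opK h) := by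
  refine funext fun S => propext (Iff.trans ?_ (ShortComplex.shortExact_iff_unop _).symm)
  exact ⟨fun h => h.2, fun h' => ⟨(S.map (T.opK h)).unop.zero, h'⟩⟩

theorem essImage_opK_iff (h : T.GFactors P n) (G : (T.Costable P n ⥤ AddCommGrpCat.{u})ᵒᵖ) :
    (T.opK h).essImage G ↔ (T.functorK h).essImage G.unop :=
  ⟨fun ⟨M, ⟨e⟩⟩ => ⟨op M, ⟨e.unop.symm⟩⟩, fun ⟨M, ⟨e⟩⟩ => ⟨M.unop, ⟨e.op.symm⟩⟩⟩

namespace RigidSetting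

variable (s : T.RigidSetting n P)
include s

/-- `𝕂` identifies the opposite of `P^∧_{n+1}/[P]` with an extension closed subcategory of an abelian
category. -/
theorem isExactEmbedding (h : T.GFactors P n) : IsExactEmbedding (T.opK h) where
  full := by
    have := s.functorK_full h
    infer_instance
  faithful := by
    have := s.functorK_faithful h
    infer_instance
  zero_mem Z hZ := (essImage_opK_iff h Z).2 (s.zero_essImage_functorK h hZ.unop)
  ext_mem S hS h₁ h₃ := (essImage_opK_iff h _).2
    (s.essImage_functorK_extension h S.unop ((ShortComplex.shortExact_iff_unop S).1 hS)
      ((essImage_opK_iff h _).1 h₃) ((essImage_opK_iff h _).1 h₁))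

theorem proj_map_eq_of_factors {X Y : (T.res P (n + 1)).FullSubcategory} {f g : X ⟶ Y} {Z : C}
    (a : X.obj ⟶ Z) (b : Z ⟶ Y.obj) (hZ : P Z) (h : f.hom = g.hom + a ≫ b) :
    (T.idealP P n).proj.map f = (T.idealP P n).proj.map g := by
  rw [HomIdeal.proj_map_eq_iff, s.mem_idealP_iff]
  exact ⟨Z, a, b, hZ, (sub_eq_of_eq_add' h).symm⟩

/-- A split `E`-triangle `K ⟶ M ⊞ (X ⊞ I) ⟶ N` with `X` in `P` and `I` injective gives a splitting
sequence `K ⟶ M ⟶ N` modulo the ideal `[P]`. -/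
theorem exists_splitting {K M N : (T.res P (n + 1)).FullSubcategory} (a : K ⟶ M) {X I : C}
    {f : K.obj ⟶ X} {i : K.obj ⟶ I} {b : M.obj ⊞ (X ⊞ I) ⟶ N.obj} (hX : P X)
    (hI : T.injectives I) (h : T.Realizes (biprod.lift a.hom (biprod.lift f i)) b 0) :
    ∃ zero : (T.idealP P n).proj.map a ≫
        (T.idealP P n).proj.map (ObjectProperty.homMk (biprod.inl ≫ b) : M ⟶ N) = 0,
      Nonempty (ShortComplex.mk _ _ zero).Splitting := by
  obtain ⟨r, t, hr, ht, hz, -, htot⟩ := h.splitting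
  have hXI : P (X ⊞ I) := s.biprod_mem hX (s.injectives_le _ hI)
  have e : biprod.lift a.hom (biprod.lift f i) =
      a.hom ≫ biprod.inl + biprod.lift f i ≫ biprod.inr := by ext <;> simp
  have e' : 𝟙 (M.obj ⊞ (X ⊞ I)) = biprod.fst ≫ biprod.inl + biprod.snd ≫ biprod.inr :=
    biprod.total.symm
  let q : M ⟶ N := ObjectProperty.homMk (biprod.inl ≫ b)
  let r' : M ⟶ K := ObjectProperty.homMk (biprod.inl ≫ r)
  let j : N ⟶ M := ObjectProperty.homMk (t ≫ biprod.fst)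
  have h₀ : (T.idealP P n).proj.map (a ≫ q) = (T.idealP P n).proj.map 0 := by
    refine s.proj_map_eq_of_factors (-biprod.lift f i) (biprod.inr ≫ b) hXI ?_
    rw [e, Preadditive.add_comp, Category.assoc, Category.assoc] at hz
    change a.hom ≫ biprod.inl ≫ b = 0 + _
    rw [eq_neg_of_add_eq_zero_left hz, zero_add, Preadditive.neg_comp]
  have h₁ : (T.idealP P n).proj.map (a ≫ r') = (T.idealP P n).proj.map (𝟙 K) := by
    refine s.proj_map_eq_of_factors (-biprod.lift f i) (biprod.inr ≫ r) hXI ?_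
    rw [e, Preadditive.add_comp, Category.assoc, Category.assoc] at hr
    change a.hom ≫ biprod.inl ≫ r = 𝟙 K.obj + _
    rw [← hr, Preadditive.neg_comp, add_neg_cancel_right]
  have h₂ : (T.idealP P n).proj.map (j ≫ q) = (T.idealP P n).proj.map (𝟙 N) := by
    refine s.proj_map_eq_of_factors (-(t ≫ biprod.snd)) (biprod.inr ≫ b) hXI ?_
    have := congrArg (fun k => t ≫ k ≫ b) e'
    simp only [Preadditive.add_comp, Preadditive.comp_add, Category.id_comp, ht,
      Category.assoc] at this
    change (t ≫ biprod.fst) ≫ biprod.inl ≫ b = 𝟙 N.obj + _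
    rw [this, Preadditive.neg_comp, Category.assoc, Category.assoc, add_neg_cancel_right]
  have h₃ : r' ≫ a + q ≫ j = 𝟙 M := by
    refine ObjectProperty.hom_ext _ ?_
    have := congrArg (fun k => biprod.inl ≫ k ≫ biprod.fst) htot
    simp only [Preadditive.add_comp, Preadditive.comp_add, Category.id_comp, Category.assoc,
      biprod.lift_fst, biprod.inl_fst] at this
    change (biprod.inl ≫ r) ≫ a.hom + (biprod.inl ≫ b) ≫ t ≫ biprod.fst = 𝟙 M.obj
    rw [Category.assoc, Category.assoc, this]
  rw [Functor.map_comp, Functor.map_zero] at h₀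
  refine ⟨h₀, ⟨ShortComplex.Splitting.mk ((T.idealP P n).proj.map r') ((T.idealP P n).proj.map j)
    ?_ ?_ ?_⟩⟩
  · exact ((Functor.map_comp _ _ _).symm.trans h₁).trans (CategoryTheory.Functor.map_id _ _)
  · exact ((Functor.map_comp _ _ _).symm.trans h₂).trans (CategoryTheory.Functor.map_id _ _)
  · change (T.idealP P n).proj.map r' ≫ (T.idealP P n).proj.map a +
      (T.idealP P n).proj.map q ≫ (T.idealP P n).proj.map j = 𝟙 ((T.idealP P n).proj.obj M)
    rw [← Functor.map_comp, ← Functor.map_comp, ← Functor.map_add, h₃,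
      CategoryTheory.Functor.map_id]

/-- A morphism which is a split monomorphism modulo `[P]` is part of a split `E`-triangle, after
adding maps to an object of `P` and to an injective object. -/
theorem exists_realizes_of_retraction {K M : (T.res P (n + 1)).FullSubcategory} (a : K ⟶ M)
    (r : (T.idealP P n).proj.obj M ⟶ (T.idealP P n).proj.obj K)
    (hr : (T.idealP P n).proj.map a ≫ r = 𝟙 _) :
    ∃ (X I : C) (f : K.obj ⟶ X) (i : K.obj ⟶ I) (N : (T.res P (n + 1)).FullSubcategory)
      (b : M.obj ⊞ (X ⊞ I) ⟶ N.obj), P X ∧ T.injectives I ∧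
      T.Realizes (biprod.lift a.hom (biprod.lift f i)) b 0 := by
  obtain ⟨r, rfl⟩ := (T.idealP P n).proj.map_surjective r
  rw [← Functor.map_comp, ← CategoryTheory.Functor.map_id, HomIdeal.proj_map_eq_iff,
    s.mem_idealP_iff] at hr
  obtain ⟨X, f, t, hX, hft⟩ := hr
  have h : a.hom ≫ r.hom + (-f) ≫ t = 𝟙 K.obj := by
    have hft : f ≫ t = a.hom ≫ r.hom - 𝟙 K.obj := hft
    rw [Preadditive.neg_comp, hft]
    abel
  obtain ⟨I, i, N, b, hI, hN, h⟩ :=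
    s.exists_split_of_retraction a.hom (-f) r.hom t h K.property M.property hX
  exact ⟨X, I, -f, i, ⟨N, hN⟩, b, hX, hI, h⟩

/-- A split epimorphism `f` of `P^∧_{n+1}/[P]` has a kernel: a section `g` of `f` is a split
monomorphism, so it has a complement coming from a split `E`-triangle. -/
theorem isWeaklyIdempotentComplete : IsWeaklyIdempotentComplete (T.M₂ P n) := by
  rintro Y X f ⟨⟨g, hg⟩⟩
  obtain ⟨g', rfl⟩ := (T.idealP P n).proj.map_surjective (X := X.as) (Y := Y.as) g
  obtain ⟨Z, I, x, i, N, b, hZ, hI, h⟩ := s.exists_realizes_of_retraction g' f hg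
  obtain ⟨zero, ⟨σ⟩⟩ := s.exists_splitting g' hZ hI h
  set g : X ⟶ Y := (T.idealP P n).proj.map g'
  obtain ⟨N', q, j, r, hgr, hjq, hgq, htot⟩ : ∃ (N' : T.M₂ P n) (q : Y ⟶ N') (j : N' ⟶ Y)
      (r : Y ⟶ X), g ≫ r = 𝟙 X ∧ j ≫ q = 𝟙 N' ∧ g ≫ q = 0 ∧ r ≫ g + q ≫ j = 𝟙 Y :=
    ⟨_, _, σ.s, σ.r, σ.f_r, σ.s_g, zero, σ.id⟩
  -- the idempotent `1 - f g` splits through `N'` like `1 - r g = q j`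
  have hk : (j - j ≫ f ≫ g) ≫ f = 0 := by
    rw [Preadditive.sub_comp, Category.assoc, Category.assoc, hg, Category.comp_id, sub_self]
  have hkq : (j - j ≫ f ≫ g) ≫ q = 𝟙 N' := by
    rw [Preadditive.sub_comp, Category.assoc, Category.assoc, hgq, hjq]
    simp
  have hqk : q ≫ (j - j ≫ f ≫ g) = 𝟙 Y - f ≫ g := by
    have e : q ≫ j = 𝟙 Y - r ≫ g := eq_sub_of_add_eq' htot
    rw [Preadditive.comp_sub, ← Category.assoc q j, e, Preadditive.sub_comp, Category.id_comp,
      Category.assoc r, ← Category.assoc g, hg, Category.id_comp]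
    abel
  exact ⟨⟨⟨_, KernelFork.IsLimit.ofι (j - j ≫ f ≫ g) hk (fun k _ => k ≫ q)
    (fun k hk' => by
      rw [Category.assoc, hqk, Preadditive.comp_sub, ← Category.assoc, hk']; simp)
    (fun k _ m hm => by rw [← hm, Category.assoc, hkq, Category.comp_id])⟩⟩⟩

/-- The splitting conflations of `P^∧_{n+1}/[P]` are those whose first map is part of a split
`E`-triangle, after adding maps to an object of `P` and to an injective object. -/
theorem split_iff (h : T.GFactors P n) (K M N : (T.res P (n + 1)).FullSubcategory) (a : K ⟶ M)
    (b : M ⟶ N) (zero : (T.idealP P n).proj.map a ≫ (T.idealP P n).proj.map b = 0)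
    (hη : T.epsK h (ShortComplex.mk ((T.idealP P n).proj.map a) ((T.idealP P n).proj.map b)
      zero)) :
    splitConflations (T.epsK h) ⟨_, hη⟩ ↔
      ∃ (X I : C) (f : K.obj ⟶ X) (i : K.obj ⟶ I)
        (N' : (T.res P (n + 1)).FullSubcategory) (b' : M.obj ⊞ (X ⊞ I) ⟶ N'.obj),
        P X ∧ T.injectives I ∧
        T.Realizes (biprod.lift a.hom (biprod.lift f i)) b' 0 ∧
        IsConflation (fun R => R.ShortExact)
          ((T.functorK h).map ((T.idealP P n).proj.map
            (ObjectProperty.homMk (biprod.inl ≫ b') : M ⟶ N')).op)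
          ((T.functorK h).map ((T.idealP P n).proj.map a).op) ∧
        ∃ φ : (T.functorK h).obj (op ((T.idealP P n).proj.obj N')) ≅
            (T.functorK h).obj (op ((T.idealP P n).proj.obj N)),
          φ.hom ≫ (T.functorK h).map ((T.idealP P n).proj.map b).op =
            (T.functorK h).map ((T.idealP P n).proj.map
              (ObjectProperty.homMk (biprod.inl ≫ b') : M ⟶ N')).op := by
  have hF := s.isExactEmbedding h
  have hη' := hη
  rw [epsK_eq] at hη'
  constructor
  · rintro ⟨σ⟩
    obtain ⟨X, I, f, i, N', b', hX, hI, hs⟩ := s.exists_realizes_of_retraction a σ.r σ.f_r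
    obtain ⟨zero', ⟨σ'⟩⟩ := s.exists_splitting a hX hI hs
    have hσ : inducedClass (T.opK h) (ShortComplex.mk _ _ zero') := mem_inducedClass_of_splitting σ'
    -- both `b` and `b'` are cokernels of `a` modulo `[P]`
    obtain ⟨ψ, hψ⟩ := hF.exists_desc hη' _ zero'
    obtain ⟨ψ', hψ'⟩ := hF.exists_desc hσ _ zero
    have he := hF.epi_g hη'
    have he' := hF.epi_g hσ
    let e : (T.idealP P n).proj.obj N ≅ (T.idealP P n).proj.obj N' :=
      { hom := ψ
        inv := ψ'
        hom_inv_id := by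
          refine he.left_cancellation _ _ ?_
          exact ((Category.assoc _ _ _).symm.trans (congrArg (· ≫ ψ') hψ)).trans
            (hψ'.trans (Category.comp_id _).symm)
        inv_hom_id := by
          refine he'.left_cancellation _ _ ?_
          exact ((Category.assoc _ _ _).symm.trans (congrArg (· ≫ ψ) hψ')).trans
            (hψ.trans (Category.comp_id _).symm) }
    refine ⟨X, I, f, i, N', b', hX, hI, hs, ?_, (T.functorK h).mapIso e.op, ?_⟩
    · rw [← epsK_eq] at hσ
      exact hσ
    · change (T.functorK h).map ψ.op ≫ _ = _
      rw [← Functor.map_comp, ← op_comp]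
      exact congrArg (fun t => (T.functorK h).map t.op) hψ
  · rintro ⟨X, I, f, i, N', b', hX, hI, hs, -, -⟩
    obtain ⟨zero', ⟨σ'⟩⟩ := s.exists_splitting a hX hI hs
    exact hF.split_of_retraction hη' σ'.r σ'.f_r

end RigidSetting

end Extriangulation

end ConflationQuotient

theorem mainTheorem9 {C : Type u} [SmallCategory C] [Preadditive C] [HasZeroObject C]
    [HasBinaryBiproducts C] (T : Extriangulation C) (hinj : T.EnoughInjectives)
    (n : ℕ) (P : ObjectProperty C) (hadd : P = add P) (hrigid : T.IsRigid (n + 2) P)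
    (hP : T.injectives ≤ P) :
    -- the functor `𝕂` is well defined on `P^∧_{n+1}/[P]`
    ∃ h : T.GFactors P n,
      -- `(M₂, ε_𝕂)` is a weakly idempotent complete exact category
      IsExactCategory (T.epsK h) ∧ IsWeaklyIdempotentComplete (T.M₂ P n) ∧
      -- `𝕂` is an exact duality from `M₂` onto `𝓛ⁿ_P`
      (T.functorK h).Full ∧ (T.functorK h).Faithful ∧
      (T.functorK h).essImage = T.classL P n ∧
      -- the category of conflations of `M₂` is exact
      IsExactCategory (degreewise (T.epsK h)) ∧
      -- (a)
      IsPseudoClusterTilting (degreewise (T.epsK h)) (splitConflations (T.epsK h)) ∧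
      resDimLE (IsConflation (degreewise (T.epsK h))) (splitConflations (T.epsK h)) 1 = ⊤ ∧
      coresDimLE (IsConflation (degreewise (T.epsK h))) (splitConflations (T.epsK h)) 1 = ⊤ ∧
      -- (b)
      Nonempty (Abelian (HomIdeal.ofObjects (splitConflations (T.epsK h))).Quot) ∧
      -- (c)
      ∀ (K M N : (T.res P (n + 1)).FullSubcategory) (a : K ⟶ M) (b : M ⟶ N)
        (zero : (T.idealP P n).proj.map a ≫ (T.idealP P n).proj.map b = 0)
        (hη : T.epsK h (ShortComplex.mk ((T.idealP P n).proj.map a) ((T.idealP P n).proj.map b)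
          zero)),
        splitConflations (T.epsK h) ⟨_, hη⟩ ↔
          ∃ (X I : C) (f : K.obj ⟶ X) (i : K.obj ⟶ I)
            (N' : (T.res P (n + 1)).FullSubcategory) (b' : M.obj ⊞ (X ⊞ I) ⟶ N'.obj),
            P X ∧ T.injectives I ∧
            T.Realizes (biprod.lift a.hom (biprod.lift f i)) b' 0 ∧
            -- the upper row of the diagram is a conflation
            IsConflation (fun R => R.ShortExact)
              ((T.functorK h).map ((T.idealP P n).proj.map
                (ObjectProperty.homMk (biprod.inl ≫ b') : M ⟶ N')).op)
              ((T.functorK h).map ((T.idealP P n).proj.map a).op) ∧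
            -- the vertical isomorphism makes the left square commute
            ∃ φ : (T.functorK h).obj (op ((T.idealP P n).proj.obj N')) ≅
                (T.functorK h).obj (op ((T.idealP P n).proj.obj N)),
              φ.hom ≫ (T.functorK h).map ((T.idealP P n).proj.map b).op =
                (T.functorK h).map ((T.idealP P n).proj.map
                  (ObjectProperty.homMk (biprod.inl ≫ b') : M ⟶ N')).op := by
  have s : T.RigidSetting n P := ⟨hinj, hadd, hrigid, hP⟩
  have h := s.gFactors
  have hF := s.isExactEmbedding h
  have hε := Extriangulation.epsK_eq h
  refine ⟨h, ?_, s.isWeaklyIdempotentComplete, s.functorK_full h, s.functorK_faithful h,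
    s.essImage_functorK h, ?_, ?_, ?_, ?_, ?_, s.split_iff h⟩
  all_goals rw [hε]
  · exact hF.isExactCategory
  · exact hF.isExactCategory_degreewise
  · exact hF.isPseudoClusterTilting
  · exact hF.isPseudoClusterTilting.resDimLE_eq_top
  · exact hF.isPseudoClusterTilting.coresDimLE_eq_top
  · exact hF.nonempty_abelian_quot
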